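/- **Setting.** Let $n\ge 1$ and work throughout either in the $C^\infty$-smooth category or in the $\mathbb R$-analytic category; all germs are at $0\in\mathbb R^{2n}$. A germ of a closed $2$-form $\omega$ on $\mathbb R^{2n}$ is *singular symplectic* if its *Martinet hypersurface* $\Sigma_2(\omega)=\{p:\ \omega^n|_p=0\}$ is nowhere dense. Write $\omega^n=f\,\Omega$ with $\Omega$ a volume form-germ; $\Sigma_2(\omega)=\{f=0\}$ is *structurally smooth at $0$* if $f(0)=0$ and $df|_0\neq 0$. In that case let $\iota:\Sigma_2(\omega)\hookrightarrow\mathbb R^{2n}$ be the inclusion. The *canonical orientation* of $\Sigma_2(\omega)$ is the one given by the volume form $\Omega_{\Sigma_2}$ on $\Sigma_2(\omega)$ with $df\wedge\Omega_{\Sigma_2}=\omega^n/f$, where $f$ is any function-germ with $\Sigma_2(\omega)=\{f=0\}$ and $df|_0\ne 0$ (the orientation does not depend on $f$). Put $\ker\omega^{n-1}|_0=\{v\in T_0\mathbb R^{2n}:\ v\rfloor(\omega^{n-1}|_0)=0\}$. **Theorem.** Let $\omega_0,\omega_1$ be germs of smooth ($\mathbb R$-analytic) singular symplectic forms on $\mathbb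 R^{2n}$ with Martinet hypersurfaces structurally smooth at $0$. 1. Suppose that $\omega_0$ and $\omega_1$ have a common Martinet hypersurface $\Sigma_2$ and that $\operatorname{rank}(\iota^*\omega_0|_0)=\operatorname{rank}(\iota^*\omega_1|_0)\le 2n-2$. If the canonical orientations of $\Sigma_2$ defined by $\omega_0$ and $\omega_1$ are the same, $\iota^*\omega_0=\iota^*\omega_1$ and $\ker\omega_0^{n-1}|_0=\ker\omega_1^{n-1}|_0$, then there exists a smooth ($\mathbb R$-analytic) diffeomorphism-germ $\Psi:(\mathbb R^{2n},0)\to(\mathbb R^{2n},0)$ such that $\Psi^*\omega_1=\omega_0$. 2. Consequently the Martinet hypersurface, the pullback of the form to it, its canonical orientation and the kernel of $\omega^{n-1}|_0$ form a complete set of local invariants. That is: every smooth ($\mathbb R$-analytic) diffeomorphism-germ $\Psi$ of $(\mathbb R^{2n},0)$ with $\Psi^*\omega_1=\omega_0$ carries these four data of $\omega_0$ to those of $\omega_1$; and, conversely, if some smooth ($\mathbb R$-analytic) diffeomorphism-germ $\Phi$ of $(\mathbb R^{2n},0)$ carries these four data of $\omega_0$ to those of $\omega_1$, then there is a smooth ($\mathbb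 R$-analytic) diffeomorphism-germ $\Psi$ of $(\mathbb R^{2n},0)$ with $\Psi^*\omega_1=\omega_0$. -/

import Mathlib

open Filter Topology

namespace SingularSymplectic

/-- The space `ℝ^{2n}`. -/
abbrev Space (n : ℕ) : Type := EuclideanSpace ℝ (Fin (2 * n))

/-- The two real categories: `C^∞`-smooth and `ℝ`-analytic. -/
inductive Category
  | smooth
  | analytic

/-- The order of differentiability of a category in Mathlib's scale, in which `(⊤ : ℕ∞)` is `C^∞`
and `⊤` is analytic. -/
def Category.order : Category → WithTop ℕ∞
  | .smooth => ((⊤ : ℕ∞) : WithTop ℕ∞)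
  | .analytic => ⊤

/-! Germs at `0` are represented by everywhere defined maps; every notion below depends only on the
values near `0`. -/

/-- `f` is smooth (resp. analytic) on a neighbourhood of `0`. -/
def IsRegularGerm {E F : Type*} [NormedAddCommGroup E] [NormedSpace ℝ E]
    [NormedAddCommGroup F] [NormedSpace ℝ F] (c : Category) (f : E → F) : Prop :=
  ∀ᶠ x in 𝓝 (0 : E), ContDiffAt ℝ c.order f x

/-- The exterior product of alternating forms, normalised so that
`(α ∧ β)(v) = ∑ sign(s) α(v_{s(1)}, …, v_{s(k)}) β(v_{s(k+1)}, …, v_{s(k+l)})`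
with the sum over all `(k, l)`-shuffles `s`. -/
noncomputable def wedge {V : Type*} [AddCommGroup V] [Module ℝ V] {k l : ℕ}
    (α : V [⋀^Fin k]→ₗ[ℝ] ℝ) (β : V [⋀^Fin l]→ₗ[ℝ] ℝ) : V [⋀^Fin (k + l)]→ₗ[ℝ] ℝ :=
  ((LinearMap.mul' ℝ ℝ).compAlternatingMap (α.domCoprod β)).domDomCongr finSumFinEquiv

/-- The exterior power `α^k = α ∧ ⋯ ∧ α` of a 2-form. -/
noncomputable def formPow {V : Type*} [AddCommGroup V] [Module ℝ V]
    (α : V [⋀^Fin 2]→ₗ[ℝ] ℝ) : (k : ℕ) → V [⋀^Fin (2 * k)]→ₗ[ℝ] ℝ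
  | 0 => AlternatingMap.constOfIsEmpty ℝ V (Fin 0) 1
  | k + 1 => wedge (formPow α k) α

/-- The kernel `{v | v ⌟ α = 0}` of an alternating form: the vectors which, put in any slot,
make the form vanish. (For a form of degree `0` this is the whole space.) -/
def formKer {V : Type*} [AddCommGroup V] [Module ℝ V] {k : ℕ}
    (α : V [⋀^Fin k]→ₗ[ℝ] ℝ) : Submodule ℝ V where
  carrier := {v | ∀ (i : Fin k) (w : Fin k → V), α (Function.update w i v) = 0}
  zero_mem' := fun i w => α.map_update_zero w i
  add_mem' := by
    intro a b ha hb i w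
    rw [α.map_update_add, ha i w, hb i w, add_zero]
  smul_mem' := by
    intro r a ha i w
    rw [α.map_update_smul, ha i w, smul_zero]

/-- The rank of a 2-form: the rank of the linear map `v ↦ v ⌟ α`. -/
noncomputable def formRank {V : Type*} [NormedAddCommGroup V] [NormedSpace ℝ V]
    (α : V [⋀^Fin 2]→L[ℝ] ℝ) : ℕ :=
  Module.finrank ℝ
    (LinearMap.range (α.curryLeft : V →L[ℝ] V [⋀^Fin 1]→L[ℝ] ℝ).toLinearMap)

/-- A germ at `0` of a differential 2-form on `ℝ^{2n}`, given by a representative. -/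
abbrev TwoForm (n : ℕ) : Type := Space n → Space n [⋀^Fin 2]→L[ℝ] ℝ

/-- The value at `x` of the exterior power `ω^k`. -/
noncomputable def powAt {n : ℕ} (ω : TwoForm n) (k : ℕ) (x : Space n) :
    Space n [⋀^Fin (2 * k)]→ₗ[ℝ] ℝ :=
  formPow (ω x).toAlternatingMap k

/-- The Martinet hypersurface `Σ₂(ω) = {x | ω^n|_x = 0}`. -/
def martinet {n : ℕ} (ω : TwoForm n) : Set (Space n) := {x | powAt ω n x = 0}

/-- `ω` is the germ at `0` of a smooth (resp. analytic) singular symplectic form: it is regular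
and closed near `0`, and its degeneracy set is nowhere dense near `0`. -/
structure IsSingularSymplectic {n : ℕ} (c : Category) (ω : TwoForm n) : Prop where
  regular : IsRegularGerm c ω
  closed : ∀ᶠ x in 𝓝 (0 : Space n), extDeriv ω x = 0
  nowhereDense : ∃ U ∈ 𝓝 (0 : Space n), IsNowhereDense (U ∩ martinet ω)

/-- The standard basis of `ℝ^{2n}`. -/
noncomputable def stdBasis (n : ℕ) : Module.Basis (Fin (2 * n)) ℝ (Space n) :=
  (EuclideanSpace.basisFun (Fin (2 * n)) ℝ).toBasis

/-- The function `f` with `ω^n = f Ω`, where `Ω = dx₁ ∧ ⋯ ∧ dx_{2n}`; see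
`powAt_eq_martinetFun_smul`. -/
noncomputable def martinetFun {n : ℕ} (ω : TwoForm n) (x : Space n) : ℝ :=
  powAt ω n x (stdBasis n)

theorem powAt_eq_martinetFun_smul {n : ℕ} (ω : TwoForm n) (x : Space n) :
    powAt ω n x = martinetFun ω x • (stdBasis n).det :=
  AlternatingMap.eq_smul_basis_det _ _

/-- The Martinet hypersurface is structurally smooth at `0`: `ω^n = f Ω` with `f(0) = 0` and
`df|₀ ≠ 0`. -/
structure StructurallySmooth {n : ℕ} (ω : TwoForm n) : Prop where
  apply_zero : martinetFun ω 0 = 0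
  fderiv_ne_zero : fderiv ℝ (martinetFun ω) 0 ≠ 0

/-- The tangent space at `p` of the Martinet hypersurface `{f = 0}` (where `df|_p ≠ 0`),
namely `ker df|_p`. -/
noncomputable def tangent {n : ℕ} (ω : TwoForm n) (p : Space n) : Submodule ℝ (Space n) :=
  LinearMap.ker (fderiv ℝ (martinetFun ω) p).toLinearMap

/-- The value at a point `p` of `Σ₂(ω)` of the pullback `ι^*ω` of `ω` to `Σ₂(ω)`. -/
noncomputable def restrictAt {n : ℕ} (ω : TwoForm n) (p : Space n) :
    tangent ω p [⋀^Fin 2]→L[ℝ] ℝ :=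
  (ω p).compContinuousLinearMap (tangent ω p).subtypeL

/-- The kernel of `ω^{n-1}|₀`. -/
noncomputable def kerAtZero {n : ℕ} (ω : TwoForm n) : Submodule ℝ (Space n) :=
  formKer (powAt ω (n - 1) 0)

/-- A linear functional as an alternating 1-form. -/
noncomputable def oneForm {V : Type*} [AddCommGroup V] [Module ℝ V] (φ : V →ₗ[ℝ] ℝ) :
    V [⋀^Fin 1]→ₗ[ℝ] ℝ :=
  AlternatingMap.ofSubsingleton ℝ V ℝ (0 : Fin 1) φ

theorem one_add_two_mul_sub_one {n : ℕ} (hn : 1 ≤ n) : 1 + (2 * n - 1) = 2 * n := by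
  omega

/-- `f` is a function-germ with `Σ₂(ω) = {f = 0}` and `df|₀ ≠ 0`, and `Θ` is a
`(2n-1)`-form-germ with `df ∧ Θ = ω^n / f`. The restriction of `Θ` to `Σ₂(ω)` is then the volume
form `Ω_{Σ₂}` which defines the canonical orientation. -/
structure IsCanonicalVolume {n : ℕ} (c : Category) (hn : 1 ≤ n) (ω : TwoForm n)
    (f : Space n → ℝ) (Θ : Space n → Space n [⋀^Fin (2 * n - 1)]→L[ℝ] ℝ) : Prop where
  regular_fun : IsRegularGerm c f
  zero_iff : ∀ᶠ x in 𝓝 (0 : Space n), f x = 0 ↔ x ∈ martinet ω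
  fderiv_ne_zero : fderiv ℝ f 0 ≠ 0
  regular_form : IsRegularGerm c Θ
  eq_pow : ∀ᶠ x in 𝓝 (0 : Space n),
    f x • (wedge (oneForm (fderiv ℝ f x).toLinearMap) (Θ x).toAlternatingMap).domDomCongr
      (finCongr (one_add_two_mul_sub_one hn)) = powAt ω n x

/-- `ω₀` and `ω₁` define the same canonical orientation of their common Martinet hypersurface:
at its points near `0` the same frames are positively oriented for both. -/
def SameOrientation {n : ℕ} (c : Category) (hn : 1 ≤ n) (ω₀ ω₁ : TwoForm n) : Prop :=
  ∃ f₀ Θ₀ f₁ Θ₁, IsCanonicalVolume c hn ω₀ f₀ Θ₀ ∧ IsCanonicalVolume c hn ω₁ f₁ Θ₁ ∧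
    ∀ᶠ p in 𝓝 (0 : Space n), p ∈ martinet ω₀ →
      ∀ e : Fin (2 * n - 1) → Space n, (∀ i, e i ∈ tangent ω₀ p) →
        (0 < Θ₀ p e ↔ 0 < Θ₁ p e)

/-- `ι^*ω₀ = ι^*ω₁` on the common Martinet hypersurface. -/
def SamePullback {n : ℕ} (ω₀ ω₁ : TwoForm n) : Prop :=
  ∀ᶠ p in 𝓝 (0 : Space n), p ∈ martinet ω₀ →
    ∀ u ∈ tangent ω₀ p, ∀ v ∈ tangent ω₀ p, ω₀ p ![u, v] = ω₁ p ![u, v]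

/-- `Φ` is a smooth (resp. analytic) diffeomorphism-germ `(ℝ^{2n}, 0) → (ℝ^{2n}, 0)`. -/
def IsDiffeoGerm {n : ℕ} (c : Category) (Φ : Space n → Space n) : Prop :=
  Φ 0 = 0 ∧ IsRegularGerm c Φ ∧ ∃ Φ' : Space n → Space n, Φ' 0 = 0 ∧ IsRegularGerm c Φ' ∧
    (∀ᶠ x in 𝓝 (0 : Space n), Φ' (Φ x) = x) ∧ ∀ᶠ x in 𝓝 (0 : Space n), Φ (Φ' x) = x

/-- The pullback `Φ^*ω`. -/
noncomputable def pullback {n : ℕ} (Φ : Space n → Space n) (ω : TwoForm n) : TwoForm n :=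
  fun x => (ω (Φ x)).compContinuousLinearMap (fderiv ℝ Φ x)

/-- The germs of `ω₀` and `ω₁` are equivalent. -/
def Equivalent {n : ℕ} (c : Category) (ω₀ ω₁ : TwoForm n) : Prop :=
  ∃ Ψ : Space n → Space n, IsDiffeoGerm c Ψ ∧ pullback Ψ ω₁ =ᶠ[𝓝 0] ω₀

/-- The diffeomorphism-germ `Φ` carries the data (Martinet hypersurface, pullback to it, its
canonical orientation, kernel of the `(n-1)`-st power at `0`) of `ω₀` to those of `ω₁`. -/
structure CarriesData {n : ℕ} (c : Category) (hn : 1 ≤ n) (Φ : Space n → Space n)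
    (ω₀ ω₁ : TwoForm n) : Prop where
  hypersurface : ∀ᶠ x in 𝓝 (0 : Space n), x ∈ martinet ω₀ ↔ Φ x ∈ martinet ω₁
  form : ∀ᶠ p in 𝓝 (0 : Space n), p ∈ martinet ω₀ →
    ∀ u ∈ tangent ω₀ p, ∀ v ∈ tangent ω₀ p,
      ω₀ p ![u, v] = ω₁ (Φ p) ![fderiv ℝ Φ p u, fderiv ℝ Φ p v]
  orientation : ∃ f₀ Θ₀ f₁ Θ₁,
    IsCanonicalVolume c hn ω₀ f₀ Θ₀ ∧ IsCanonicalVolume c hn ω₁ f₁ Θ₁ ∧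
    ∀ᶠ p in 𝓝 (0 : Space n), p ∈ martinet ω₀ →
      ∀ e : Fin (2 * n - 1) → Space n, (∀ i, e i ∈ tangent ω₀ p) →
        (0 < Θ₀ p e ↔ 0 < Θ₁ (Φ p) (fun i => fderiv ℝ Φ p (e i)))
  kernel : (kerAtZero ω₀).map (fderiv ℝ Φ 0).toLinearMap = kerAtZero ω₁

end SingularSymplectic

/-! The proof is Moser's path method along ω_t = ω₀ + t(ω₁ - ω₀), carried out after the common
hypersurface has been straightened to a hyperplane ℓ = 0 and the two forms have been made equal at
0.

Linear algebra at 0. A 2-form on an even-dimensional space has even corank, and its Gram determinant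
is a constant times the square of its top power f. Since f vanishes only to first order, the corank
at 0 is exactly 2 (`finrank_formKer_eq_two`), so the kernel of ω^(n-1) at 0 is the kernel of ω at 0
(`kerAtZero_eq_formKer`). Equal kernels together with equal restrictions to the tangent hyperplane
give a linear isomorphism that fixes the hyperplane and pulls ω₁(0) back to ω₀(0)
(`exists_vector_of_same_kernel`). Equal canonical orientations make df₀ and df₁ positively
proportional at 0 (`exists_pos_of_orientation`).

The homotopy. The form ω₁ - ω₀ is closed and restricts to zero on ℓ = 0, hence equals d(ℓα), with
α(0) = 0 (`exists_primitive_of_closed`). The Moser equation Y ⌟ ω_t = -ℓα can be solved across the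
degeneracy locus. Every ω_t is degenerate on the hyperplane (`degenerate_segment`), so f_t = ℓg; the
corank there is at least 2, so the adjugate of the Gram matrix G is ℓP. Cancelling one ℓ in adj(G)·G
= det(G)·1 leaves PG = dℓg²·1 with d a nonzero constant, and Y is regular where g ≠ 0
(`exists_vectorField`). Because the forms agree at 0, df_t is there a convex combination of df₀ and
df₁, so g(0) ≠ 0 for all t in [0, 1]. The flow of Y fixes the origin and, for short times,
identifies nearby members of the path; connectedness of [0, 1] links ω₀ to ω₁
(`equivalent_of_eq_at_zero`).

Both categories at once. Parameter integrals and solutions of differential equations are expressed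
through γ ↦ g ∘ γ on the Banach space of continuous curves. Near a constant curve this operator is
smooth or analytic as g is (`regularAt_superpose`), and flows come from the inverse function theorem
in that space (`exists_regular_flow`). -/

set_option linter.unusedSectionVars false

namespace SingularSymplectic

/-! ### Superposition operators on spaces of continuous maps -/

section Superposition

variable {K : Type} [TopologicalSpace K] [CompactSpace K]
variable {F G : Type} [NormedAddCommGroup F] [NormedSpace ℝ F] [NormedAddCommGroup G]
  [NormedSpace ℝ G]

open Classical in
/-- The superposition operator `γ ↦ g ∘ γ` on continuous maps (zero where `g ∘ γ` is not
continuous). -/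
noncomputable def superpose (g : F → G) (γ : C(K, F)) : C(K, G) :=
  if h : Continuous (fun s => g (γ s)) then ⟨fun s => g (γ s), h⟩ else 0

theorem superpose_apply_of_continuous {g : F → G} {γ : C(K, F)}
    (h : Continuous (fun s => g (γ s))) (s : K) : superpose g γ s = g (γ s) := by
  simp [superpose, h]

theorem superpose_apply {g : F → G} {U : Set F} (hU : IsOpen U) (hg : ContinuousOn g U)
    {γ : C(K, F)} (hγ : ∀ s, γ s ∈ U) (s : K) : superpose g γ s = g (γ s) := by
  refine superpose_apply_of_continuous ?_ s
  rw [continuous_iff_continuousAt]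
  intro s
  exact ContinuousAt.comp (f := γ) (hg.continuousAt (hU.mem_nhds (hγ s))) γ.continuous.continuousAt

/-- Pointwise application of a continuous family of operators. -/
noncomputable def pointwiseApply :
    C(K, F →L[ℝ] G) →L[ℝ] C(K, F) →L[ℝ] C(K, G) :=
  LinearMap.mkContinuous₂
    (LinearMap.mk₂ ℝ (fun (A : C(K, F →L[ℝ] G)) (h : C(K, F)) =>
      (⟨fun s => A s (h s), A.continuous.clm_apply h.continuous⟩ : C(K, G)))
      (by intros; ext; simp) (by intros; ext; simp) (by intros; ext; simp) (by intros; ext; simp))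
    1 (by
      intro A h
      rw [one_mul, ContinuousMap.norm_le _ (by positivity)]
      intro s
      refine ((A s).le_opNorm (h s)).trans ?_
      exact mul_le_mul (A.norm_coe_le_norm s) (h.norm_coe_le_norm s) (norm_nonneg _)
        (by positivity))

@[simp]
theorem pointwiseApply_apply (A : C(K, F →L[ℝ] G)) (h : C(K, F)) (s : K) :
    pointwiseApply A h s = A s (h s) := rfl

theorem isOpen_setOf_forall_mem {U : Set F} (hU : IsOpen U) :
    IsOpen {γ : C(K, F) | ∀ s, γ s ∈ U} := by
  have := ContinuousMap.isOpen_setOfPred_mapsTo (X := K) (isCompact_univ) hU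
  simpa [Set.MapsTo] using this

/-- The image of γ is compact, so one radius δ serves every parameter s. This uniformity turns
pointwise estimates into estimates in the supremum norm. -/
theorem exists_ball_of_compact {U : Set F} (hU : IsOpen U) {g : F → G} (hg : ContinuousOn g U)
    {γ : C(K, F)} (hγ : ∀ s, γ s ∈ U) {ε : ℝ} (hε : 0 < ε) :
    ∃ δ > 0, ∀ s, Metric.ball (γ s) δ ⊆ U ∧ ∀ y ∈ Metric.ball (γ s) δ, ‖g y - g (γ s)‖ < ε := by
  have hc : IsCompact (Set.range γ) := isCompact_range γ.continuous
  obtain ⟨δ₁, hδ₁, h₁⟩ := hc.exists_thickening_subset_open hU (Set.range_subset_iff.2 hγ)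
  have h2 := hc.uniformContinuousAt_of_continuousAt g
    (by rintro _ ⟨s, rfl⟩; exact hg.continuousAt (hU.mem_nhds (hγ s))) (Metric.dist_mem_uniformity hε)
  obtain ⟨δ₂, hδ₂, h₂⟩ := Metric.mem_uniformity_dist.1 h2
  refine ⟨min δ₁ δ₂, lt_min hδ₁ hδ₂, fun s => ⟨fun y hy => ?_, fun y hy => ?_⟩⟩
  · refine h₁ (Metric.mem_thickening_iff.2 ⟨γ s, ⟨s, rfl⟩, ?_⟩)
    exact (Metric.mem_ball.1 hy).trans_le (min_le_left _ _)
  · have := @h₂ (γ s) y (by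
      rw [dist_comm]; exact (Metric.mem_ball.1 hy).trans_le (min_le_right _ _)) ⟨s, rfl⟩
    rw [← dist_eq_norm, dist_comm]
    exact this

theorem continuousOn_superpose {U : Set F} (hU : IsOpen U) {g : F → G} (hg : ContinuousOn g U) :
    ContinuousOn (superpose g) {γ : C(K, F) | ∀ s, γ s ∈ U} := by
  intro γ hγ
  refine ContinuousAt.continuousWithinAt ?_
  rw [Metric.continuousAt_iff]
  intro ε hε
  obtain ⟨δ, hδ, h⟩ := exists_ball_of_compact hU hg hγ (half_pos hε)
  refine ⟨δ, hδ, fun {η} hη => ?_⟩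
  have hηs : ∀ s, η s ∈ Metric.ball (γ s) δ := fun s =>
    (ContinuousMap.dist_apply_le_dist s).trans_lt hη
  refine lt_of_le_of_lt ?_ (half_lt_self hε)
  rw [ContinuousMap.dist_le (half_pos hε).le]
  intro s
  rw [superpose_apply hU hg (fun s => (h s).1 (hηs s)), superpose_apply hU hg hγ, dist_eq_norm]
  exact ((h s).2 _ (hηs s)).le

/-- The mean value inequality is applied at each s on a ball where `fderiv ℝ g` oscillates by less
than ε; since the radius does not depend on s, the error is o(‖η - γ‖) in the supremum norm. -/
theorem hasFDerivAt_superpose {U : Set F} (hU : IsOpen U) {g : F → G}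
    (hd : DifferentiableOn ℝ g U) (hg : ContinuousOn (fderiv ℝ g) U) {γ : C(K, F)}
    (hγ : ∀ s, γ s ∈ U) :
    HasFDerivAt (superpose g) (pointwiseApply (superpose (fderiv ℝ g) γ)) γ := by
  refine HasFDerivAt.of_isLittleO (Asymptotics.isLittleO_iff.2 fun ε hε => ?_)
  obtain ⟨δ, hδ, h⟩ := exists_ball_of_compact hU hg hγ hε
  filter_upwards [Metric.ball_mem_nhds γ hδ] with η hη
  have hηs : ∀ s, η s ∈ Metric.ball (γ s) δ := fun s =>
    (ContinuousMap.dist_apply_le_dist s).trans_lt hη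
  rw [ContinuousMap.norm_le _ (by positivity)]
  intro s
  have hdiff : ∀ y ∈ Metric.ball (γ s) δ,
      HasFDerivWithinAt g (fderiv ℝ g y) (Metric.ball (γ s) δ) y := fun y hy =>
    ((hd.differentiableAt (hU.mem_nhds ((h s).1 hy))).hasFDerivAt).hasFDerivWithinAt
  have key := (convex_ball (γ s) δ).norm_image_sub_le_of_norm_hasFDerivWithin_le' hdiff
    (fun y hy => ((h s).2 y hy).le) (Metric.mem_ball_self hδ) (hηs s)
  simp only [ContinuousMap.sub_apply, pointwiseApply_apply]
  rw [superpose_apply hU hd.continuousOn (fun s => (h s).1 (hηs s)),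
    superpose_apply hU hd.continuousOn hγ, superpose_apply hU hg hγ]
  refine key.trans (mul_le_mul_of_nonneg_left ?_ hε.le)
  exact (η - γ).norm_coe_le_norm s

end Superposition

/-- The derivative of a superposition operator is the superposition operator of the derivative,
followed by a fixed continuous linear map. The induction therefore changes the target space, and G
is quantified inside. -/
theorem contDiffOn_superpose_nat {K : Type} [TopologicalSpace K] [CompactSpace K] {F : Type}
    [NormedAddCommGroup F] [NormedSpace ℝ F] {U : Set F} (hU : IsOpen U) (k : ℕ) :
    ∀ {G : Type} [NormedAddCommGroup G] [NormedSpace ℝ G] {g : F → G},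
      ContDiffOn ℝ k g U →
        ContDiffOn ℝ k (superpose g) {γ : C(K, F) | ∀ s, γ s ∈ U} := by
  induction k with
  | zero =>
    intro G _ _ g hg
    simp only [Nat.cast_zero, contDiffOn_zero] at hg ⊢
    exact continuousOn_superpose hU hg
  | succ k ih =>
    intro G _ _ g hg
    have hg' := (contDiffOn_succ_iff_fderiv_of_isOpen (n := (k : WithTop ℕ∞)) hU).1
      (by exact_mod_cast hg)
    have hder : ∀ γ ∈ {γ : C(K, F) | ∀ s, γ s ∈ U},
        HasFDerivAt (superpose g) (pointwiseApply (superpose (fderiv ℝ g) γ)) γ :=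
      fun γ hγ => hasFDerivAt_superpose hU hg'.1 hg'.2.2.continuousOn hγ
    have : ContDiffOn ℝ ((k : WithTop ℕ∞) + 1) (superpose g) {γ : C(K, F) | ∀ s, γ s ∈ U} := by
      rw [contDiffOn_succ_iff_fderiv_of_isOpen (isOpen_setOf_forall_mem hU)]
      refine ⟨fun γ hγ => (hder γ hγ).differentiableAt.differentiableWithinAt,
        fun h => absurd h (by simp), ?_⟩
      refine ContDiffOn.congr ?_ (fun γ hγ => (hder γ hγ).fderiv)
      exact pointwiseApply.contDiff.comp_contDiffOn (ih hg'.2.2)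
    exact_mod_cast this

/-! ### Analyticity of superposition at constant curves -/

section Analytic

variable {K : Type} [TopologicalSpace K] [CompactSpace K]
variable {F G : Type} [NormedAddCommGroup F] [NormedSpace ℝ F] [NormedAddCommGroup G]
  [NormedSpace ℝ G]

theorem update_eval {m : ℕ} [DecidableEq (Fin m)] (h : Fin m → C(K, F)) (i : Fin m) (a : C(K, F))
    (s : K) : (fun j => Function.update h i a j s) = Function.update (fun j => h j s) i (a s) := by
  funext j
  by_cases hj : j = i
  · subst hj; simp
  · simp [hj]

/-- Pointwise application of a continuous multilinear map to continuous maps. -/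
noncomputable def pointwiseMultilinear {m : ℕ} (p : F [×m]→L[ℝ] G) :
    C(K, F) [×m]→L[ℝ] C(K, G) :=
  MultilinearMap.mkContinuous
    { toFun := fun h => (⟨fun s => p (fun i => h i s), p.cont.comp
        (continuous_pi fun i => (h i).continuous)⟩ : C(K, G))
      map_update_add' := by
        intro _ h i a b
        ext s
        have := p.map_update_add (fun j => h j s) i (a s) (b s)
        simpa only [ContinuousMap.coe_mk, ContinuousMap.add_apply, update_eval] using this
      map_update_smul' := by
        intro _ h i c a
        ext s
        have := p.map_update_smul (fun j => h j s) i c (a s)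
        simpa only [ContinuousMap.coe_mk, ContinuousMap.smul_apply, update_eval] using this }
    ‖p‖ (by
      intro h
      rw [ContinuousMap.norm_le _ (by positivity)]
      intro s
      refine (p.le_opNorm _).trans (mul_le_mul_of_nonneg_left ?_ (norm_nonneg _))
      exact Finset.prod_le_prod (fun _ _ => norm_nonneg _) fun i _ => (h i).norm_coe_le_norm s)

theorem norm_pointwiseMultilinear_le {m : ℕ} (p : F [×m]→L[ℝ] G) :
    ‖(pointwiseMultilinear p : C(K, F) [×m]→L[ℝ] C(K, G))‖ ≤ ‖p‖ :=
  MultilinearMap.mkContinuous_norm_le _ (norm_nonneg _) _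

/-- At a constant curve one power series of g serves all parameters: its coefficients act pointwise,
their norms do not grow, and so the radius does not shrink. -/
theorem analyticAt_superpose_const [CompleteSpace G] {g : F → G} {y : F}
    (hg : AnalyticAt ℝ g y) :
    AnalyticAt ℝ (superpose g) (ContinuousMap.const K y) := by
  obtain ⟨p, r, hp⟩ := hg
  refine ⟨fun m => pointwiseMultilinear (p m), r, ?_⟩
  have hrad : p.radius ≤ FormalMultilinearSeries.radius
      (fun m => (pointwiseMultilinear (p m) : C(K, F) [×m]→L[ℝ] C(K, G))) := by
    refine ENNReal.le_of_forall_nnreal_lt fun ρ hρ => ?_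
    obtain ⟨C, -, hC⟩ := p.norm_mul_pow_le_of_lt_radius hρ
    refine FormalMultilinearSeries.le_radius_of_bound _ C fun m => ?_
    exact (mul_le_mul_of_nonneg_right (norm_pointwiseMultilinear_le _) (by positivity)).trans (hC m)
  refine ⟨hp.r_le.trans hrad, hp.r_pos, fun {h} hh => ?_⟩
  have hmem : ∀ s, h s ∈ Metric.eball (0 : F) r := by
    intro s
    rw [Metric.mem_eball, edist_zero_right] at hh ⊢
    refine lt_of_le_of_lt ?_ hh
    rw [← ofReal_norm, ← ofReal_norm]
    exact ENNReal.ofReal_le_ofReal (h.norm_coe_le_norm s)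
  have hsum := FormalMultilinearSeries.summable
    (fun m => (pointwiseMultilinear (p m) : C(K, F) [×m]→L[ℝ] C(K, G)))
    (x := h) (Metric.eball_subset_eball (hp.r_le.trans hrad) hh)
  -- The series already converges in the space of curves; its sum is identified by evaluating at
  -- each s.
  have heq : superpose g (ContinuousMap.const K y + h) =
      ∑' m, pointwiseMultilinear (p m) (fun _ : Fin m => h) := by
    ext s
    have h1 := ContinuousMap.hasSum_apply hsum.hasSum s
    have h2 := hp.hasSum (hmem s)
    rw [superpose_apply (U := Metric.eball y r) Metric.isOpen_eball hp.continuousOn]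
    · exact h2.unique h1
    · intro s
      have := hmem s
      simpa [Metric.mem_eball, edist_eq_enorm_sub] using this
  rw [heq]
  exact hsum.hasSum

end Analytic

/-- `f` is smooth (resp. analytic) on a neighbourhood of `x`. -/
def RegularAt {E F : Type*} [NormedAddCommGroup E] [NormedSpace ℝ E]
    [NormedAddCommGroup F] [NormedSpace ℝ F] (c : Category) (f : E → F) (x : E) : Prop :=
  ∀ᶠ y in 𝓝 x, ContDiffAt ℝ c.order f y

/-! ### Superposition in both categories -/

section SuperpositionRegular

variable {K : Type} [TopologicalSpace K] [CompactSpace K]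
variable {F G : Type} [NormedAddCommGroup F] [NormedSpace ℝ F] [NormedAddCommGroup G]
  [NormedSpace ℝ G] {c : Category} {g : F → G} {y : F}

/-- The analytic case spreads from the constant curve by openness of analyticity; the smooth case
holds on the open set of all curves lying in a domain of smoothness. -/
theorem regularAt_superpose [CompleteSpace G] (hg : RegularAt c g y) :
    RegularAt c (superpose g) (ContinuousMap.const K y) := by
  cases c with
  | analytic =>
    have h := analyticAt_superpose_const (K := K) (ContDiffAt.analyticAt hg.self_of_nhds)
    exact h.eventually_analyticAt.mono fun γ hγ => hγ.contDiffAt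
  | smooth =>
    obtain ⟨U, hUy, hU, hyU⟩ := mem_nhds_iff.1 hg
    have hgU : ContDiffOn ℝ ((⊤ : ℕ∞) : WithTop ℕ∞) g U := fun x hx =>
      ContDiffAt.contDiffWithinAt (hUy hx)
    have hcd : ContDiffOn ℝ ((⊤ : ℕ∞) : WithTop ℕ∞) (superpose g)
        {γ : C(K, F) | ∀ s, γ s ∈ U} :=
      contDiffOn_infty.2 fun k => contDiffOn_superpose_nat hU k
        (hgU.of_le (by exact_mod_cast le_top))
    have hopen := isOpen_setOf_forall_mem (K := K) hU
    filter_upwards [hopen.mem_nhds (show ContinuousMap.const K y ∈ _ from fun _ => hyU)] with γ hγ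
    exact hcd.contDiffAt (hopen.mem_nhds hγ)

theorem one_le_order (c : Category) : 1 ≤ c.order := by
  cases c
  · simp [Category.order]
  · exact le_top

theorem order_ne_zero (c : Category) : c.order ≠ 0 := by
  cases c <;> simp [Category.order]

/-- Neither category loses regularity under differentiation. -/
theorem order_add_one_le (c : Category) : c.order + 1 ≤ c.order := by
  cases c
  · simp [Category.order]
  · exact le_top

/-- Near a constant curve the superposition operator and its derivative are computed pointwise. -/
theorem eventually_superpose (K : Type) [TopologicalSpace K] [CompactSpace K]
    (hg : RegularAt c g y) {W : Set F} (hW : W ∈ 𝓝 y) :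
    ∀ᶠ γ in 𝓝 (ContinuousMap.const K y), (∀ s, γ s ∈ W) ∧ (∀ s, superpose g γ s = g (γ s)) ∧
      ∀ h s, fderiv ℝ (superpose g) γ h s = fderiv ℝ g (γ s) (h s) := by
  obtain ⟨U, hUy, hU, hyU⟩ := mem_nhds_iff.1 (Filter.inter_mem hg hW)
  have hc : ContDiffOn ℝ 1 g U := fun x hx =>
    ((hUy hx).1 : ContDiffAt ℝ _ g x).contDiffWithinAt.of_le (one_le_order c)
  have hc' := (contDiffOn_succ_iff_fderiv_of_isOpen (n := 0) hU).1 (by simpa using hc)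
  have hopen := isOpen_setOf_forall_mem (K := K) hU
  filter_upwards [hopen.mem_nhds (show ContinuousMap.const K y ∈ _ from fun _ => hyU)] with γ hγ
  refine ⟨fun s => (hUy (hγ s)).2, superpose_apply hU hc.continuousOn hγ, fun h s => ?_⟩
  rw [(hasFDerivAt_superpose hU hc'.1 hc'.2.2.continuousOn hγ).fderiv, pointwiseApply_apply,
    superpose_apply hU hc'.2.2.continuousOn hγ]

end SuperpositionRegular

/-! ### Calculus of regular germs and the inverse function theorem -/

section Regular

variable {E F G H : Type*} [NormedAddCommGroup E] [NormedSpace ℝ E]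
  [NormedAddCommGroup F] [NormedSpace ℝ F] [NormedAddCommGroup G] [NormedSpace ℝ G]
  [NormedAddCommGroup H] [NormedSpace ℝ H] {c : Category} {x : E}

theorem RegularAt.contDiffAt {f : E → F} (h : RegularAt c f x) : ContDiffAt ℝ c.order f x :=
  h.self_of_nhds

theorem RegularAt.continuousAt {f : E → F} (h : RegularAt c f x) : ContinuousAt f x :=
  h.contDiffAt.continuousAt

theorem RegularAt.differentiableAt {f : E → F} (h : RegularAt c f x) : DifferentiableAt ℝ f x :=
  h.contDiffAt.differentiableAt (order_ne_zero c)

theorem RegularAt.eventually {f : E → F} (h : RegularAt c f x) :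
    ∀ᶠ y in 𝓝 x, RegularAt c f y :=
  eventually_eventually_nhds.2 h

theorem RegularAt.eventually_differentiableAt {f : E → F} (h : RegularAt c f x) :
    ∀ᶠ y in 𝓝 x, DifferentiableAt ℝ f y :=
  h.eventually.mono fun _ hy => hy.differentiableAt

theorem RegularAt.congr {f g : E → F} (h : RegularAt c f x) (hfg : g =ᶠ[𝓝 x] f) :
    RegularAt c g x := by
  filter_upwards [h, hfg.eventuallyEq_nhds] with y hy hy'
  exact hy.congr_of_eventuallyEq hy'

theorem regularAt_of_contDiff {f : E → F} (h : ContDiff ℝ c.order f) : RegularAt c f x :=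
  Eventually.of_forall fun _ => h.contDiffAt

theorem regularAt_const (a : F) : RegularAt c (fun _ : E => a) x :=
  regularAt_of_contDiff contDiff_const

theorem regularAt_id : RegularAt c (fun y : E => y) x :=
  regularAt_of_contDiff contDiff_id

theorem ContinuousLinearMap.regularAt (L : E →L[ℝ] F) : RegularAt c (fun y => L y) x :=
  regularAt_of_contDiff L.contDiff

theorem RegularAt.comp {g : F → G} {f : E → F} (hg : RegularAt c g (f x)) (hf : RegularAt c f x) :
    RegularAt c (fun y => g (f y)) x := by
  filter_upwards [hf, hf.continuousAt.eventually hg] with y hy hy'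
  exact ContDiffAt.comp y hy' hy

theorem RegularAt.add {f g : E → F} (hf : RegularAt c f x) (hg : RegularAt c g x) :
    RegularAt c (fun y => f y + g y) x := by
  filter_upwards [hf, hg] with y h1 h2 using h1.add h2

theorem RegularAt.sub {f g : E → F} (hf : RegularAt c f x) (hg : RegularAt c g x) :
    RegularAt c (fun y => f y - g y) x := by
  filter_upwards [hf, hg] with y h1 h2 using h1.sub h2

theorem RegularAt.neg {f : E → F} (hf : RegularAt c f x) : RegularAt c (fun y => -f y) x := by
  filter_upwards [hf] with y h1 using h1.neg

theorem RegularAt.smul {f : E → ℝ} {g : E → F} (hf : RegularAt c f x) (hg : RegularAt c g x) :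
    RegularAt c (fun y => f y • g y) x := by
  filter_upwards [hf, hg] with y h1 h2 using h1.smul h2

theorem RegularAt.mul {f g : E → ℝ} (hf : RegularAt c f x) (hg : RegularAt c g x) :
    RegularAt c (fun y => f y * g y) x := by
  filter_upwards [hf, hg] with y h1 h2 using h1.mul h2

theorem RegularAt.inv {f : E → ℝ} (hf : RegularAt c f x) (h0 : f x ≠ 0) :
    RegularAt c (fun y => (f y)⁻¹) x := by
  filter_upwards [hf, hf.continuousAt.eventually_ne h0] with y h1 h2 using h1.inv h2

theorem RegularAt.prodMk {f : E → F} {g : E → G} (hf : RegularAt c f x) (hg : RegularAt c g x) :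
    RegularAt c (fun y => (f y, g y)) x := by
  filter_upwards [hf, hg] with y h1 h2 using h1.prodMk h2

theorem RegularAt.clm_apply {f : E → F →L[ℝ] G} {g : E → F} (hf : RegularAt c f x)
    (hg : RegularAt c g x) : RegularAt c (fun y => f y (g y)) x := by
  filter_upwards [hf, hg] with y h1 h2 using h1.clm_apply h2

theorem RegularAt.fderiv {f : E → F} (hf : RegularAt c f x) :
    RegularAt c (fun y => fderiv ℝ f y) x := by
  filter_upwards [hf] with y h1 using h1.fderiv_right (order_add_one_le c)

theorem RegularAt.sum {ι : Type*} {s : Finset ι} {f : ι → E → F}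
    (h : ∀ i ∈ s, RegularAt c (f i) x) : RegularAt c (fun y => ∑ i ∈ s, f i y) x := by
  have : ∀ᶠ y in 𝓝 x, ∀ i ∈ s, ContDiffAt ℝ c.order (f i) y :=
    (Filter.eventually_all_finset s).2 h
  filter_upwards [this] with y hy using ContDiffAt.sum hy

theorem RegularAt.prod {ι : Type*} {s : Finset ι} {f : ι → E → ℝ}
    (h : ∀ i ∈ s, RegularAt c (f i) x) : RegularAt c (fun y => ∏ i ∈ s, f i y) x := by
  have : ∀ᶠ y in 𝓝 x, ∀ i ∈ s, ContDiffAt ℝ c.order (f i) y :=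
    (Filter.eventually_all_finset s).2 h
  filter_upwards [this] with y hy using contDiffAt_prod hy

theorem regularAt_pi {ι : Type*} [Fintype ι] {f : E → ι → F}
    (h : ∀ i, RegularAt c (fun y => f y i) x) : RegularAt c f x := by
  filter_upwards [Filter.eventually_all.2 h] with y hy using contDiffAt_pi.2 hy

theorem RegularAt.det {ι : Type*} [Fintype ι] [DecidableEq ι] {A : E → Matrix ι ι ℝ}
    (h : ∀ i j, RegularAt c (fun y => A y i j) x) : RegularAt c (fun y => (A y).det) x := by
  simp only [Matrix.det_apply, Units.smul_def, zsmul_eq_mul]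
  exact RegularAt.sum fun σ _ => (regularAt_const _).mul (RegularAt.prod fun i _ => h _ _)

theorem RegularAt.adjugate {ι : Type*} [Fintype ι] [DecidableEq ι] {A : E → Matrix ι ι ℝ}
    (h : ∀ i j, RegularAt c (fun y => A y i j) x) (i j : ι) :
    RegularAt c (fun y => (A y).adjugate i j) x := by
  simp only [Matrix.adjugate_apply]
  refine RegularAt.det fun k l => ?_
  by_cases hk : k = j
  · subst hk; simpa using regularAt_const _
  · simpa [Matrix.updateRow_ne hk] using h k l

/-- The inverse function theorem for germs. -/
theorem exists_regular_localInverse [CompleteSpace E] {f : E → F} {a : E}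
    (hf : RegularAt c f a) (e : E ≃L[ℝ] F) (hf' : HasFDerivAt f (e : E →L[ℝ] F) a) :
    ∃ g : F → E, g (f a) = a ∧ RegularAt c g (f a) ∧ (∀ᶠ x in 𝓝 a, g (f x) = x) ∧
      ∀ᶠ y in 𝓝 (f a), f (g y) = y := by
  set φ := hf.contDiffAt.toOpenPartialHomeomorph f hf' (order_ne_zero c) with hφ
  have hφc : (φ : E → F) = f := rfl
  have ha : a ∈ φ.source := hf.contDiffAt.mem_toOpenPartialHomeomorph_source hf' (order_ne_zero c)
  have hfa : f a ∈ φ.target :=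
    hf.contDiffAt.image_mem_toOpenPartialHomeomorph_target hf' (order_ne_zero c)
  have hsymm : φ.symm (f a) = a := φ.left_inv ha
  have hcont : ContinuousAt φ.symm (f a) := φ.continuousAt_symm hfa
  refine ⟨φ.symm, hsymm, ?_, φ.eventually_left_inverse ha, φ.eventually_right_inverse' ha⟩
  -- Regularity of the inverse is needed on a whole neighbourhood, hence invertible derivatives at
  -- all nearby points; invertible operators form an open set.
  have hinv : ∀ᶠ x in 𝓝 a, fderiv ℝ f x ∈ Set.range ((↑) : (E ≃L[ℝ] F) → E →L[ℝ] F) := by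
    have h1 : ContinuousAt (fderiv ℝ f) a := hf.fderiv.continuousAt
    have h2 := ContinuousLinearEquiv.nhds e
    rw [← hf'.fderiv] at h2
    exact h1 h2
  have hall : ∀ᶠ x in 𝓝 a, ContDiffAt ℝ c.order f x ∧ DifferentiableAt ℝ f x ∧
      fderiv ℝ f x ∈ Set.range ((↑) : (E ≃L[ℝ] F) → E →L[ℝ] F) :=
    hf.and (hf.eventually_differentiableAt.and hinv)
  rw [← hsymm] at hall
  filter_upwards [hcont.eventually hall, φ.open_target.mem_nhds hfa] with y hy hyt
  obtain ⟨h1, h2, e', he'⟩ := hy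
  exact φ.contDiffAt_symm hyt (f₀' := e') (by rw [he', hφc]; exact h2.hasFDerivAt) h1

end Regular

/-! ### Integration of curves as a bounded operator -/

section Curves

/-- The compact interval `[0, 1]`. -/
abbrev UnitIcc : Type := Set.Icc (0 : ℝ) 1

variable {G : Type} [NormedAddCommGroup G] [NormedSpace ℝ G]

/-- The extension of a curve on `[0, 1]` to the line. -/
noncomputable def extendCurve (h : C(UnitIcc, G)) (s : ℝ) : G :=
  h (Set.projIcc 0 1 zero_le_one s)

theorem continuous_extendCurve (h : C(UnitIcc, G)) : Continuous (extendCurve h) :=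
  h.continuous.comp continuous_projIcc

theorem extendCurve_of_mem (h : C(UnitIcc, G)) {s : ℝ} (hs : s ∈ Set.Icc (0 : ℝ) 1) :
    extendCurve h s = h ⟨s, hs⟩ := by
  rw [extendCurve, Set.projIcc_of_mem _ hs]

theorem norm_extendCurve_le (h : C(UnitIcc, G)) (s : ℝ) : ‖extendCurve h s‖ ≤ ‖h‖ :=
  h.norm_coe_le_norm _

theorem hasDerivAt_integral_extendCurve [CompleteSpace G] (h : C(UnitIcc, G)) (s : ℝ) :
    HasDerivAt (fun s => ∫ σ in (0 : ℝ)..s, extendCurve h σ) (extendCurve h s) s :=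
  (continuous_extendCurve h).integral_hasStrictDerivAt 0 s |>.hasDerivAt

variable (G) in
/-- The operator `h ↦ ∫₀ˢ h`. -/
noncomputable def primitive : C(UnitIcc, G) →L[ℝ] C(UnitIcc, G) :=
  LinearMap.mkContinuous
    { toFun := fun h => ⟨fun s => ∫ σ in (0 : ℝ)..s, extendCurve h σ,
        (intervalIntegral.continuous_primitive
          (fun a b => (continuous_extendCurve h).intervalIntegrable a b) 0).comp
            continuous_subtype_val⟩
      map_add' := fun h k => by
        ext s
        simp only [ContinuousMap.coe_mk, ContinuousMap.add_apply]
        rw [← intervalIntegral.integral_add ((continuous_extendCurve h).intervalIntegrable _ _)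
          ((continuous_extendCurve k).intervalIntegrable _ _)]
        rfl
      map_smul' := fun a h => by
        ext s
        simp only [ContinuousMap.coe_mk, ContinuousMap.smul_apply, RingHom.id_apply]
        rw [← intervalIntegral.integral_smul]
        rfl }
    1 (by
      intro h
      rw [one_mul, ContinuousMap.norm_le _ (norm_nonneg _)]
      intro s
      refine (intervalIntegral.norm_integral_le_of_norm_le_const
        fun σ _ => norm_extendCurve_le h σ).trans ?_
      have h1 : |(s : ℝ) - 0| ≤ 1 := by
        rw [sub_zero, abs_of_nonneg s.2.1]; exact s.2.2
      exact mul_le_of_le_one_right (norm_nonneg _) h1)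

variable (G) in
/-- The operator `h ↦ ∫₀¹ h`. -/
noncomputable def totalIntegral : C(UnitIcc, G) →L[ℝ] G :=
  (ContinuousMap.evalCLM ℝ (1 : UnitIcc)).comp (primitive G)

theorem totalIntegral_apply (h : C(UnitIcc, G)) :
    totalIntegral G h = ∫ σ in (0 : ℝ)..1, extendCurve h σ := rfl

theorem totalIntegral_eq_sub [CompleteSpace G] {h : C(UnitIcc, G)} {f : ℝ → G}
    (hf : ∀ s : UnitIcc, HasDerivAt f (h s) s) : totalIntegral G h = f 1 - f 0 := by
  rw [totalIntegral_apply]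
  refine intervalIntegral.integral_eq_sub_of_hasDerivAt (fun s hs => ?_)
    ((continuous_extendCurve h).intervalIntegrable _ _)
  rw [Set.uIcc_of_le zero_le_one] at hs
  rw [extendCurve_of_mem h hs]
  exact hf ⟨s, hs⟩

theorem ContinuousLinearMap.totalIntegral_comm [CompleteSpace G] {G' : Type}
    [NormedAddCommGroup G'] [NormedSpace ℝ G'] [CompleteSpace G'] (L : G →L[ℝ] G')
    (h : C(UnitIcc, G)) :
    L (totalIntegral G h) = totalIntegral G' (L.compLeftContinuous ℝ UnitIcc h) := by
  rw [totalIntegral_apply, totalIntegral_apply, ← L.intervalIntegral_comp_comm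
    ((continuous_extendCurve h).intervalIntegrable _ _)]
  rfl

end Curves

/-! ### Hadamard's division lemma -/

section Hadamard

variable {E G : Type} [NormedAddCommGroup E] [NormedSpace ℝ E] [NormedAddCommGroup G]
  [NormedSpace ℝ G]

/-- The segment `s ↦ x - (1 - s) ℓ(x) v` from the projection of `x` to `ker ℓ` along `v` to `x`. -/
noncomputable def shrink (ℓ : E →L[ℝ] ℝ) (v : E) : E →L[ℝ] C(UnitIcc, E) :=
  ContinuousLinearMap.const ℝ UnitIcc -
    ℓ.smulRight (⟨fun s => (1 - (s : ℝ)) • v, by fun_prop⟩ : C(UnitIcc, E))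

theorem shrink_apply (ℓ : E →L[ℝ] ℝ) (v x : E) (s : UnitIcc) :
    shrink ℓ v x s = x - (ℓ x * (1 - (s : ℝ))) • v := by
  simp [shrink, mul_smul]

theorem shrink_of_eq_zero {ℓ : E →L[ℝ] ℝ} {v y : E} (hy : ℓ y = 0) :
    shrink ℓ v y = ContinuousMap.const UnitIcc y := by
  ext s
  simp [shrink_apply, hy]

/-- At a point of the hyperplane the segment degenerates to a constant curve, which is where
superposition is known to be regular. -/
theorem regularAt_superpose_shrink [CompleteSpace G] {c : Category} {g : E → G}
    {ℓ : E →L[ℝ] ℝ} {v y : E} (hg : RegularAt c g y) (hy : ℓ y = 0) :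
    RegularAt c (fun x => superpose g (shrink ℓ v x)) y := by
  refine RegularAt.comp (g := superpose g) ?_ (ContinuousLinearMap.regularAt (shrink ℓ v))
  rw [shrink_of_eq_zero hy]
  exact regularAt_superpose hg

theorem tendsto_shrink {ℓ : E →L[ℝ] ℝ} {v y : E} (hy : ℓ y = 0) :
    Tendsto (shrink ℓ v) (𝓝 y) (𝓝 (ContinuousMap.const UnitIcc y)) := by
  rw [← shrink_of_eq_zero (v := v) hy]
  exact (shrink ℓ v).continuous.continuousAt

theorem hasDerivAt_segment (a : ℝ) (v x : E) (s : ℝ) :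
    HasDerivAt (fun s : ℝ => x - (a * (1 - s)) • v) (a • v) s := by
  have h1 : HasDerivAt (fun s : ℝ => a * (1 - s)) (a * (0 - 1)) s :=
    ((hasDerivAt_const _ _).sub (hasDerivAt_id _)).const_mul _
  exact ((hasDerivAt_const s x).sub (h1.smul_const v)).congr_deriv (by simp)

/-- Hadamard's lemma: a regular germ which vanishes on a hyperplane is divisible by the equation
of the hyperplane. -/
theorem exists_eq_smul_of_eq_zero_on_hyperplane [CompleteSpace G] {c : Category} {f : E → G}
    {ℓ : E →L[ℝ] ℝ} {v y : E} (hv : ℓ v = 1) (hf : RegularAt c f y) (hy : ℓ y = 0)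
    (h0 : ∀ᶠ x in 𝓝 y, ℓ x = 0 → f x = 0) :
    ∃ g : E → G, RegularAt c g y ∧ ∀ᶠ x in 𝓝 y, f x = ℓ x • g x := by
  have hd : RegularAt c (fun z => fderiv ℝ f z v) y := hf.fderiv.clm_apply (regularAt_const v)
  -- The quotient is the mean of the derivative in direction v along the segment from the hyperplane
  -- to x.
  refine ⟨fun x => totalIntegral G (superpose (fun z => fderiv ℝ f z v) (shrink ℓ v x)),
    (ContinuousLinearMap.regularAt (totalIntegral G)).comp
      (regularAt_superpose_shrink hd hy), ?_⟩
  have hW := (tendsto_shrink (v := v) hy).eventually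
    (eventually_superpose UnitIcc hd (hf.eventually_differentiableAt.and h0))
  filter_upwards [hW] with x hx
  obtain ⟨hx1, hx2, -⟩ := hx
  -- The segment has velocity ℓ(x)v, so this is the fundamental theorem of calculus; at s = 0 the
  -- segment is on the hyperplane, where f vanishes.
  have key : totalIntegral G (ℓ x • superpose (fun z => fderiv ℝ f z v) (shrink ℓ v x)) =
      f (x - (ℓ x * (1 - 1)) • v) - f (x - (ℓ x * (1 - 0)) • v) := by
    refine totalIntegral_eq_sub (f := fun s => f (x - (ℓ x * (1 - s)) • v)) fun s => ?_
    have hs := (hx1 s).1.hasFDerivAt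
    rw [shrink_apply] at hs
    have h3 := hs.comp_hasDerivAt (s : ℝ) (hasDerivAt_segment (ℓ x) v x s)
    rw [ContinuousMap.smul_apply, hx2 s, shrink_apply]
    exact h3.congr_deriv (map_smul _ _ _)
  have hzero : f (x - (ℓ x * (1 - 0)) • v) = 0 := by
    have := (hx1 0).2
    rw [shrink_apply] at this
    simpa [hv] using this
  rw [map_smul, hzero] at key
  simpa using key.symm

end Hadamard

/-! ### Flows of time-dependent vector field germs -/

section Flow

variable {E : Type} [NormedAddCommGroup E] [NormedSpace ℝ E]

variable (E) in
/-- The linear part of `(τ, γ) ↦ (s ↦ (t₀ + τ s, γ s))`. -/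
noncomputable def graphCurve : ℝ × C(UnitIcc, E) →L[ℝ] C(UnitIcc, ℝ × E) :=
  (ContinuousLinearMap.fst ℝ ℝ C(UnitIcc, E)).smulRight
      (⟨fun s => ((s : ℝ), 0), by fun_prop⟩ : C(UnitIcc, ℝ × E)) +
    ((ContinuousLinearMap.inr ℝ ℝ E).compLeftContinuous ℝ UnitIcc).comp
      (ContinuousLinearMap.snd ℝ ℝ C(UnitIcc, E))

theorem graphCurve_apply (τ : ℝ) (γ : C(UnitIcc, E)) (s : UnitIcc) :
    graphCurve E (τ, γ) s = (τ * s, γ s) := by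
  simp [graphCurve]

/-- The integral operator `(τ, γ) ↦ ∫₀ˢ X(t₀ + τ σ, γ(σ)) dσ`. -/
noncomputable def picardIntegral (X : ℝ × E → E) (t₀ : ℝ) (p : ℝ × C(UnitIcc, E)) :
    C(UnitIcc, E) :=
  primitive E (superpose X (ContinuousMap.const UnitIcc ((t₀, 0) : ℝ × E) + graphCurve E p))

theorem const_add_graphCurve_apply (t₀ τ : ℝ) (γ : C(UnitIcc, E)) (s : UnitIcc) :
    (ContinuousMap.const UnitIcc ((t₀, 0) : ℝ × E) + graphCurve E (τ, γ)) s =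
      (t₀ + τ * s, γ s) := by
  simp [graphCurve_apply]

theorem tendsto_const_add_graphCurve (t₀ : ℝ) :
    Tendsto (fun p => ContinuousMap.const UnitIcc ((t₀, 0) : ℝ × E) + graphCurve E p)
      (𝓝 0) (𝓝 (ContinuousMap.const UnitIcc (t₀, 0))) := by
  have : Continuous
      (fun p => ContinuousMap.const UnitIcc ((t₀, 0) : ℝ × E) + graphCurve E p) := by fun_prop
  simpa using this.tendsto 0

variable [CompleteSpace E] {c : Category} {X : ℝ × E → E} {t₀ : ℝ}

theorem regularAt_picardIntegral (hX : RegularAt c X (t₀, 0)) :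
    RegularAt c (picardIntegral X t₀) 0 := by
  refine (ContinuousLinearMap.regularAt (primitive E)).comp ?_
  refine RegularAt.comp (g := superpose X) ?_
    ((regularAt_const _).add (ContinuousLinearMap.regularAt (graphCurve E)))
  simpa using regularAt_superpose hX

/-- Exhibits the integrands of the Picard operator and of its derivative in the curve variable
pointwise, so that integral equations between curves can later be read as differential equations. -/
theorem eventually_picardIntegral (hX : RegularAt c X (t₀, 0)) {W : Set (ℝ × E)}
    (hW : W ∈ 𝓝 (t₀, (0 : E))) :
    ∀ᶠ p in 𝓝 (0 : ℝ × C(UnitIcc, E)), (∀ s : UnitIcc, (t₀ + p.1 * s, p.2 s) ∈ W) ∧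
      ∃ h : C(UnitIcc, E), picardIntegral X t₀ p = primitive E h ∧
        (∀ s : UnitIcc, h s = X (t₀ + p.1 * s, p.2 s)) ∧
        ∀ q : C(UnitIcc, E), ∃ k : C(UnitIcc, E),
          fderiv ℝ (picardIntegral X t₀) p (0, q) = primitive E k ∧
          ∀ s : UnitIcc, k s = fderiv ℝ X (t₀ + p.1 * s, p.2 s) (0, q s) := by
  have hs : RegularAt c (superpose X) (ContinuousMap.const UnitIcc ((t₀, 0) : ℝ × E)) :=
    regularAt_superpose hX
  filter_upwards [(tendsto_const_add_graphCurve t₀).eventually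
    ((eventually_superpose UnitIcc hX hW).and hs.eventually_differentiableAt)]
  rintro ⟨τ, γ⟩ ⟨⟨h1, h2, h3⟩, h4⟩
  simp only [const_add_graphCurve_apply] at h1 h2 h3
  refine ⟨h1, _, rfl, h2, fun q => ⟨fderiv ℝ (superpose X)
    (ContinuousMap.const UnitIcc ((t₀, 0) : ℝ × E) + graphCurve E (τ, γ)) (graphCurve E (0, q)),
    ?_, fun s => by rw [h3, graphCurve_apply, zero_mul]⟩⟩
  · have ha : HasFDerivAt (fun p => ContinuousMap.const UnitIcc ((t₀, 0) : ℝ × E) +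
        graphCurve E p) (graphCurve E) (τ, γ) := (graphCurve E).hasFDerivAt.const_add _
    have hb := h4.hasFDerivAt.comp (τ, γ) ha
    have hd : HasFDerivAt (picardIntegral X t₀) _ (τ, γ) :=
      (primitive E).hasFDerivAt.comp (τ, γ) hb
    rw [hd.fderiv]
    rfl

/-- Local solutions of `γ(s) = x + τ ∫₀ˢ X(t₀ + τ σ, γ(σ)) dσ` depend regularly on `(τ, x)`. -/
theorem exists_regular_integralCurves (hX : RegularAt c X (t₀, 0))
    (hX0 : ∀ᶠ t in 𝓝 t₀, X (t, 0) = 0) :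
    ∃ γ : ℝ × E → C(UnitIcc, E), RegularAt c γ 0 ∧ γ 0 = 0 ∧
      (∀ᶠ z in 𝓝 (0 : ℝ × E), γ z = ContinuousLinearMap.const ℝ UnitIcc z.2 +
        z.1 • picardIntegral X t₀ (z.1, γ z)) ∧
      ∀ᶠ τ in 𝓝 (0 : ℝ), γ (τ, 0) = 0 := by
  set C₀ : E →L[ℝ] C(UnitIcc, E) := ContinuousLinearMap.const ℝ UnitIcc with hC₀
  set N : (ℝ × E) × C(UnitIcc, E) → C(UnitIcc, E) :=
    fun w => picardIntegral X t₀ (w.1.1, w.2) with hN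
  have hNr : RegularAt c N 0 := by
    refine RegularAt.comp (g := picardIntegral X t₀)
      (f := fun w : (ℝ × E) × C(UnitIcc, E) => (w.1.1, w.2)) ?_ ?_
    · exact regularAt_picardIntegral hX
    · exact regularAt_of_contDiff (by fun_prop)
  -- A solution with data z is a preimage of (z, 0) under f. Keeping z as a component lets the
  -- inverse function theorem act as an implicit one.
  set f : (ℝ × E) × C(UnitIcc, E) → (ℝ × E) × C(UnitIcc, E) :=
    fun w => (w.1, w.2 - C₀ w.1.2 - w.1.1 • N w) with hf
  have hfr : RegularAt c f 0 := by
    refine RegularAt.prodMk (regularAt_of_contDiff contDiff_fst) (RegularAt.sub ?_ ?_)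
    · exact regularAt_of_contDiff (contDiff_snd.sub (C₀.contDiff.comp
        (contDiff_snd.comp contDiff_fst)))
    · exact RegularAt.smul (regularAt_of_contDiff (contDiff_fst.comp contDiff_fst)) hNr
  have hpic0 : ∀ τ : ℝ, (∀ s : UnitIcc, X (t₀ + τ * s, 0) = 0) →
      picardIntegral X t₀ (τ, 0) = 0 := by
    intro τ hτ
    have : superpose X (ContinuousMap.const UnitIcc ((t₀, 0) : ℝ × E) + graphCurve E (τ, 0)) =
        0 := by
      ext s
      rw [superpose_apply_of_continuous]
      · rw [const_add_graphCurve_apply]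
        simpa using hτ s
      · have : (fun s => X ((ContinuousMap.const UnitIcc ((t₀, 0) : ℝ × E) +
            graphCurve E (τ, 0)) s)) = fun _ => (0 : E) := by
          funext s
          rw [const_add_graphCurve_apply]
          simpa using hτ s
        rw [this]
        exact continuous_const
    rw [picardIntegral, this, map_zero]
  have hN0 : N 0 = 0 := hpic0 0 (fun s => by simpa using hX0.self_of_nhds)
  have hf0 : f 0 = 0 := by simp [hf]
  let pr : (ℝ × E) × C(UnitIcc, E) →L[ℝ] C(UnitIcc, E) :=
    C₀.comp ((ContinuousLinearMap.snd ℝ ℝ E).comp (ContinuousLinearMap.fst ℝ (ℝ × E) _))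
  let e : ((ℝ × E) × C(UnitIcc, E)) ≃L[ℝ] ((ℝ × E) × C(UnitIcc, E)) :=
    ContinuousLinearEquiv.equivOfInverse
      ((ContinuousLinearMap.fst ℝ (ℝ × E) C(UnitIcc, E)).prod
        (ContinuousLinearMap.snd ℝ (ℝ × E) C(UnitIcc, E) - pr))
      ((ContinuousLinearMap.fst ℝ (ℝ × E) C(UnitIcc, E)).prod
        (ContinuousLinearMap.snd ℝ (ℝ × E) C(UnitIcc, E) + pr))
      (fun w => by ext <;> simp [pr]) (fun w => by ext <;> simp [pr])
  -- The term τN contributes nothing at the origin, because both τ and N vanish there; what remains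
  -- is the shear e.
  have hfd : HasFDerivAt f (e : _ →L[ℝ] _) 0 := by
    have h1 : HasFDerivAt (fun w : (ℝ × E) × C(UnitIcc, E) => w.1.1)
        ((ContinuousLinearMap.fst ℝ ℝ E).comp (ContinuousLinearMap.fst ℝ (ℝ × E) _)) 0 :=
      ((ContinuousLinearMap.fst ℝ ℝ E).comp
        (ContinuousLinearMap.fst ℝ (ℝ × E) C(UnitIcc, E))).hasFDerivAt
    have h2 := h1.smul hNr.differentiableAt.hasFDerivAt
    have h3 := ((ContinuousLinearMap.snd ℝ (ℝ × E) C(UnitIcc, E) - pr).hasFDerivAt (x := 0)).sub h2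
    have h4 := ((ContinuousLinearMap.fst ℝ (ℝ × E) C(UnitIcc, E)).hasFDerivAt (x := 0)).prodMk h3
    refine h4.congr_fderiv ?_
    ext w <;> simp [hN0, e]
  obtain ⟨Q, hQ0, hQr, hQl, hQ⟩ := exists_regular_localInverse hfr e hfd
  rw [hf0] at hQ0 hQr hQ
  have hcont : Tendsto (fun z : ℝ × E => (z, (0 : C(UnitIcc, E)))) (𝓝 0) (𝓝 0) := by
    have : Continuous (fun z : ℝ × E => (z, (0 : C(UnitIcc, E)))) := by fun_prop
    exact this.tendsto 0
  refine ⟨fun z => (Q (z, 0)).2, ?_, ?_, ?_, ?_⟩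
  · refine RegularAt.comp (g := Prod.snd) (regularAt_of_contDiff contDiff_snd)
      (RegularAt.comp (g := Q) (f := fun z : ℝ × E => (z, (0 : C(UnitIcc, E)))) hQr ?_)
    exact regularAt_of_contDiff (by fun_prop)
  · simp only [Prod.mk_zero_zero, hQ0]; rfl
  · filter_upwards [hcont.eventually hQ] with z hz
    have h1 : (Q (z, 0)).1 = z := congrArg Prod.fst hz
    have h2 : (Q (z, 0)).2 - C₀ (Q (z, 0)).1.2 - (Q (z, 0)).1.1 • N (Q (z, 0)) = 0 :=
      congrArg Prod.snd hz
    simp only [hN] at h2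
    rw [h1, sub_sub, sub_eq_zero] at h2
    exact h2
  · have hc2 : Tendsto (fun τ : ℝ => ((τ, (0 : E)), (0 : C(UnitIcc, E)))) (𝓝 0) (𝓝 0) := by
      have : Continuous (fun τ : ℝ => ((τ, (0 : E)), (0 : C(UnitIcc, E)))) := by fun_prop
      exact this.tendsto 0
    obtain ⟨δ, hδ, hball⟩ := Metric.eventually_nhds_iff.1 hX0
    filter_upwards [hc2.eventually hQl, Metric.ball_mem_nhds (0 : ℝ) hδ] with τ hτ hτδ
    have hz : picardIntegral X t₀ (τ, 0) = 0 := by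
      refine hpic0 τ fun s => hball ?_
      rw [Real.dist_eq, add_sub_cancel_left, abs_mul, abs_of_nonneg s.2.1]
      rw [Metric.mem_ball, Real.dist_eq, sub_zero] at hτδ
      exact (mul_le_of_le_one_right (abs_nonneg _) s.2.2).trans_lt hτδ
    -- The zero curve is a solution for starting point 0, and the local left inverse makes it the
    -- chosen one.
    have : f ((τ, 0), 0) = ((τ, 0), 0) := by
      simp [hf, hN, hz]
    rw [this] at hτ
    rw [hτ]

/-- The flow of a regular time-dependent vector field germ which vanishes at the origin, together
with the variational equation. -/
theorem exists_regular_flow (hX : RegularAt c X (t₀, 0)) (hX0 : ∀ᶠ t in 𝓝 t₀, X (t, 0) = 0)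
    {W : Set (ℝ × E)} (hW : W ∈ 𝓝 (t₀, (0 : E))) :
    ∀ᶠ τ in 𝓝 (0 : ℝ), ∃ Ψ : E → E, RegularAt c Ψ 0 ∧ Ψ 0 = 0 ∧
      (∃ e : E ≃L[ℝ] E, HasFDerivAt Ψ (e : E →L[ℝ] E) 0) ∧
      ∀ᶠ x in 𝓝 (0 : E), ∃ y : ℝ → E, y 0 = x ∧ y 1 = Ψ x ∧
        (∀ s ∈ Set.Icc (0 : ℝ) 1, (t₀ + τ * s, y s) ∈ W ∧
          HasDerivAt y (τ • X (t₀ + τ * s, y s)) s) ∧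
        ∀ u : E, ∃ j : ℝ → E, j 0 = u ∧ j 1 = fderiv ℝ Ψ x u ∧
          ∀ s ∈ Set.Icc (0 : ℝ) 1,
            HasDerivAt j (τ • fderiv ℝ X (t₀ + τ * s, y s) (0, j s)) s := by
  obtain ⟨γ, hγ, hγ0, hγeq, hγτ⟩ := exists_regular_integralCurves hX hX0
  set ev : C(UnitIcc, E) →L[ℝ] E := ContinuousMap.evalCLM ℝ (1 : UnitIcc) with hev
  have hpair : RegularAt c (fun z : ℝ × E => (z.1, γ z)) 0 :=
    (regularAt_of_contDiff contDiff_fst).prodMk hγ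
  have hpair0 : Tendsto (fun z : ℝ × E => (z.1, γ z)) (𝓝 0) (𝓝 0) := by
    have := hpair.continuousAt.tendsto
    rwa [hγ0] at this
  -- Differentiating the integral equation in the starting point gives the variational equation in
  -- integrated form.
  have hder : ∀ᶠ z in 𝓝 (0 : ℝ × E), ∀ u : E, fderiv ℝ γ z (0, u) =
      ContinuousLinearMap.const ℝ UnitIcc u + z.1 • fderiv ℝ (picardIntegral X t₀) (z.1, γ z)
        (0, fderiv ℝ γ z (0, u)) := by
    filter_upwards [hγeq.eventually_nhds, hγ.eventually_differentiableAt,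
      hpair0.eventually (regularAt_picardIntegral hX).eventually_differentiableAt] with z h1 h2 h3 u
    have h4 : HasFDerivAt (fun z : ℝ × E => (z.1, γ z)) _ z :=
      (hasFDerivAt_fst).prodMk h2.hasFDerivAt
    have h5 := h3.hasFDerivAt.comp z h4
    have h6 := ((ContinuousLinearMap.const ℝ UnitIcc :
      E →L[ℝ] C(UnitIcc, E)).hasFDerivAt.comp z (hasFDerivAt_snd (𝕜 := ℝ) (p := z))).add
      ((hasFDerivAt_fst (𝕜 := ℝ) (p := z)).smul h5)
    have h7 := h6.congr_of_eventuallyEq (f₁ := γ) h1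
    have h8 := congrArg (fun L => L ((0 : ℝ), u)) h7.fderiv
    simpa using h8
  -- At z = 0 the derivative of the time-one map in the starting point is the identity, and
  -- invertibility is open.
  have hD : ∀ᶠ z in 𝓝 (0 : ℝ × E),
      (ev.comp (fderiv ℝ γ z)).comp (ContinuousLinearMap.inr ℝ ℝ E) ∈
        Set.range ((↑) : (E ≃L[ℝ] E) → E →L[ℝ] E) := by
    have hc : ContinuousAt (fun z : ℝ × E =>
        (ev.comp (fderiv ℝ γ z)).comp (ContinuousLinearMap.inr ℝ ℝ E)) 0 := by
      have := hγ.fderiv.continuousAt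
      fun_prop
    have h0 : (ev.comp (fderiv ℝ γ 0)).comp (ContinuousLinearMap.inr ℝ ℝ E) =
        ((ContinuousLinearEquiv.refl ℝ E : E ≃L[ℝ] E) : E →L[ℝ] E) := by
      ext u
      have := hder.self_of_nhds u
      simp only [Prod.fst_zero, zero_smul, add_zero] at this
      simp [hev, this]
    have hn := ContinuousLinearEquiv.nhds (ContinuousLinearEquiv.refl ℝ E)
    rw [← h0] at hn
    exact hc hn
  have hall : ∀ᶠ z in 𝓝 ((0 : ℝ), (0 : E)), _ :=
    hγeq.and (hder.and (hD.and (hγ.eventually.and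
      (hpair0.eventually (eventually_picardIntegral hX hW)))))
  filter_upwards [hall.curry_nhds, hγτ] with τ hτ hτ0
  have hincl : ∀ x : E, HasFDerivAt (fun x : E => (τ, x)) (ContinuousLinearMap.inr ℝ ℝ E) x :=
    fun x => hasFDerivAt_prodMk_right τ x
  refine ⟨fun x => ev (γ (τ, x)), ?_, ?_, ?_, ?_⟩
  · refine (ContinuousLinearMap.regularAt ev).comp (RegularAt.comp (g := γ)
      hτ.self_of_nhds.2.2.2.1 ((regularAt_const τ).prodMk regularAt_id))
  · simp [hτ0]
  · obtain ⟨e, he⟩ := hτ.self_of_nhds.2.2.1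
    refine ⟨e, ?_⟩
    rw [he]
    exact (ev.hasFDerivAt.comp _ hτ.self_of_nhds.2.2.2.1.differentiableAt.hasFDerivAt).comp
      (0 : E) (hincl 0)
  · filter_upwards [hτ] with x hx
    obtain ⟨h1, h2, -, h3, h4, h, h5, h6, h7⟩ := hx
    have hy : ∀ s (hs : s ∈ Set.Icc (0 : ℝ) 1),
        x + τ • (∫ σ in (0 : ℝ)..s, extendCurve h σ) = γ (τ, x) ⟨s, hs⟩ := by
      intro s hs
      conv_rhs => rw [h1, h5]
      rfl
    have hderΨ : ∀ u, fderiv ℝ (fun x => ev (γ (τ, x))) x u = fderiv ℝ γ (τ, x) (0, u) 1 := by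
      intro u
      have := (ev.hasFDerivAt.comp _ h3.differentiableAt.hasFDerivAt).comp x (hincl x)
      exact congrArg (fun L => L u) this.fderiv
    -- The integral of the extended integrand is defined on the whole line, so two-sided derivatives
    -- exist even at the endpoints of [0, 1].
    refine ⟨fun s => x + τ • ∫ σ in (0 : ℝ)..s, extendCurve h σ, by simp,
      hy 1 ⟨zero_le_one, le_rfl⟩, fun s hs => ⟨?_, ?_⟩, fun u => ?_⟩
    · simp only [hy s hs]
      exact h4 ⟨s, hs⟩
    · have := ((hasDerivAt_integral_extendCurve h s).const_smul τ).const_add x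
      rw [extendCurve_of_mem h hs, h6] at this
      simp only [hy s hs]
      exact this
    · obtain ⟨k, hk1, hk2⟩ := h7 (fderiv ℝ γ (τ, x) (0, u))
      have hj : ∀ s (hs : s ∈ Set.Icc (0 : ℝ) 1),
          u + τ • (∫ σ in (0 : ℝ)..s, extendCurve k σ) = fderiv ℝ γ (τ, x) (0, u) ⟨s, hs⟩ := by
        intro s hs
        conv_rhs => rw [h2, hk1]
        rfl
      refine ⟨fun s => u + τ • ∫ σ in (0 : ℝ)..s, extendCurve k σ, by simp, ?_, fun s hs => ?_⟩
      · rw [hderΨ]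
        exact hj 1 ⟨zero_le_one, le_rfl⟩
      · have := ((hasDerivAt_integral_extendCurve k s).const_smul τ).const_add u
        rw [extendCurve_of_mem k hs, hk2] at this
        simp only [hy s hs, hj s hs]
        exact this

end Flow

/-! ### Naturality and regularity of the exterior product -/

section Wedge

variable {V U : Type*} [AddCommGroup V] [Module ℝ V] [AddCommGroup U] [Module ℝ U] {k l : ℕ}

theorem wedge_apply (α : V [⋀^Fin k]→ₗ[ℝ] ℝ) (β : V [⋀^Fin l]→ₗ[ℝ] ℝ) (v : Fin (k + l) → V) :
    wedge α β v = ∑ q : Equiv.Perm.ModSumCongr (Fin k) (Fin l), LinearMap.mul' ℝ ℝ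
      (AlternatingMap.domCoprod.summand α β q (fun i => v (finSumFinEquiv i))) := by
  simp only [wedge, AlternatingMap.domDomCongr_apply, LinearMap.compAlternatingMap_apply,
    AlternatingMap.domCoprod_apply, sum_apply, map_sum]
  rfl

theorem wedge_summand (α : V [⋀^Fin k]→ₗ[ℝ] ℝ) (β : V [⋀^Fin l]→ₗ[ℝ] ℝ)
    (w : Fin k ⊕ Fin l → V) (σ : Equiv.Perm (Fin k ⊕ Fin l)) :
    LinearMap.mul' ℝ ℝ (AlternatingMap.domCoprod.summand α β (Quotient.mk'' σ) w) =
      ((Equiv.Perm.sign σ : ℤ) : ℝ) *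
        (α (fun i => w (σ (Sum.inl i))) * β (fun i => w (σ (Sum.inr i)))) := by
  rw [AlternatingMap.domCoprod.summand_mk'']
  change LinearMap.mul' ℝ ℝ (Equiv.Perm.sign σ • TensorProduct.tmul ℝ
    (α fun i => w (σ (Sum.inl i))) (β fun i => w (σ (Sum.inr i)))) = _
  rw [Units.smul_def, map_zsmul, LinearMap.mul'_apply, zsmul_eq_mul]

theorem wedge_compLinearMap (α : V [⋀^Fin k]→ₗ[ℝ] ℝ) (β : V [⋀^Fin l]→ₗ[ℝ] ℝ) (L : U →ₗ[ℝ] V) :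
    wedge (α.compLinearMap L) (β.compLinearMap L) = (wedge α β).compLinearMap L := by
  ext v
  rw [AlternatingMap.compLinearMap_apply, wedge_apply, wedge_apply]
  refine Finset.sum_congr rfl fun q _ => ?_
  induction q using Quotient.inductionOn' with
  | h σ =>
    rw [wedge_summand, wedge_summand]
    simp only [AlternatingMap.compLinearMap_apply]

theorem zero_wedge (β : V [⋀^Fin l]→ₗ[ℝ] ℝ) : wedge (0 : V [⋀^Fin k]→ₗ[ℝ] ℝ) β = 0 := by
  ext v
  rw [wedge_apply, AlternatingMap.zero_apply]
  refine Finset.sum_eq_zero fun q _ => ?_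
  induction q using Quotient.inductionOn' with
  | h σ => rw [wedge_summand]; simp

theorem contDiff_wedge {X : Type*} [NormedAddCommGroup X] [NormedSpace ℝ X] {N : WithTop ℕ∞}
    {x : X} {α : X → V [⋀^Fin k]→ₗ[ℝ] ℝ} {β : X → V [⋀^Fin l]→ₗ[ℝ] ℝ}
    (hα : ∀ v, ContDiffAt ℝ N (fun x => α x v) x) (hβ : ∀ v, ContDiffAt ℝ N (fun x => β x v) x)
    (v : Fin (k + l) → V) : ContDiffAt ℝ N (fun x => wedge (α x) (β x) v) x := by
  simp only [wedge_apply]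
  refine ContDiffAt.sum fun q _ => ?_
  induction q using Quotient.inductionOn' with
  | h σ =>
    simp only [wedge_summand]
    exact contDiffAt_const.mul ((hα _).mul (hβ _))

theorem formPow_compLinearMap (a : V [⋀^Fin 2]→ₗ[ℝ] ℝ) (L : U →ₗ[ℝ] V) (k : ℕ) :
    formPow (a.compLinearMap L) k = (formPow a k).compLinearMap L := by
  induction k with
  | zero => ext v; rfl
  | succ k ih => rw [formPow, ih, wedge_compLinearMap]; rfl

theorem contDiff_formPow {X : Type*} [NormedAddCommGroup X] [NormedSpace ℝ X] {N : WithTop ℕ∞}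
    {x : X} {a : X → V [⋀^Fin 2]→ₗ[ℝ] ℝ} (ha : ∀ v, ContDiffAt ℝ N (fun x => a x v) x) (k : ℕ) :
    ∀ v, ContDiffAt ℝ N (fun x => formPow (a x) k v) x := by
  induction k with
  | zero => exact fun v => contDiffAt_const
  | succ k ih => exact contDiff_wedge ih ha

/-- The wedge product of a functional `φ` with `Θ` on a frame of which all but the first vector
lie in the kernel of `φ`. -/
theorem wedge_oneForm_cons (φ : V →ₗ[ℝ] ℝ) (Θ : V [⋀^Fin l]→ₗ[ℝ] ℝ) (v : V) (e : Fin l → V)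
    (he : ∀ i, φ (e i) = 0) :
    wedge (oneForm φ) Θ (fun i => Sum.elim (fun _ => v) e (finSumFinEquiv.symm i)) =
      φ v * Θ e := by
  rw [wedge_apply]
  refine (Finset.sum_eq_single
    (Quotient.mk'' 1 : Equiv.Perm.ModSumCongr (Fin 1) (Fin l)) ?_ ?_).trans ?_
  · intro q _ hq
    induction q using Quotient.inductionOn' with
    | h σ =>
      rw [wedge_summand]
      simp only [Equiv.symm_apply_apply]
      rcases hσ : σ (Sum.inl 0) with i | j
      -- A permutation fixing the first slot lies in the coset of the identity; any other coset
      -- feeds some e j, a vector of ker φ, to φ.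
      · exfalso
        apply hq
        have hi : σ (Sum.inl 0) = Sum.inl 0 := by rw [hσ, Subsingleton.elim i 0]
        refine (Quotient.sound' ?_).symm
        rw [QuotientGroup.leftRel_apply]
        simp only [inv_one, one_mul]
        refine Equiv.Perm.mem_sumCongrHom_range_of_perm_mapsTo_inl ?_
        rintro _ ⟨i, rfl⟩
        exact ⟨0, by rw [Subsingleton.elim i 0, hi]⟩
      · have : (oneForm φ) (fun i => Sum.elim (fun _ => v) e (σ (Sum.inl i))) = 0 := by
          simp only [oneForm, AlternatingMap.ofSubsingleton_apply_apply, hσ]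
          exact he j
        rw [this]; simp
  · intro h; exact absurd (Finset.mem_univ _) h
  · rw [wedge_summand]
    simp [oneForm]

end Wedge

/-! ### Alternating bilinear forms and their normal form -/

section Bilinear

variable {V U : Type*} [AddCommGroup V] [Module ℝ V] [AddCommGroup U] [Module ℝ U]

theorem eq_vec_two {α : Type*} (m : Fin 2 → α) : m = ![m 0, m 1] := by
  funext i; fin_cases i <;> rfl

theorem update_vec_two_zero {α : Type*} [DecidableEq (Fin 2)] (u v w : α) :
    Function.update ![u, v] 0 w = ![w, v] := by
  funext i; fin_cases i <;> simp

theorem update_vec_two_one {α : Type*} [DecidableEq (Fin 2)] (u v w : α) :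
    Function.update ![u, v] 1 w = ![u, w] := by
  funext i; fin_cases i <;> simp

/-- The bilinear map of an alternating 2-form. -/
noncomputable def bilin (a : V [⋀^Fin 2]→ₗ[ℝ] ℝ) : V →ₗ[ℝ] V →ₗ[ℝ] ℝ :=
  LinearMap.mk₂ ℝ (fun u v => a ![u, v])
    (fun u u' v => a.map_vecCons_add ![v] u u')
    (fun r u v => a.map_vecCons_smul ![v] r u)
    (fun u v v' => by
      simpa only [update_vec_two_one] using a.map_update_add ![u, v] 1 v v')
    (fun r u v => by
      simpa only [update_vec_two_one] using a.map_update_smul ![u, v] 1 r v)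

@[simp]
theorem bilin_apply (a : V [⋀^Fin 2]→ₗ[ℝ] ℝ) (u v : V) : bilin a u v = a ![u, v] := rfl

theorem bilin_isAlt (a : V [⋀^Fin 2]→ₗ[ℝ] ℝ) : (bilin a).IsAlt := fun u =>
  a.map_eq_zero_of_eq ![u, u] (i := 0) (j := 1) rfl (by decide)

theorem ext_of_bilin {a b : V [⋀^Fin 2]→ₗ[ℝ] ℝ} (h : ∀ u v, bilin a u v = bilin b u v) : a = b := by
  ext m
  rw [eq_vec_two m]
  exact h _ _

theorem bilin_compLinearMap (a : V [⋀^Fin 2]→ₗ[ℝ] ℝ) (L : U →ₗ[ℝ] V) (u v : U) :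
    bilin (a.compLinearMap L) u v = bilin a (L u) (L v) := by
  simp only [bilin_apply, AlternatingMap.compLinearMap_apply]
  congr 1
  ext i; fin_cases i <;> rfl

theorem mem_formKer_iff (a : V [⋀^Fin 2]→ₗ[ℝ] ℝ) (v : V) :
    v ∈ formKer a ↔ ∀ u, bilin a v u = 0 := by
  constructor
  · intro h u
    rw [bilin_apply, ← update_vec_two_zero 0 u v]
    exact h 0 ![0, u]
  · intro h i w
    fin_cases i
    · have := h (w 1)
      rw [eq_vec_two (Function.update _ _ _)]
      simpa using this
    · have := h (w 0)
      rw [← (bilin_isAlt a).neg, neg_eq_zero] at this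
      rw [eq_vec_two (Function.update _ _ _)]
      simpa using this

theorem formKer_eq_ker (a : V [⋀^Fin 2]→ₗ[ℝ] ℝ) : formKer a = LinearMap.ker (bilin a) := by
  ext v
  rw [mem_formKer_iff, LinearMap.mem_ker, LinearMap.ext_iff]
  rfl

theorem apply_update_of_mem_ker {k : ℕ} (τ : V [⋀^Fin k]→ₗ[ℝ] ℝ) {P : V →ₗ[ℝ] V}
    (hP : τ.compLinearMap P = τ) {v : V} (hv : P v = 0) : v ∈ formKer τ := by
  intro i w
  rw [← hP, AlternatingMap.compLinearMap_apply]
  exact τ.map_coord_zero i (by simp [hv])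

/-- For v in the kernel, a is invariant under a projection P that kills v. By naturality its powers
are invariant under P too, so they vanish whenever v fills a slot. -/
theorem formKer_le_formKer_formPow (a : V [⋀^Fin 2]→ₗ[ℝ] ℝ) (k : ℕ) :
    formKer a ≤ formKer (formPow a k) := by
  intro v hv
  by_cases hv0 : v = 0
  · rw [hv0]; exact zero_mem _
  obtain ⟨φ, hφ⟩ := Module.Projective.exists_dual_ne_zero ℝ hv0
  set P : V →ₗ[ℝ] V := LinearMap.id - ((φ v)⁻¹ • φ).smulRight v with hP
  have hPv : P v = 0 := by simp [hP, hφ]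
  have ha : a.compLinearMap P = a := by
    refine ext_of_bilin fun x y => ?_
    rw [mem_formKer_iff] at hv
    have hv' : ∀ u, bilin a u v = 0 := fun u => by
      rw [← (bilin_isAlt a).neg, hv, neg_zero]
    rw [bilin_compLinearMap]
    simp only [hP, LinearMap.sub_apply, LinearMap.id_apply, LinearMap.smulRight_apply, map_sub,
      map_smul, hv, hv', LinearMap.smul_apply, smul_zero, sub_zero]
  refine apply_update_of_mem_ker _ (P := P) ?_ hPv
  rw [← formPow_compLinearMap, ha]

/-- Replacing the j-th vector of a basis by v multiplies a top form by the j-th coordinate of v. -/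
theorem eq_zero_of_mem_formKer [FiniteDimensional ℝ V] {k : ℕ} (hk : Module.finrank ℝ V = k)
    (τ : V [⋀^Fin k]→ₗ[ℝ] ℝ) (hτ : τ ≠ 0) {v : V} (hv : v ∈ formKer τ) : v = 0 := by
  let b := Module.finBasisOfFinrankEq ℝ V hk
  have hb : τ b ≠ 0 := (AlternatingMap.map_basis_ne_zero_iff b τ).2 hτ
  by_contra hv0
  obtain ⟨j, hj⟩ : ∃ j, b.repr v j ≠ 0 := by
    by_contra! h
    exact hv0 (b.repr.map_eq_zero_iff.1 (Finsupp.ext h))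
  have h1 := hv j b
  rw [← b.sum_repr v, AlternatingMap.map_update_sum, Finset.sum_eq_single j] at h1
  · rw [AlternatingMap.map_update_smul, Function.update_eq_self, smul_eq_mul] at h1
    exact (mul_ne_zero hj hb) h1
  · intro i _ hij
    rw [AlternatingMap.map_update_smul, AlternatingMap.map_update_self _ _ hij.symm, smul_zero]
  · intro h; exact absurd (Finset.mem_univ _) h

theorem top_form_eq_zero [FiniteDimensional ℝ V] {k : ℕ} (hk : Module.finrank ℝ V = k)
    (τ : V [⋀^Fin k]→ₗ[ℝ] ℝ) {v : V} (hv0 : v ≠ 0) (hv : v ∈ formKer τ) : τ = 0 := by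
  by_contra h
  exact hv0 (eq_zero_of_mem_formKer hk τ h hv)

theorem form_eq_zero_of_finrank_lt [FiniteDimensional ℝ V] {k : ℕ} (hk : Module.finrank ℝ V < k)
    (τ : V [⋀^Fin k]→ₗ[ℝ] ℝ) : τ = 0 := by
  ext v
  refine τ.map_linearDependent v fun h => ?_
  have := h.fintype_card_le_finrank
  rw [Fintype.card_fin] at this
  omega

/-- The standard symplectic form on `(ℝ²)^r`. -/
noncomputable def stdForm (r : ℕ) : (Fin r → ℝ × ℝ) [⋀^Fin 2]→ₗ[ℝ] ℝ where
  toFun m := ∑ i, ((m 0 i).1 * (m 1 i).2 - (m 0 i).2 * (m 1 i).1)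
  map_update_add' := by
    intro _ m i x y
    rw [← Finset.sum_add_distrib]
    refine Finset.sum_congr rfl fun j _ => ?_
    fin_cases i <;> simp <;> ring
  map_update_smul' := by
    intro _ m i c x
    rw [Finset.smul_sum]
    refine Finset.sum_congr rfl fun j _ => ?_
    fin_cases i <;> simp <;> ring
  map_eq_zero_of_eq' := by
    intro m i j h hij
    refine Finset.sum_eq_zero fun l _ => ?_
    have : m 0 = m 1 := by
      fin_cases i <;> fin_cases j <;> first | exact absurd rfl hij | exact h | exact h.symm
    rw [this]; ring

theorem bilin_stdForm {r : ℕ} (u v : Fin r → ℝ × ℝ) :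
    bilin (stdForm r) u v = ∑ i, ((u i).1 * (v i).2 - (u i).2 * (v i).1) := rfl

theorem eq_zero_of_bilin_stdForm {r : ℕ} {u : Fin r → ℝ × ℝ}
    (h : ∀ v, bilin (stdForm r) u v = 0) : u = 0 := by
  funext i
  have h1 := h (Pi.single i (1, 0))
  have h2 := h (Pi.single i (0, 1))
  rw [bilin_stdForm, Finset.sum_eq_single i] at h1 h2
  · simp only [Pi.single_eq_same] at h1 h2
    ext
    · simpa using h2
    · simpa using h1
  all_goals first
    | (intro j _ hj; simp [Pi.single_eq_of_ne hj])
    | (intro hi; exact absurd (Finset.mem_univ _) hi)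

/-- Every alternating bilinear form is the pullback of a standard symplectic form under a linear
surjection. -/
theorem exists_surjective_eq_stdForm (N : ℕ) :
    ∀ {V : Type} [AddCommGroup V] [Module ℝ V] [FiniteDimensional ℝ V],
      Module.finrank ℝ V = N → ∀ B : V →ₗ[ℝ] V →ₗ[ℝ] ℝ, B.IsAlt →
        ∃ (r : ℕ) (L : V →ₗ[ℝ] (Fin r → ℝ × ℝ)), Function.Surjective L ∧
          ∀ u v, B u v = bilin (stdForm r) (L u) (L v) := by
  induction N using Nat.strong_induction_on with
  | _ N ih =>
  intro V _ _ _ hN B hB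
  by_cases hB0 : ∀ u v, B u v = 0
  · refine ⟨0, 0, fun w => ⟨0, Subsingleton.elim _ _⟩, fun u v => ?_⟩
    rw [hB0, bilin_stdForm]; rfl
  push Not at hB0
  obtain ⟨x, y', hxy'⟩ := hB0
  obtain ⟨y, hxy⟩ : ∃ y, B x y = 1 := ⟨(B x y')⁻¹ • y', by simp [hxy']⟩
  have hyx : B y x = -1 := by rw [← hB.neg, hxy]
  set p : V →ₗ[ℝ] ℝ := B.flip y with hp
  set q : V →ₗ[ℝ] ℝ := B x with hq
  have hpx : p x = 1 := hxy
  have hpy : p y = 0 := hB y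
  have hqx : q x = 0 := hB x
  have hqy : q y = 1 := hxy
  -- The pair x, y is hyperbolic; W is its orthogonal complement, to which the induction applies,
  -- and π₀ below projects onto W along the plane of x and y.
  let W : Submodule ℝ V := LinearMap.ker p ⊓ LinearMap.ker q
  have hW : Module.finrank ℝ W < N := by
    rw [← hN]
    refine Submodule.finrank_lt (fun h => ?_)
    have hx : x ∈ W := h ▸ Submodule.mem_top
    have : p x = 0 := hx.1
    rw [hpx] at this
    exact one_ne_zero this
  obtain ⟨r, L, hL, hBL⟩ := ih _ hW rfl (B.compl₁₂ W.subtype W.subtype) (fun u => hB _)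
  let π₀ : V →ₗ[ℝ] V := LinearMap.id - p.smulRight x - q.smulRight y
  have hπ₀ : ∀ u, π₀ u = u - p u • x - q u • y := fun u => rfl
  let π : V →ₗ[ℝ] W := π₀.codRestrict W fun u => by
    refine ⟨?_, ?_⟩ <;> rw [SetLike.mem_coe, LinearMap.mem_ker, hπ₀] <;> simp [hpx, hpy, hqx, hqy]
  have hπ : ∀ u, ((π u : W) : V) = u - p u • x - q u • y := fun u => rfl
  let L' : V →ₗ[ℝ] (Fin (r + 1) → ℝ × ℝ) := LinearMap.pi
    (Fin.cons (p.prod q) (fun i => (LinearMap.proj i).comp (L.comp π)))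
  have hL'0 : ∀ u, L' u 0 = (p u, q u) := fun u => rfl
  have hL's : ∀ u i, L' u (Fin.succ i) = L (π u) i := fun u i => rfl
  refine ⟨r + 1, L', fun m => ?_, fun u v => ?_⟩
  · obtain ⟨w, hw⟩ := hL (fun i => m i.succ)
    have hwp : p w = 0 := w.2.1
    have hwq : q w = 0 := w.2.2
    refine ⟨w + (m 0).1 • x + (m 0).2 • y, ?_⟩
    have h1 : p (w + (m 0).1 • x + (m 0).2 • y) = (m 0).1 := by simp [hwp, hpx, hpy]
    have h2 : q (w + (m 0).1 • x + (m 0).2 • y) = (m 0).2 := by simp [hwq, hqx, hqy]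
    have h3 : π (w + (m 0).1 • x + (m 0).2 • y) = w := by
      apply Subtype.ext
      rw [hπ, h1, h2]
      abel
    funext i
    refine Fin.cases ?_ (fun i => ?_) i
    · rw [hL'0, h1, h2]
    · rw [hL's, h3, hw]
  · rw [bilin_stdForm, Fin.sum_univ_succ]
    simp only [hL'0, hL's]
    rw [← bilin_stdForm, ← hBL]
    simp only [LinearMap.compl₁₂_apply, Submodule.subtype_apply, hπ]
    have e1 : ∀ u, B u y = p u := fun u => rfl
    have e2 : ∀ u, B x u = q u := fun u => rfl
    have e3 : ∀ u, B u x = - q u := fun u => by rw [← hB.neg]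
    have e4 : ∀ u, B y u = - p u := fun u => by rw [← hB.neg]; rfl
    simp only [map_sub, LinearMap.sub_apply, map_smul, LinearMap.smul_apply, smul_eq_mul, e1, e2,
      e3, e4, hpx, hpy, hqx, hqy]
    ring

end Bilinear

/-! ### Corank, Gram determinants and kernels of powers -/

section LinearAlgebra

variable {V : Type} [AddCommGroup V] [Module ℝ V] [FiniteDimensional ℝ V]

theorem finrank_std (r : ℕ) : Module.finrank ℝ (Fin r → ℝ × ℝ) = 2 * r := by
  rw [Module.finrank_pi_fintype]
  simp [mul_comm]

/-- The dimension count in the last clause is the source of all parity arguments: the corank has the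
parity of the dimension. -/
theorem exists_eq_stdForm_compLinearMap (a : V [⋀^Fin 2]→ₗ[ℝ] ℝ) :
    ∃ (r : ℕ) (L : V →ₗ[ℝ] (Fin r → ℝ × ℝ)), Function.Surjective L ∧
      a = (stdForm r).compLinearMap L ∧ LinearMap.ker L = formKer a ∧
      2 * r + Module.finrank ℝ (formKer a) = Module.finrank ℝ V := by
  obtain ⟨r, L, hL, h⟩ := exists_surjective_eq_stdForm _ rfl (bilin a) (bilin_isAlt a)
  have hker : LinearMap.ker L = formKer a := by
    ext v
    rw [mem_formKer_iff, LinearMap.mem_ker]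
    refine ⟨fun hv u => by rw [h, hv, map_zero, LinearMap.zero_apply], fun hv => ?_⟩
    refine eq_zero_of_bilin_stdForm fun w => ?_
    obtain ⟨u, rfl⟩ := hL w
    rw [← h, hv]
  refine ⟨r, L, hL, ext_of_bilin fun u v => by rw [h, bilin_compLinearMap], hker, ?_⟩
  rw [← hker, ← LinearMap.finrank_range_add_finrank_ker L, LinearMap.range_eq_top.2 hL,
    finrank_top, finrank_std]

/-- On an even-dimensional space the kernel of a degenerate 2-form meets every hyperplane. -/
theorem exists_mem_formKer_of_functional {n : ℕ} (hV : Module.finrank ℝ V = 2 * n)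
    {a : V [⋀^Fin 2]→ₗ[ℝ] ℝ} (ha : ∃ k ≠ 0, k ∈ formKer a) (φ : V →ₗ[ℝ] ℝ) :
    ∃ k ≠ 0, k ∈ formKer a ∧ φ k = 0 := by
  obtain ⟨r, -, -, -, -, hr⟩ := exists_eq_stdForm_compLinearMap a
  obtain ⟨k, hk0, hk⟩ := ha
  have hpos : 0 < Module.finrank ℝ (formKer a) := by
    refine Module.finrank_pos_iff_exists_ne_zero.2 ⟨⟨k, hk⟩, fun h => hk0 ?_⟩
    exact congrArg Subtype.val h
  have h2 := LinearMap.finrank_range_add_finrank_ker (φ.domRestrict (formKer a))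
  have h3 : Module.finrank ℝ (LinearMap.range (φ.domRestrict (formKer a))) ≤ 1 := by
    simpa using Submodule.finrank_le (LinearMap.range (φ.domRestrict (formKer a)))
  -- The kernel has positive even dimension, hence dimension at least 2, and one functional lowers
  -- it by at most 1.
  have h4 : 0 < Module.finrank ℝ (LinearMap.ker (φ.domRestrict (formKer a))) := by omega
  obtain ⟨⟨⟨x, hx⟩, hx'⟩, hx0⟩ := Module.finrank_pos_iff_exists_ne_zero.1 h4
  refine ⟨x, fun h => hx0 ?_, hx, hx'⟩
  apply Subtype.ext; apply Subtype.ext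
  exact h

section Matrix

variable {ι : Type*} [Fintype ι] [DecidableEq ι]

/-- The Gram matrix of a 2-form in a basis. -/
noncomputable def gram (b : Module.Basis ι ℝ V) (a : V [⋀^Fin 2]→ₗ[ℝ] ℝ) : Matrix ι ι ℝ :=
  LinearMap.toMatrix₂ b b (bilin a)

theorem gram_apply (b : Module.Basis ι ℝ V) (a : V [⋀^Fin 2]→ₗ[ℝ] ℝ) (i j : ι) :
    gram b a i j = a ![b i, b j] := by
  rw [gram, LinearMap.toMatrix₂_apply]; rfl

theorem gram_mulVec (b : Module.Basis ι ℝ V) (a : V [⋀^Fin 2]→ₗ[ℝ] ℝ) (x : ι → ℝ) (i : ι) :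
    (gram b a).mulVec x i = bilin a (b i) (∑ j, x j • b j) := by
  rw [Matrix.mulVec, dotProduct, map_sum]
  refine Finset.sum_congr rfl fun j _ => ?_
  rw [gram_apply, map_smul, smul_eq_mul, mul_comm, bilin_apply]

theorem mem_formKer_of_basis (b : Module.Basis ι ℝ V) {a : V [⋀^Fin 2]→ₗ[ℝ] ℝ} {v : V}
    (h : ∀ i, bilin a (b i) v = 0) : v ∈ formKer a := by
  rw [formKer_eq_ker, LinearMap.mem_ker]
  refine b.ext fun i => ?_
  rw [← (bilin_isAlt a).neg, h i, neg_zero, LinearMap.zero_apply]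

theorem det_gram_eq_zero_iff (b : Module.Basis ι ℝ V) (a : V [⋀^Fin 2]→ₗ[ℝ] ℝ) :
    (gram b a).det = 0 ↔ ∃ k ≠ 0, k ∈ formKer a := by
  rw [← Matrix.exists_mulVec_eq_zero_iff]
  constructor
  · rintro ⟨x, hx, h⟩
    refine ⟨∑ j, x j • b j, fun h0 => hx ?_, mem_formKer_of_basis b fun i => ?_⟩
    · funext j
      exact Fintype.linearIndependent_iff.1 b.linearIndependent x h0 j
    · rw [← gram_mulVec, h]; rfl
  · rintro ⟨k, hk0, hk⟩
    refine ⟨b.repr k, fun h => hk0 ?_, ?_⟩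
    · rw [← b.sum_repr k]
      exact Finset.sum_eq_zero fun i _ => by rw [congrFun h i]; simp
    · funext i
      rw [gram_mulVec, b.sum_repr, ← (bilin_isAlt a).neg, (mem_formKer_iff a k).1 hk]
      simp

/-- The (i, j) entry is the determinant after row j has been replaced by the i-th coordinate
functional. A nonzero kernel vector with vanishing i-th coordinate, which exists by parity, is
annihilated by the modified matrix. -/
theorem adjugate_gram_eq_zero {n : ℕ} (hV : Module.finrank ℝ V = 2 * n)
    (b : Module.Basis ι ℝ V) {a : V [⋀^Fin 2]→ₗ[ℝ] ℝ} (ha : ∃ k ≠ 0, k ∈ formKer a) :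
    (gram b a).adjugate = 0 := by
  ext i j
  obtain ⟨k, hk0, hk, hki⟩ := exists_mem_formKer_of_functional hV ha (b.coord i)
  rw [Matrix.adjugate_apply, Matrix.zero_apply, ← Matrix.exists_mulVec_eq_zero_iff]
  refine ⟨b.repr k, fun h => hk0 ?_, ?_⟩
  · rw [← b.sum_repr k]
    exact Finset.sum_eq_zero fun i _ => by rw [congrFun h i]; simp
  · funext l
    by_cases hl : l = j
    · subst hl
      simp only [Matrix.mulVec, Matrix.updateRow_self, single_dotProduct, one_mul]
      exact hki
    · have h1 : (Matrix.updateRow (gram b a) j (Pi.single i 1)).mulVec (b.repr k) l =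
          (gram b a).mulVec (b.repr k) l := by
        simp only [Matrix.mulVec, Matrix.updateRow_ne hl]
      rw [h1, gram_mulVec, b.sum_repr, ← (bilin_isAlt a).neg, (mem_formKer_iff a k).1 hk]
      simp

theorem formPow_eq_zero_of_degenerate {n : ℕ} (hV : Module.finrank ℝ V = 2 * n)
    {a : V [⋀^Fin 2]→ₗ[ℝ] ℝ} (ha : ∃ k ≠ 0, k ∈ formKer a) : formPow a n = 0 := by
  obtain ⟨k, hk0, hk⟩ := ha
  exact top_form_eq_zero hV _ hk0 (formKer_le_formKer_formPow a n hk)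

theorem top_form_comp {n : ℕ} (b : Module.Basis (Fin n) ℝ V) (τ : V [⋀^Fin n]→ₗ[ℝ] ℝ)
    (P : V →ₗ[ℝ] V) : τ (P ∘ b) = LinearMap.det P * τ b := by
  conv_lhs => rw [AlternatingMap.eq_smul_basis_det b τ]
  rw [AlternatingMap.smul_apply, Module.Basis.det_comp, b.det_self]
  simp [mul_comm]

/-- The determinant of the Gram matrix is a multiple of the square of the top power. -/
theorem exists_det_gram_eq {n : ℕ} (b : Module.Basis (Fin (2 * n)) ℝ V)
    (b' : Module.Basis ι ℝ V) {a₀ : V [⋀^Fin 2]→ₗ[ℝ] ℝ} (h₀ : formPow a₀ n b ≠ 0) :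
    ∃ c ≠ 0, ∀ a : V [⋀^Fin 2]→ₗ[ℝ] ℝ, (gram b' a).det = c * (formPow a n b) ^ 2 := by
  have hV : Module.finrank ℝ V = 2 * n := by simpa using Module.finrank_eq_card_basis b
  have hnd : ¬ ∃ k ≠ 0, k ∈ formKer a₀ := fun h =>
    h₀ (by rw [formPow_eq_zero_of_degenerate hV h]; rfl)
  have hd₀ : (gram b' a₀).det ≠ 0 := fun h => hnd ((det_gram_eq_zero_iff b' a₀).1 h)
  -- Nondegenerate forms make up one orbit of the linear group, and both sides of the identity scale
  -- by det(P)²; the constant is thus read off at the reference form a₀.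
  have nondeg : ∀ a : V [⋀^Fin 2]→ₗ[ℝ] ℝ, (¬ ∃ k ≠ 0, k ∈ formKer a) →
      ∃ L : V ≃ₗ[ℝ] (Fin n → ℝ × ℝ), a = (stdForm n).compLinearMap L := by
    intro a ha
    obtain ⟨r, L, hL, haL, hker, hr⟩ := exists_eq_stdForm_compLinearMap a
    have hbot : formKer a = ⊥ := by
      rw [Submodule.eq_bot_iff]
      intro x hx
      by_contra hx0
      exact ha ⟨x, hx0, hx⟩
    rw [hbot, finrank_bot, hV] at hr
    obtain rfl : r = n := by omega
    exact ⟨LinearEquiv.ofBijective L ⟨LinearMap.ker_eq_bot.1 (hker.trans hbot), hL⟩, haL⟩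
  obtain ⟨L₀, hL₀⟩ := nondeg a₀ hnd
  refine ⟨(gram b' a₀).det / (formPow a₀ n b) ^ 2, div_ne_zero hd₀ (pow_ne_zero 2 h₀),
    fun a => ?_⟩
  by_cases ha : ∃ k ≠ 0, k ∈ formKer a
  · rw [(det_gram_eq_zero_iff b' a).2 ha, formPow_eq_zero_of_degenerate hV ha]
    simp
  obtain ⟨L, hL⟩ := nondeg a ha
  set P : V →ₗ[ℝ] V := (L.trans L₀.symm).toLinearMap with hP
  have haP : a = a₀.compLinearMap P := by
    rw [hL, hL₀]
    refine ext_of_bilin fun u v => ?_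
    simp only [bilin_compLinearMap]
    simp [hP]
  have h1 : (gram b' a).det = LinearMap.det P ^ 2 * (gram b' a₀).det := by
    have : bilin a = (bilin a₀).compl₁₂ P P := by
      ext u v
      rw [haP, bilin_compLinearMap]; rfl
    rw [gram, this, LinearMap.toMatrix₂_compl₁₂ b' b' b' b', Matrix.det_mul, Matrix.det_mul,
      Matrix.det_transpose, LinearMap.det_toMatrix, gram]
    ring
  have h2 : formPow a n b = LinearMap.det P * formPow a₀ n b := by
    rw [haP, formPow_compLinearMap, ← top_form_comp]
    rfl
  rw [h1, h2]
  field_simp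

end Matrix

/-- The segment between two degenerate forms which agree on a hyperplane is degenerate. -/
theorem degenerate_segment {n : ℕ} (hV : Module.finrank ℝ V = 2 * n)
    {a₀ a₁ : V [⋀^Fin 2]→ₗ[ℝ] ℝ} (h₀ : ∃ k ≠ 0, k ∈ formKer a₀) (h₁ : ∃ k ≠ 0, k ∈ formKer a₁)
    {ℓ : V →ₗ[ℝ] ℝ} {v : V} (hv : ℓ v = 1)
    (h : ∀ x y, ℓ x = 0 → ℓ y = 0 → bilin a₀ x y = bilin a₁ x y) (t : ℝ) :
    ∃ k ≠ 0, k ∈ formKer (a₀ + t • (a₁ - a₀)) := by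
  obtain ⟨r₀, hr₀, hk₀, hℓ₀⟩ := exists_mem_formKer_of_functional hV h₀ ℓ
  obtain ⟨r₁, hr₁, hk₁, hℓ₁⟩ := exists_mem_formKer_of_functional hV h₁ ℓ
  rw [mem_formKer_iff] at hk₀ hk₁
  have hb : ∀ x y, bilin (a₀ + t • (a₁ - a₀)) x y =
      bilin a₀ x y + t * (bilin a₁ x y - bilin a₀ x y) := fun x y => rfl
  -- For a vector r of the hyperplane that is orthogonal to the hyperplane, only the pairing with v
  -- can keep r out of the kernel.
  have crit : ∀ r, ℓ r = 0 → (∀ y, ℓ y = 0 → bilin a₀ r y = 0) →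
      bilin (a₀ + t • (a₁ - a₀)) r v = 0 → r ∈ formKer (a₀ + t • (a₁ - a₀)) := by
    intro r hr hry hrv
    rw [mem_formKer_iff]
    intro u
    have hu : u = (u - ℓ u • v) + ℓ u • v := by abel
    have hu0 : ℓ (u - ℓ u • v) = 0 := by simp [hv]
    rw [hu, map_add, map_smul, hrv, smul_zero, add_zero, hb, ← h r _ hr hu0, hry _ hu0]
    ring
  have g₀ : ∀ y, ℓ y = 0 → bilin a₀ r₀ y = 0 := fun y _ => hk₀ y
  have g₁ : ∀ y, ℓ y = 0 → bilin a₀ r₁ y = 0 := fun y hy => by rw [h _ _ hℓ₁ hy, hk₁]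
  set p := bilin (a₀ + t • (a₁ - a₀)) r₀ v with hp
  set q := bilin (a₀ + t • (a₁ - a₀)) r₁ v with hq
  by_cases hq0 : q = 0
  · exact ⟨r₁, hr₁, crit r₁ hℓ₁ g₁ hq0⟩
  -- The combination qr₀ - pr₁ pairs to zero with v. If it vanishes, r₀ is a multiple of r₁ and so
  -- lies in both kernels.
  by_cases hr : q • r₀ - p • r₁ = 0
  · refine ⟨r₀, hr₀, crit r₀ hℓ₀ g₀ ?_⟩
    have h2 : r₀ = (q⁻¹ * p) • r₁ := by
      rw [sub_eq_zero] at hr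
      rw [mul_smul, ← hr, smul_smul, inv_mul_cancel₀ hq0, one_smul]
    have h3 : bilin a₁ r₀ v = 0 := by
      rw [h2, map_smul, LinearMap.smul_apply, hk₁, smul_zero]
    rw [hb, hk₀, h3]; ring
  · refine ⟨_, hr, crit _ (by simp [hℓ₀, hℓ₁]) (fun y hy => ?_) ?_⟩
    · simp only [map_sub, map_smul, LinearMap.sub_apply, LinearMap.smul_apply, g₀ y hy, g₁ y hy,
        smul_zero, sub_zero]
    · simp only [map_sub, map_smul, LinearMap.sub_apply, LinearMap.smul_apply, ← hp, ← hq,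
        smul_eq_mul]
      ring

theorem formPow_eq_zero_of_corank {m r : ℕ} (L : V →ₗ[ℝ] (Fin r → ℝ × ℝ))
    (h : formPow (stdForm m) m = 0) (hr : r ≤ m) :
    formPow ((stdForm r).compLinearMap L) m = 0 := by
  rw [formPow_compLinearMap]
  rcases hr.eq_or_lt with rfl | hlt
  · rw [h]; rfl
  · rw [form_eq_zero_of_finrank_lt (by rw [finrank_std]; omega) (formPow (stdForm r) m)]; rfl

/-- If some 2-form has nonzero top power, then the kernel of the `m`-th power of a form of
rank `2m` and corank `2` is the kernel of the form. -/
theorem formKer_formPow_eq {m : ℕ} (hV : Module.finrank ℝ V = 2 * (m + 1))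
    {a₁ : V [⋀^Fin 2]→ₗ[ℝ] ℝ} (h₁ : formPow a₁ (m + 1) ≠ 0) {a : V [⋀^Fin 2]→ₗ[ℝ] ℝ}
    (ha : Module.finrank ℝ (formKer a) = 2) : formKer (formPow a m) = formKer a := by
  refine le_antisymm ?_ (formKer_le_formKer_formPow a m)
  obtain ⟨r, L, hL, haL, hker, hr⟩ := exists_eq_stdForm_compLinearMap a
  obtain rfl : r = m := by omega
  -- Indirectly: any 2r vectors lie in the image of a map P of rank at most 2r, so a₁ on them
  -- factors through a standard form with at most r planes. If the top power of the standard form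
  -- vanished, the r-th and then the (r+1)-st power of a₁ would vanish.
  have hne : formPow (stdForm r) r ≠ 0 := by
    intro h0
    apply h₁
    have : formPow a₁ r = 0 := by
      ext u
      let W := Submodule.span ℝ (Set.range u)
      have hW : Module.finrank ℝ W ≤ 2 * r := by
        exact (finrank_range_le_card (R := ℝ) u).trans (by simp)
      obtain ⟨g, hg⟩ := LinearMap.exists_leftInverse_of_injective W.subtype
        (Submodule.ker_subtype W)
      let P : V →ₗ[ℝ] V := W.subtype.comp g
      have hPu : P ∘ u = u := by
        funext i
        have hui : u i ∈ W := Submodule.subset_span ⟨i, rfl⟩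
        have := LinearMap.congr_fun hg ⟨u i, hui⟩
        exact congrArg Subtype.val this
      have hkerP : 2 ≤ Module.finrank ℝ (LinearMap.ker P) := by
        have h2 := LinearMap.finrank_range_add_finrank_ker P
        have h3 : Module.finrank ℝ (LinearMap.range P) ≤ Module.finrank ℝ W :=
          Submodule.finrank_mono (by rintro _ ⟨x, rfl⟩; exact (g x).2)
        omega
      have hle : LinearMap.ker P ≤ formKer (a₁.compLinearMap P) := by
        intro x hx
        rw [mem_formKer_iff]
        intro y
        rw [bilin_compLinearMap, LinearMap.mem_ker.1 hx, map_zero, LinearMap.zero_apply]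
      obtain ⟨r', L', -, haL', -, hr'⟩ := exists_eq_stdForm_compLinearMap (a₁.compLinearMap P)
      have h4 := Submodule.finrank_mono hle
      have h5 : formPow (a₁.compLinearMap P) r = 0 := by
        rw [haL']
        exact formPow_eq_zero_of_corank L' h0 (by omega)
      rw [formPow_compLinearMap] at h5
      have h6 := congrArg (fun τ => τ u) h5
      rw [AlternatingMap.zero_apply]
      rw [← hPu]
      exact h6
    rw [formPow, this, zero_wedge]
  intro v hv
  rw [← hker, LinearMap.mem_ker]
  refine eq_zero_of_mem_formKer (finrank_std r) _ hne fun i w => ?_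
  choose u hu using fun j => hL (w j)
  have h1 := hv i u
  rw [haL, formPow_compLinearMap, AlternatingMap.compLinearMap_apply] at h1
  rw [← h1]
  congr 1
  funext j
  by_cases hj : j = i
  · subst hj; simp
  · simp [hj, hu]

/-- Two 2-forms with the same kernel which agree on a hyperplane are related by a linear map which
fixes the hyperplane. -/
theorem exists_vector_of_same_kernel {a₀ a₁ : V [⋀^Fin 2]→ₗ[ℝ] ℝ} (hK : formKer a₀ = formKer a₁)
    {ℓ : V →ₗ[ℝ] ℝ} {v : V} (hv : ℓ v = 1)
    (h : ∀ x y, ℓ x = 0 → ℓ y = 0 → bilin a₀ x y = bilin a₁ x y) :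
    ∃ w, ℓ w ≠ 0 ∧ ∀ u, ℓ u = 0 → bilin a₁ w u = bilin a₀ v u := by
  have split : ∀ (z : V), ℓ z = 1 → ∀ x, ℓ (x - ℓ x • z) = 0 := fun z hz x => by simp [hz]
  -- If the kernel is transverse to the hyperplane, the restriction determines the whole form, and w
  -- = v will do.
  by_cases hKT : ∃ k ∈ formKer a₀, ℓ k ≠ 0
  · obtain ⟨k, hk, hℓk⟩ := hKT
    have hk1 : k ∈ formKer a₁ := hK ▸ hk
    rw [mem_formKer_iff] at hk hk1
    refine ⟨v, by simp [hv], fun u hu => ?_⟩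
    have hv' : v = (v - (ℓ k)⁻¹ • k) + (ℓ k)⁻¹ • k := by abel
    have h0 : ℓ (v - (ℓ k)⁻¹ • k) = 0 := by simp [hv, hℓk]
    rw [hv']
    simp only [map_add, map_smul, LinearMap.add_apply, LinearMap.smul_apply, hk, hk1]
    rw [h _ _ h0 hu]
  · push Not at hKT
    have hrange : LinearMap.range (bilin a₁) =
        (LinearMap.ker (bilin a₁)).dualAnnihilator := by
      refine Submodule.eq_of_le_of_finrank_eq ?_ ?_
      · rintro _ ⟨x, rfl⟩
        rw [Submodule.mem_dualAnnihilator]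
        intro y hy
        rw [← (bilin_isAlt a₁).neg, LinearMap.mem_ker.1 hy]
        simp
      · have h1 := LinearMap.finrank_range_add_finrank_ker (bilin a₁)
        have h2 : Module.finrank ℝ (LinearMap.ker (bilin a₁)) +
            Module.finrank ℝ (LinearMap.ker (bilin a₁)).dualAnnihilator = Module.finrank ℝ V :=
          Subspace.finrank_add_finrank_dualAnnihilator_eq (LinearMap.ker (bilin a₁))
        exact Nat.add_right_cancel (h1.trans (h2.symm.trans (add_comm _ _)))
    -- The functional a₀(v, ·) kills the common kernel, hence is represented by a₁ through some w.
    have hmem : bilin a₀ v ∈ LinearMap.range (bilin a₁) := by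
      rw [hrange, Submodule.mem_dualAnnihilator]
      intro y hy
      rw [← formKer_eq_ker, ← hK, mem_formKer_iff] at hy
      rw [← (bilin_isAlt a₀).neg, hy, neg_zero]
    obtain ⟨w, hw⟩ := hmem
    refine ⟨w, fun hw0 => ?_, fun u _ => by rw [hw]⟩
    -- If w were in the hyperplane, v - w would be a kernel vector outside it, contrary to the
    -- present case.
    have h1 : v - w ∈ formKer a₀ := by
      rw [mem_formKer_iff]
      intro u
      have hvw : ℓ (v - w) = 1 := by simp [hv, hw0]
      have hu : u = (u - ℓ u • (v - w)) + ℓ u • (v - w) := by abel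
      have hu0 := split _ hvw u
      have key : ∀ u', ℓ u' = 0 → bilin a₀ (v - w) u' = 0 := fun u' hu' => by
        rw [map_sub, LinearMap.sub_apply, h w _ hw0 hu', hw, sub_self]
      rw [hu, map_add, map_smul, bilin_isAlt a₀ (v - w), smul_zero, add_zero, key _ hu0]
    have := hKT _ h1
    rw [map_sub, hv, hw0] at this
    norm_num at this

end LinearAlgebra

/-! ### Differential 2-forms as bilinear maps -/

section Forms

variable {E : Type} [NormedAddCommGroup E] [NormedSpace ℝ E]

theorem norm_bilin_le (a : E [⋀^Fin 2]→L[ℝ] ℝ) (u v : E) :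
    ‖bilin a.toAlternatingMap u v‖ ≤ ‖a‖ * ‖u‖ * ‖v‖ := by
  have := a.le_opNorm ![u, v]
  rw [Fin.prod_univ_two] at this
  rw [mul_assoc]
  exact this

variable (E) in
/-- The bilinear map of a continuous 2-form. -/
noncomputable def formBilin : (E [⋀^Fin 2]→L[ℝ] ℝ) →L[ℝ] E →L[ℝ] E →L[ℝ] ℝ :=
  LinearMap.mkContinuous
    { toFun := fun a => LinearMap.mkContinuous₂ (bilin a.toAlternatingMap) ‖a‖ (norm_bilin_le a)
      map_add' := fun a b => by ext u v; rfl
      map_smul' := fun r a => by ext u v; rfl }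
    1 (fun a => by
      rw [one_mul]
      exact LinearMap.mkContinuous₂_norm_le _ (norm_nonneg a) (norm_bilin_le a))

theorem formBilin_apply (a : E [⋀^Fin 2]→L[ℝ] ℝ) (u v : E) : formBilin E a u v = a ![u, v] := rfl

theorem formBilin_self (a : E [⋀^Fin 2]→L[ℝ] ℝ) (u : E) : formBilin E a u u = 0 :=
  bilin_isAlt a.toAlternatingMap u

theorem formBilin_swap (a : E [⋀^Fin 2]→L[ℝ] ℝ) (u v : E) :
    formBilin E a u v = -formBilin E a v u :=
  ((bilin_isAlt a.toAlternatingMap).neg v u).symm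

theorem form_ext {a b : E [⋀^Fin 2]→L[ℝ] ℝ} (h : ∀ u v, formBilin E a u v = formBilin E b u v) :
    a = b := by
  ext m
  rw [eq_vec_two m]
  exact h _ _

theorem formBilin_compContinuousLinearMap {E' : Type} [NormedAddCommGroup E'] [NormedSpace ℝ E']
    (a : E [⋀^Fin 2]→L[ℝ] ℝ) (L : E' →L[ℝ] E) (u v : E') :
    formBilin E' (a.compContinuousLinearMap L) u v = formBilin E a (L u) (L v) :=
  bilin_compLinearMap a.toAlternatingMap L.toLinearMap u v

theorem extDeriv_eq_zero_cyclic {ω : E → E [⋀^Fin 2]→L[ℝ] ℝ} {x : E}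
    (hd : DifferentiableAt ℝ ω x) (h : extDeriv ω x = 0) (u v w : E) :
    formBilin E (fderiv ℝ ω x u) v w - formBilin E (fderiv ℝ ω x v) u w +
      formBilin E (fderiv ℝ ω x w) u v = 0 := by
  have h1 := extDeriv_apply hd ![u, v, w]
  rw [h, Fin.sum_univ_three] at h1
  have e0 : Fin.removeNth 0 ![u, v, w] = ![v, w] := by funext i; fin_cases i <;> rfl
  have e1 : Fin.removeNth 1 ![u, v, w] = ![u, w] := by funext i; fin_cases i <;> rfl
  have e2 : Fin.removeNth 2 ![u, v, w] = ![u, v] := by funext i; fin_cases i <;> rfl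
  rw [e0, e1, e2] at h1
  simp only [formBilin_apply]
  have e : ∀ m : Fin 2 → E, fderiv ℝ (fun y => ω y m) x = (ContinuousAlternatingMap.apply ℝ E ℝ m).comp
      (fderiv ℝ ω x) := fun m =>
    ((ContinuousAlternatingMap.apply ℝ E ℝ m).hasFDerivAt.comp x hd.hasFDerivAt).fderiv
  simp only [e] at h1
  simp at h1
  linarith

theorem fderiv_formBilin {ω : E → E [⋀^Fin 2]→L[ℝ] ℝ} {x : E} (hd : DifferentiableAt ℝ ω x) :
    HasFDerivAt (fun y => formBilin E (ω y)) ((formBilin E).comp (fderiv ℝ ω x)) x :=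
  HasFDerivAt.comp (g := fun a : E [⋀^Fin 2]→L[ℝ] ℝ => formBilin E a) x
    (ContinuousLinearMap.hasFDerivAt (F := E →L[ℝ] E →L[ℝ] ℝ) (formBilin E)) hd.hasFDerivAt

theorem RegularAt.formBilin {X : Type*} [NormedAddCommGroup X] [NormedSpace ℝ X] {c : Category}
    {x : X} {ω : X → E [⋀^Fin 2]→L[ℝ] ℝ} (h : RegularAt c ω x) :
    RegularAt c (fun y => SingularSymplectic.formBilin E (ω y)) x := by
  refine RegularAt.comp (g := fun a => SingularSymplectic.formBilin E a) ?_ h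
  exact ContinuousLinearMap.regularAt (F := E →L[ℝ] E →L[ℝ] ℝ) (SingularSymplectic.formBilin E)

section Regularity

variable {X : Type*} [NormedAddCommGroup X] [NormedSpace ℝ X] [FiniteDimensional ℝ E]
  {c : Category} {x : X} {k : ℕ}

/-- Evaluation on tuples of basis vectors is an injective linear map, and a linear left inverse
recovers the form from its coefficients. -/
theorem regularAt_form_of_apply {ω : X → E [⋀^Fin k]→L[ℝ] ℝ}
    (h : ∀ m, RegularAt c (fun y => ω y m) x) : RegularAt c ω x := by
  let b := Module.finBasis ℝ E
  let L : (E [⋀^Fin k]→L[ℝ] ℝ) →ₗ[ℝ] ((Fin k → Fin (Module.finrank ℝ E)) → ℝ) :=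
    { toFun := fun a r => a (fun i => b (r i))
      map_add' := fun _ _ => rfl
      map_smul' := fun _ _ => rfl }
  have hL : LinearMap.ker L = ⊥ := by
    rw [LinearMap.ker_eq_bot]
    intro a a' haa'
    apply ContinuousAlternatingMap.toAlternatingMap_injective
    refine b.ext_alternating fun r _ => congrFun haa' r
  obtain ⟨g, hg⟩ := LinearMap.exists_leftInverse_of_injective L hL
  have h1 : RegularAt c (fun y => L (ω y)) x := regularAt_pi fun r => h _
  have h2 := (ContinuousLinearMap.regularAt (c := c) (x := L (ω x))
    (LinearMap.toContinuousLinearMap g)).comp (f := fun y => L (ω y)) h1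
  refine h2.congr (Eventually.of_forall fun y => ?_)
  exact (LinearMap.congr_fun hg (ω y)).symm

theorem RegularAt.form_apply {ω : X → E [⋀^Fin k]→L[ℝ] ℝ} {m : X → Fin k → E}
    (hω : RegularAt c ω x) (hm : ∀ i, RegularAt c (fun y => m y i) x) :
    RegularAt c (fun y => ω y (m y)) x := by
  let b := Module.finBasis ℝ E
  have hexp : ∀ y, ω y (m y) = ∑ r : Fin k → Fin (Module.finrank ℝ E),
      (∏ i, b.coord (r i) (m y i)) • ω y (fun i => b (r i)) := by
    intro y
    have h1 : m y = fun i => ∑ j, b.coord j (m y i) • b j := by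
      funext i; exact (b.sum_repr (m y i)).symm
    conv_lhs => rw [h1]
    have h2 := (ω y).toMultilinearMap.map_sum (fun i j => b.coord j (m y i) • b j)
    refine h2.trans (Finset.sum_congr rfl fun r _ => ?_)
    exact (ω y).toMultilinearMap.map_smul_univ _ _
  simp only [hexp]
  refine RegularAt.sum fun r _ => RegularAt.smul (RegularAt.prod fun i _ => ?_) ?_
  · exact (ContinuousLinearMap.regularAt
      (LinearMap.toContinuousLinearMap (b.coord (r i)))).comp (hm i)
  · have hev : RegularAt c (fun a : E [⋀^Fin k]→L[ℝ] ℝ => a (fun i => b (r i))) (ω x) :=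
      ContinuousLinearMap.regularAt
        (ContinuousAlternatingMap.apply ℝ E ℝ (fun i => b (r i)))
    exact hev.comp hω

theorem RegularAt.form_pullback {E' : Type} [NormedAddCommGroup E'] [NormedSpace ℝ E']
    [FiniteDimensional ℝ E'] {ω : E → E [⋀^Fin k]→L[ℝ] ℝ} {Φ : E' → E} {z : E'}
    (hω : RegularAt c ω (Φ z)) (hΦ : RegularAt c Φ z) :
    RegularAt c (fun y => (ω (Φ y)).compContinuousLinearMap (_root_.fderiv ℝ Φ y)) z := by
  refine regularAt_form_of_apply fun m => ?_
  have h1 : RegularAt c (fun y => ω (Φ y)) z := hω.comp hΦ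
  exact h1.form_apply (m := fun y i => _root_.fderiv ℝ Φ y (m i))
    fun i => hΦ.fderiv.clm_apply (regularAt_const _)

end Regularity

end Forms

/-! ### The relative Poincaré lemma -/

section Poincare

variable {E : Type} [NormedAddCommGroup E] [NormedSpace ℝ E] {c : Category}

theorem hasDerivAt_formBilin_comp {ω : E → E [⋀^Fin 2]→L[ℝ] ℝ} {y : ℝ → E} {y' : E} {s : ℝ}
    (hd : DifferentiableAt ℝ ω (y s)) (hy : HasDerivAt y y' s) :
    HasDerivAt (fun s => formBilin E (ω (y s))) (formBilin E (fderiv ℝ ω (y s) y')) s :=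
  HasFDerivAt.comp_hasDerivAt (E := E →L[ℝ] E →L[ℝ] ℝ) (F := E) s
    (fderiv_formBilin hd) hy

set_option maxHeartbeats 1000000 in
/-- The relative Poincaré lemma: a closed 2-form whose pullback to the hyperplane `ℓ = 0` vanishes
is of the form `d(ℓ α)`. -/
theorem exists_primitive_of_closed {ω : E → E [⋀^Fin 2]→L[ℝ] ℝ} {ℓ : E →L[ℝ] ℝ} {v : E}
    (hv : ℓ v = 1) (hω : RegularAt c ω 0) (hcl : ∀ᶠ x in 𝓝 (0 : E), extDeriv ω x = 0)
    (hres : ∀ᶠ x in 𝓝 (0 : E), ℓ x = 0 → ∀ u w, ℓ u = 0 → ℓ w = 0 → formBilin E (ω x) u w = 0) :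
    ∃ α : E → E →L[ℝ] ℝ, RegularAt c α 0 ∧ (ω 0 = 0 → α 0 = 0) ∧
      ∀ᶠ x in 𝓝 (0 : E), ∀ a b, formBilin E (ω x) a b =
        ℓ a * α x b - ℓ b * α x a + ℓ x * (fderiv ℝ α x a b - fderiv ℝ α x b a) := by
  set g : E → E →L[ℝ] ℝ := fun z => formBilin E (ω z) v with hg
  have hgr : RegularAt c g 0 :=
    hω.formBilin.clm_apply (regularAt_const v)
  have hsr : RegularAt c (fun x => superpose g (shrink ℓ v x)) 0 :=
    regularAt_superpose_shrink hgr (map_zero ℓ)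
  -- The factor ℓ comes from the velocity ℓ(x)v of the contraction onto the hyperplane; the homotopy
  -- operator without it is the mean of v ⌟ ω along the segment.
  refine ⟨fun x => totalIntegral _ (superpose g (shrink ℓ v x)),
    (ContinuousLinearMap.regularAt (totalIntegral _)).comp hsr, fun h0 => ?_, ?_⟩
  · have : superpose g (shrink ℓ v 0) = 0 := by
      rw [shrink_of_eq_zero (map_zero ℓ)]
      ext1 s
      rw [superpose_apply_of_continuous (by simpa using continuous_const)]
      simp [hg, h0]
    change totalIntegral _ (superpose g (shrink ℓ v 0)) = 0
    rw [this, map_zero]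
  have hS : RegularAt c (superpose g) (ContinuousMap.const UnitIcc (0 : E)) :=
    regularAt_superpose hgr
  filter_upwards [(tendsto_shrink (v := v) (map_zero ℓ)).eventually ((eventually_superpose UnitIcc
    hgr (hω.eventually_differentiableAt.and (hcl.and hres))).and hS.eventually_differentiableAt)]
    with x hx a b
  obtain ⟨⟨h1, h2, h3⟩, h4⟩ := hx
  set S := superpose g (shrink ℓ v x) with hSdef
  set D := fderiv ℝ (superpose g) (shrink ℓ v x) with hDdef
  have hα : ∀ a', fderiv ℝ (fun x => totalIntegral _ (superpose g (shrink ℓ v x))) x a' =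
      totalIntegral _ (D (shrink ℓ v a')) := by
    intro a'
    have hc := h4.hasFDerivAt.comp x (shrink ℓ v).hasFDerivAt
    have := (totalIntegral (E →L[ℝ] ℝ)).hasFDerivAt.comp x hc
    exact congrArg (fun L => L a') this.fderiv
  rw [hα, hα]
  let ev : E → C(UnitIcc, E →L[ℝ] ℝ) →L[ℝ] C(UnitIcc, ℝ) := fun b' =>
    (ContinuousLinearMap.apply ℝ ℝ b').compLeftContinuous ℝ UnitIcc
  have hev : ∀ (h : C(UnitIcc, E →L[ℝ] ℝ)) (b' : E),
      totalIntegral _ h b' = totalIntegral ℝ (ev b' h) := fun h b' =>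
    ContinuousLinearMap.totalIntegral_comm (ContinuousLinearMap.apply ℝ ℝ b') h
  have hev' : ∀ (h : C(UnitIcc, E →L[ℝ] ℝ)) (b' : E) (s : UnitIcc), ev b' h s = h s b' :=
    fun _ _ _ => rfl
  rw [hev, hev, hev, hev]
  -- The pullback of ω under the contraction at time s is differentiated in s; closedness converts
  -- the derivative into the integrand on the left. At s = 1 it is ω, at s = 0 the pullback through
  -- the hyperplane, which vanishes.
  have key : totalIntegral ℝ (ℓ a • ev b S - ℓ b • ev a S +
      ℓ x • (ev b (D (shrink ℓ v a)) - ev a (D (shrink ℓ v b)))) =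
      formBilin E (ω (x - (ℓ x * (1 - 1)) • v)) (a - (ℓ a * (1 - 1)) • v)
        (b - (ℓ b * (1 - 1)) • v) -
      formBilin E (ω (x - (ℓ x * (1 - 0)) • v)) (a - (ℓ a * (1 - 0)) • v)
        (b - (ℓ b * (1 - 0)) • v) := by
    refine totalIntegral_eq_sub (f := fun s => formBilin E (ω (x - (ℓ x * (1 - s)) • v))
      (a - (ℓ a * (1 - s)) • v) (b - (ℓ b * (1 - s)) • v)) fun s => ?_
    obtain ⟨hd, hcls, -⟩ := h1 s
    have hd' := hd
    rw [shrink_apply] at hd'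
    have e1 := hasDerivAt_formBilin_comp hd' (hasDerivAt_segment (ℓ x) v x s)
    have e2 := (e1.clm_apply (hasDerivAt_segment (ℓ a) v a s)).clm_apply
      (hasDerivAt_segment (ℓ b) v b s)
    refine e2.congr_deriv ?_
    have hcyc := extDeriv_eq_zero_cyclic hd hcls v (shrink ℓ v a s) (shrink ℓ v b s)
    simp only [ContinuousMap.add_apply, ContinuousMap.sub_apply, ContinuousMap.smul_apply, hev',
      h2, h3]
    have hdg : ∀ a' b', fderiv ℝ g (shrink ℓ v x s) a' b' =
        formBilin E (fderiv ℝ ω (shrink ℓ v x s) a') v b' := by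
      intro a' b'
      have hgd := (fderiv_formBilin hd).clm_apply (hasFDerivAt_const v (shrink ℓ v x s))
      have := congrArg (fun L => L a' b') hgd.fderiv
      simpa using this
    rw [hdg, hdg, hg]
    set y := shrink ℓ v x s with hy
    have ea : a = shrink ℓ v a s + (ℓ a * (1 - (s : ℝ))) • v := by rw [shrink_apply]; abel
    have eb : b = shrink ℓ v b s + (ℓ b * (1 - (s : ℝ))) • v := by rw [shrink_apply]; abel
    -- Once v occupies a slot, the v-component of the other argument does not matter.
    have r1 : ∀ A : E [⋀^Fin 2]→L[ℝ] ℝ, formBilin E A v a = formBilin E A v (shrink ℓ v a s) := by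
      intro A
      conv_lhs => rw [ea]
      rw [map_add, map_smul, formBilin_self, smul_zero, add_zero]
    have r2 : ∀ A : E [⋀^Fin 2]→L[ℝ] ℝ, formBilin E A v b = formBilin E A v (shrink ℓ v b s) := by
      intro A
      conv_lhs => rw [eb]
      rw [map_add, map_smul, formBilin_self, smul_zero, add_zero]
    simp only [r1, r2]
    rw [← shrink_apply, ← shrink_apply, ← shrink_apply, ← hy]
    simp only [add_apply, map_smul, smul_apply, smul_eq_mul]
    rw [formBilin_swap (ω y) (shrink ℓ v a s) v]
    linear_combination (ℓ x) * hcyc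
  have hzero : formBilin E (ω (x - (ℓ x * (1 - 0)) • v)) (a - (ℓ a * (1 - 0)) • v)
        (b - (ℓ b * (1 - 0)) • v) = 0 := by
    have := (h1 0).2.2
    rw [shrink_apply] at this
    exact this (by simp [hv]) _ _ (by simp [hv]) (by simp [hv])
  rw [hzero, sub_zero] at key
  simp only [map_add, map_sub, map_smul, smul_eq_mul] at key
  simpa using key.symm

end Poincare

/-! ### From infinitesimal invariance to invariance under the flow -/

section Moser

variable {E : Type} [NormedAddCommGroup E] [NormedSpace ℝ E] [CompleteSpace E] {c : Category}

/-- Moser's argument: a time-dependent bilinear form which is infinitesimally invariant under a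
time-dependent vector field vanishing at the origin is invariant under its flow. -/
theorem exists_diffeo_of_infinitesimal {Ω : ℝ × E → E →L[ℝ] E →L[ℝ] ℝ} {X : ℝ × E → E} {t₀ : ℝ}
    (hΩ : RegularAt c Ω (t₀, 0)) (hX : RegularAt c X (t₀, 0)) (hX0 : ∀ᶠ t in 𝓝 t₀, X (t, 0) = 0)
    (hinf : ∀ᶠ p in 𝓝 (t₀, (0 : E)), ∀ a b, fderiv ℝ Ω p (1, X p) a b +
      Ω p (fderiv ℝ X p (0, a)) b + Ω p a (fderiv ℝ X p (0, b)) = 0) :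
    ∀ᶠ τ in 𝓝 (0 : ℝ), ∃ Ψ : E → E, RegularAt c Ψ 0 ∧ Ψ 0 = 0 ∧
      (∃ e : E ≃L[ℝ] E, HasFDerivAt Ψ (e : E →L[ℝ] E) 0) ∧
      ∀ᶠ x in 𝓝 (0 : E), ∀ u v,
        Ω (t₀ + τ, Ψ x) (fderiv ℝ Ψ x u) (fderiv ℝ Ψ x v) = Ω (t₀, x) u v := by
  filter_upwards [exists_regular_flow hX hX0 (hinf.and hΩ.eventually_differentiableAt)]
    with τ ⟨Ψ, h1, h2, h3, h4⟩
  refine ⟨Ψ, h1, h2, h3, ?_⟩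
  filter_upwards [h4] with x ⟨y, hy0, hy1, hy, hj⟩ u v
  obtain ⟨ju, hju0, hju1, hju⟩ := hj u
  obtain ⟨jv, hjv0, hjv1, hjv⟩ := hj v
  -- The form is evaluated on two solutions of the variational equation; infinitesimal invariance
  -- says exactly that this is constant in s.
  set G : ℝ → ℝ := fun s => Ω (t₀ + τ * s, y s) (ju s) (jv s) with hG
  have hder : ∀ s ∈ Set.Icc (0 : ℝ) 1, HasDerivAt G 0 s := by
    intro s hs
    obtain ⟨⟨hi, hd⟩, hys⟩ := hy s hs
    have ht : HasDerivAt (fun s : ℝ => t₀ + τ * s) τ s := by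
      simpa using ((hasDerivAt_id s).const_mul τ).const_add t₀
    have hp : HasDerivAt (fun s => (t₀ + τ * s, y s)) (τ, τ • X (t₀ + τ * s, y s)) s :=
      ht.prodMk hys
    have e1 := hd.hasFDerivAt.comp_hasDerivAt s hp
    have e2 := (e1.clm_apply (hju s hs)).clm_apply (hjv s hs)
    refine e2.congr_deriv ?_
    have hsm : ((τ, τ • X (t₀ + τ * s, y s)) : ℝ × E) = τ • (1, X (t₀ + τ * s, y s)) := by simp
    simp only [hsm, map_smul, add_apply, smul_apply,
      smul_eq_mul, Function.comp_apply]
    linear_combination τ * hi (ju s) (jv s)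
  have hconst : G 1 = G 0 := by
    refine constant_of_has_deriv_right_zero (a := 0) (b := 1)
      (fun s hs => (hder s hs).continuousAt.continuousWithinAt)
      (fun s hs => (hder s ⟨hs.1, hs.2.le⟩).hasDerivWithinAt) 1 ⟨zero_le_one, le_rfl⟩
  simpa [hG, hy0, hy1, hju0, hju1, hjv0, hjv1] using hconst

end Moser

/-! ### First-order vanishing of the top power -/

section TopCoefficient

variable {n : ℕ} {c : Category}

/-- The coefficient of the top power of a 2-form with respect to the standard volume form. -/
noncomputable def topCoeff (a : Space n [⋀^Fin 2]→L[ℝ] ℝ) : ℝ :=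
  formPow a.toAlternatingMap n (stdBasis n)

theorem martinetFun_eq_topCoeff (ω : TwoForm n) : martinetFun ω = fun x => topCoeff (ω x) := rfl

theorem finrank_space (n : ℕ) : Module.finrank ℝ (Space n) = 2 * n := by simp

theorem contDiff_topCoeff {N : WithTop ℕ∞} :
    ContDiff ℝ N (topCoeff : (Space n [⋀^Fin 2]→L[ℝ] ℝ) → ℝ) := by
  rw [contDiff_iff_contDiffAt]
  exact fun a => contDiff_formPow
    (a := fun a : Space n [⋀^Fin 2]→L[ℝ] ℝ => a.toAlternatingMap)
    (fun v => (ContinuousAlternatingMap.apply ℝ (Space n) ℝ v).contDiff.contDiffAt) n _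

theorem differentiable_topCoeff :
    Differentiable ℝ (topCoeff : (Space n [⋀^Fin 2]→L[ℝ] ℝ) → ℝ) :=
  (contDiff_topCoeff (N := 1)).differentiable one_ne_zero

theorem RegularAt.topCoeff {X : Type*} [NormedAddCommGroup X] [NormedSpace ℝ X] {x : X}
    {ω : X → Space n [⋀^Fin 2]→L[ℝ] ℝ} (h : RegularAt c ω x) :
    RegularAt c (fun y => SingularSymplectic.topCoeff (ω y)) x :=
  (regularAt_of_contDiff contDiff_topCoeff).comp h

theorem fderiv_martinetFun {ω : TwoForm n} {x : Space n} (h : DifferentiableAt ℝ ω x) :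
    fderiv ℝ (martinetFun ω) x = (fderiv ℝ topCoeff (ω x)).comp (fderiv ℝ ω x) :=
  ((differentiable_topCoeff (ω x)).hasFDerivAt.comp x h.hasFDerivAt).fderiv

theorem mem_martinet_iff {ω : TwoForm n} {x : Space n} : x ∈ martinet ω ↔ martinetFun ω x = 0 := by
  constructor
  · intro h
    have h' : powAt ω n x = 0 := h
    rw [martinetFun, h']; rfl
  · intro h
    change powAt ω n x = 0
    rw [powAt_eq_martinetFun_smul, h, zero_smul]

theorem topCoeff_comp (a : Space n [⋀^Fin 2]→L[ℝ] ℝ) (L : Space n →L[ℝ] Space n) :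
    topCoeff (a.compContinuousLinearMap L) = LinearMap.det (L : Space n →ₗ[ℝ] Space n) *
      topCoeff a := by
  rw [topCoeff, topCoeff, ← top_form_comp]
  exact congrArg (fun τ => τ (stdBasis n)) (formPow_compLinearMap a.toAlternatingMap L.toLinearMap n)

theorem topCoeff_eq_zero_of_degenerate {a : Space n [⋀^Fin 2]→L[ℝ] ℝ}
    (h : ∃ k ≠ 0, k ∈ formKer a.toAlternatingMap) : topCoeff a = 0 := by
  rw [topCoeff, formPow_eq_zero_of_degenerate (finrank_space n) h]; rfl

theorem degenerate_of_topCoeff_eq_zero {a₀ a : Space n [⋀^Fin 2]→L[ℝ] ℝ} (h₀ : topCoeff a₀ ≠ 0)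
    (h : topCoeff a = 0) : ∃ k ≠ 0, k ∈ formKer a.toAlternatingMap := by
  obtain ⟨d, hd, hg⟩ := exists_det_gram_eq (stdBasis n) (stdBasis n) h₀
  rw [← det_gram_eq_zero_iff (stdBasis n), hg, ← topCoeff, h]
  simp

/-- Supplies the reference form that normalises `exists_det_gram_eq`, without computing the top
power of any explicit form. -/
theorem exists_topCoeff_ne_zero {ω : TwoForm n} {x : Space n}
    (h : fderiv ℝ (martinetFun ω) x ≠ 0) : ∃ a : Space n [⋀^Fin 2]→L[ℝ] ℝ, topCoeff a ≠ 0 := by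
  by_contra! h0
  apply h
  rw [martinetFun_eq_topCoeff]
  simp [h0]

/-- If the top power vanishes to first order only, then the corank is `2`. -/
theorem finrank_formKer_eq_two {A B : Space n [⋀^Fin 2]→L[ℝ] ℝ} (hA : topCoeff A = 0)
    (hB : fderiv ℝ topCoeff A B ≠ 0) : Module.finrank ℝ (formKer A.toAlternatingMap) = 2 := by
  set h : ℝ → ℝ := fun s => topCoeff (A + s • B) with hh
  have hd : HasDerivAt h (fderiv ℝ topCoeff A B) 0 := by
    have h1 : HasDerivAt (fun s : ℝ => A + s • B) B 0 := by
      simpa using ((hasDerivAt_id (0 : ℝ)).smul_const B).const_add A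
    have h2 : HasFDerivAt topCoeff (fderiv ℝ topCoeff A) (A + (0 : ℝ) • B) := by
      simpa using (differentiable_topCoeff A).hasFDerivAt
    exact h2.comp_hasDerivAt 0 h1
  obtain ⟨a₀, ha₀⟩ : ∃ a : Space n [⋀^Fin 2]→L[ℝ] ℝ, topCoeff a ≠ 0 := by
    by_contra! h0
    have : (topCoeff : (Space n [⋀^Fin 2]→L[ℝ] ℝ) → ℝ) = fun _ => 0 := funext h0
    rw [this] at hB
    simp at hB
  set K := formKer A.toAlternatingMap with hK
  obtain ⟨k₀, hk₀, hk₀K⟩ := degenerate_of_topCoeff_eq_zero ha₀ hA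
  have hpos : 0 < Module.finrank ℝ K :=
    Module.finrank_pos_iff_exists_ne_zero.2 ⟨⟨k₀, hk₀K⟩, fun h => hk₀ (congrArg Subtype.val h)⟩
  obtain ⟨r, L, hL, haL, hker, hr⟩ := exists_eq_stdForm_compLinearMap A.toAlternatingMap
  rw [finrank_space, ← hK] at hr
  by_contra hne
  have h3 : 3 ≤ Module.finrank ℝ K := by omega
  obtain ⟨K', hKK'⟩ := K.exists_isCompl
  let b' := ((Module.finBasis ℝ K).prod (Module.finBasis ℝ K')).map
    (Submodule.prodEquivOfIsCompl K K' hKK')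
  obtain ⟨d, hd0, hg⟩ := exists_det_gram_eq (stdBasis n) b' ha₀
  let v : ℝ → Fin (Module.finrank ℝ K) ⊕ Fin (Module.finrank ℝ K') → ℝ :=
    fun s => Sum.elim (fun _ => s) (fun _ => 1)
  let N : ℝ → Matrix (Fin (Module.finrank ℝ K) ⊕ Fin (Module.finrank ℝ K'))
      (Fin (Module.finrank ℝ K) ⊕ Fin (Module.finrank ℝ K')) ℝ := fun s =>
    Matrix.of fun i j => Sum.elim (fun _ => B ![b' i, b' j])
      (fun _ => (A + s • B) ![b' i, b' j]) j
  -- In a basis adapted to K ⊕ K', the columns of A + sB belonging to K are divisible by s. The left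
  -- side has order exactly 2 at s = 0, so K cannot have dimension 3 or more.
  have hfac : ∀ s, d * h s ^ 2 = s ^ Module.finrank ℝ K * (N s).det := by
    intro s
    rw [hh]
    change d * (formPow (A + s • B).toAlternatingMap n (stdBasis n)) ^ 2 = _
    rw [← hg]
    have hm : gram b' (A + s • B).toAlternatingMap = Matrix.of fun i j => v s j * N s i j := by
      ext i j
      rw [gram_apply, Matrix.of_apply]
      rcases j with j | j
      · have hj : b' (Sum.inl j) ∈ K := by simp [b']
        have := (mem_formKer_iff A.toAlternatingMap _).1 hj (b' i)
        rw [← (bilin_isAlt _).neg, neg_eq_zero] at this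
        change A ![b' i, b' (Sum.inl j)] + s * B ![b' i, b' (Sum.inl j)] = s * B ![b' i, b' (Sum.inl j)]
        have h0 : A ![b' i, b' (Sum.inl j)] = 0 := this
        rw [h0, zero_add]
      · exact (one_mul _).symm
    rw [hm, Matrix.det_mul_row]
    simp [v]
  have hNc : Continuous fun s => (N s).det := by
    refine Continuous.matrix_det (continuous_matrix fun i j => ?_)
    rcases j with j | j
    · exact continuous_const
    · change Continuous fun s : ℝ => A ![b' i, b' (Sum.inr j)] + s * B ![b' i, b' (Sum.inr j)]
      fun_prop
  have h0 : h 0 = 0 := by simpa [hh] using hA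
  have l1 : Tendsto (fun s => d * (s⁻¹ * h s) ^ 2) (𝓝[≠] 0)
      (𝓝 (d * (fderiv ℝ topCoeff A B) ^ 2)) := by
    have := hd.tendsto_slope_zero
    simp only [zero_add, h0, sub_zero, smul_eq_mul] at this
    exact (this.pow 2).const_mul d
  have l2 : Tendsto (fun s => s ^ (Module.finrank ℝ K - 2) * (N s).det) (𝓝[≠] 0) (𝓝 0) := by
    have hc : Continuous fun s : ℝ => s ^ (Module.finrank ℝ K - 2) * (N s).det :=
      (continuous_pow _).mul hNc
    have := (hc.tendsto 0).mono_left (nhdsWithin_le_nhds (s := {0}ᶜ))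
    rwa [zero_pow (by omega), zero_mul] at this
  have l3 := l2.congr' (f₂ := fun s => d * (s⁻¹ * h s) ^ 2) (by
    filter_upwards [self_mem_nhdsWithin] with s hs
    have hs' : s ≠ 0 := hs
    have e : s ^ Module.finrank ℝ K = s ^ (Module.finrank ℝ K - 2) * s ^ 2 := by
      rw [← pow_add]; congr 1; omega
    have := hfac s
    rw [e] at this
    field_simp
    linear_combination -this)
  have := tendsto_nhds_unique l1 l3
  simp [hd0, hB] at this

theorem finrank_formKer_of_structurallySmooth {ω : TwoForm n} (hd : DifferentiableAt ℝ ω 0)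
    (h : StructurallySmooth ω) : Module.finrank ℝ (formKer (ω 0).toAlternatingMap) = 2 := by
  obtain ⟨v, hv⟩ : ∃ v, fderiv ℝ (martinetFun ω) 0 v ≠ 0 := by
    by_contra! h0
    exact h.fderiv_ne_zero (ContinuousLinearMap.ext h0)
  rw [fderiv_martinetFun hd] at hv
  exact finrank_formKer_eq_two h.apply_zero hv

/-- Corank 2 is the case in which the power loses no information about the kernel; from here on the
invariant is the kernel of ω at 0 itself. -/
theorem kerAtZero_eq_formKer (hn : 1 ≤ n) {ω : TwoForm n} (hd : DifferentiableAt ℝ ω 0)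
    (h : StructurallySmooth ω) : kerAtZero ω = formKer (ω 0).toAlternatingMap := by
  obtain ⟨m, rfl⟩ : ∃ m, n = m + 1 := ⟨n - 1, by omega⟩
  obtain ⟨a, ha⟩ := exists_topCoeff_ne_zero h.fderiv_ne_zero
  refine formKer_formPow_eq (finrank_space _) (a₁ := a.toAlternatingMap) (fun h0 => ha ?_)
    (finrank_formKer_of_structurallySmooth hd h)
  rw [topCoeff, h0]; rfl

end TopCoefficient

/-! ### Diffeomorphism germs and pullbacks -/

section DiffeoGerms

variable {n : ℕ} {c : Category} {Φ Ψ : Space n → Space n} {ω ω₀ ω₁ ω₂ : TwoForm n}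

theorem IsDiffeoGerm.regularAt (h : IsDiffeoGerm c Φ) : RegularAt c Φ 0 := h.2.1

theorem IsDiffeoGerm.map_zero (h : IsDiffeoGerm c Φ) : Φ 0 = 0 := h.1

theorem IsDiffeoGerm.tendsto (h : IsDiffeoGerm c Φ) : Tendsto Φ (𝓝 0) (𝓝 0) := by
  have := h.regularAt.continuousAt.tendsto
  rwa [h.map_zero] at this

theorem IsDiffeoGerm.exists_inverse (h : IsDiffeoGerm c Φ) :
    ∃ Φ', IsDiffeoGerm c Φ' ∧ (∀ᶠ x in 𝓝 (0 : Space n), Φ' (Φ x) = x) ∧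
      ∀ᶠ x in 𝓝 (0 : Space n), Φ (Φ' x) = x := by
  obtain ⟨h0, hr, Φ', h0', hr', h1, h2⟩ := h
  exact ⟨Φ', ⟨h0', hr', Φ, h0, hr, h2, h1⟩, h1, h2⟩

theorem IsDiffeoGerm.comp (hΦ : IsDiffeoGerm c Φ) (hΨ : IsDiffeoGerm c Ψ) :
    IsDiffeoGerm c (fun x => Φ (Ψ x)) := by
  obtain ⟨Φ', hΦ', h1, h2⟩ := hΦ.exists_inverse
  obtain ⟨Ψ', hΨ', h3, h4⟩ := hΨ.exists_inverse
  have r1 : RegularAt c Φ (Ψ 0) := by rw [hΨ.map_zero]; exact hΦ.regularAt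
  have r2 : RegularAt c Ψ' (Φ' 0) := by rw [hΦ'.map_zero]; exact hΨ'.regularAt
  refine ⟨by simp only [hΨ.map_zero, hΦ.map_zero], r1.comp hΨ.regularAt, fun x => Ψ' (Φ' x),
    by simp only [hΨ'.map_zero, hΦ'.map_zero], r2.comp hΦ'.regularAt, ?_, ?_⟩
  · filter_upwards [hΨ.tendsto.eventually h1, h3] with x hx hx' using by rw [hx, hx']
  · filter_upwards [hΦ'.tendsto.eventually h4, h2] with x hx hx' using by rw [hx, hx']

theorem isDiffeoGerm_of_hasFDerivAt (h : RegularAt c Φ 0) (h0 : Φ 0 = 0)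
    {e : Space n ≃L[ℝ] Space n} (he : HasFDerivAt Φ (e : Space n →L[ℝ] Space n) 0) :
    IsDiffeoGerm c Φ := by
  obtain ⟨g, hg0, hgr, h1, h2⟩ := exists_regular_localInverse h e he
  rw [h0] at hg0 hgr h2
  exact ⟨h0, h, g, hg0, hgr, h1, h2⟩

theorem IsDiffeoGerm.eventually_differentiableAt (h : IsDiffeoGerm c Φ) :
    ∀ᶠ x in 𝓝 (0 : Space n), DifferentiableAt ℝ Φ x :=
  h.regularAt.eventually_differentiableAt

theorem IsDiffeoGerm.eventually_exists_leftInverse (h : IsDiffeoGerm c Φ) :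
    ∀ᶠ x in 𝓝 (0 : Space n), ∃ L : Space n →L[ℝ] Space n,
      L.comp (fderiv ℝ Φ x) = ContinuousLinearMap.id ℝ _ := by
  obtain ⟨Φ', hΦ', h1, h2⟩ := h.exists_inverse
  filter_upwards [h1.eventually_nhds, h.eventually_differentiableAt,
    h.tendsto.eventually hΦ'.eventually_differentiableAt] with x hx hd hd'
  refine ⟨fderiv ℝ Φ' (Φ x), ?_⟩
  have e1 := hd'.hasFDerivAt.comp x hd.hasFDerivAt
  have e2 : HasFDerivAt (Φ' ∘ Φ) (ContinuousLinearMap.id ℝ (Space n)) x :=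
    (hasFDerivAt_id x).congr_of_eventuallyEq hx
  exact e1.unique e2

theorem IsDiffeoGerm.eventually_det_ne_zero (h : IsDiffeoGerm c Φ) :
    ∀ᶠ x in 𝓝 (0 : Space n), LinearMap.det (fderiv ℝ Φ x : Space n →ₗ[ℝ] Space n) ≠ 0 := by
  filter_upwards [h.eventually_exists_leftInverse] with x ⟨L, hL⟩ h0
  have : LinearMap.det ((L : Space n →ₗ[ℝ] Space n) ∘ₗ (fderiv ℝ Φ x : Space n →ₗ[ℝ] Space n)) = 1 := by
    exact (congrArg (fun M : Space n →L[ℝ] Space n => LinearMap.det (M : Space n →ₗ[ℝ] Space n))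
      hL).trans LinearMap.det_id
  rw [LinearMap.det_comp, h0, mul_zero] at this
  exact zero_ne_one this

theorem formBilin_pullback (Φ : Space n → Space n) (ω : TwoForm n) (x u v : Space n) :
    formBilin _ (pullback Φ ω x) u v =
      formBilin _ (ω (Φ x)) (fderiv ℝ Φ x u) (fderiv ℝ Φ x v) :=
  formBilin_compContinuousLinearMap _ _ _ _

theorem pullback_congr (hΦ : IsDiffeoGerm c Φ) (h : ω₀ =ᶠ[𝓝 0] ω₁) :
    pullback Φ ω₀ =ᶠ[𝓝 0] pullback Φ ω₁ := by
  filter_upwards [hΦ.tendsto.eventually h] with x hx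
  rw [pullback, pullback, hx]

theorem pullback_comp (hΦ : IsDiffeoGerm c Φ) (hΨ : IsDiffeoGerm c Ψ) :
    pullback (fun x => Φ (Ψ x)) ω =ᶠ[𝓝 0] pullback Ψ (pullback Φ ω) := by
  filter_upwards [hΨ.eventually_differentiableAt,
    hΨ.tendsto.eventually hΦ.eventually_differentiableAt] with x h1 h2
  have e : fderiv ℝ (fun x => Φ (Ψ x)) x = (fderiv ℝ Φ (Ψ x)).comp (fderiv ℝ Ψ x) :=
    (h2.hasFDerivAt.comp x h1.hasFDerivAt).fderiv
  rw [pullback, e]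
  rfl

theorem pullback_eq_of_eq_id (h : ∀ᶠ x in 𝓝 (0 : Space n), Φ x = x) :
    pullback Φ ω =ᶠ[𝓝 0] ω := by
  filter_upwards [h.eventually_nhds] with x hx
  have e : fderiv ℝ Φ x = ContinuousLinearMap.id ℝ (Space n) :=
    ((hasFDerivAt_id x).congr_of_eventuallyEq hx).fderiv
  rw [pullback, e, hx.self_of_nhds]
  rfl

theorem Equivalent.trans (h₀ : Equivalent c ω₀ ω₁) (h₁ : Equivalent c ω₁ ω₂) :
    Equivalent c ω₀ ω₂ := by
  obtain ⟨Ψ, hΨ, h⟩ := h₀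
  obtain ⟨Φ, hΦ, h'⟩ := h₁
  exact ⟨_, hΦ.comp hΨ, (pullback_comp hΦ hΨ).trans ((pullback_congr hΨ h').trans h)⟩

theorem Equivalent.symm (h : Equivalent c ω₀ ω₁) : Equivalent c ω₁ ω₀ := by
  obtain ⟨Ψ, hΨ, h⟩ := h
  obtain ⟨Ψ', hΨ', h1, h2⟩ := hΨ.exists_inverse
  exact ⟨Ψ', hΨ', (pullback_congr hΨ' h.symm).trans
    ((pullback_comp hΨ hΨ').symm.trans (pullback_eq_of_eq_id h2))⟩

theorem equivalent_pullback (hΦ : IsDiffeoGerm c Φ) : Equivalent c (pullback Φ ω) ω :=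
  ⟨Φ, hΦ, EventuallyEq.rfl⟩

theorem regularAt_pullback (hω : RegularAt c ω 0) (hΦ : IsDiffeoGerm c Φ) :
    RegularAt c (pullback Φ ω) 0 :=
  RegularAt.form_pullback (by rw [hΦ.map_zero]; exact hω) hΦ.regularAt

theorem two_le_order (c : Category) : minSmoothness ℝ 2 ≤ c.order := by
  rw [minSmoothness_of_isRCLikeNormedField]
  cases c with
  | smooth =>
    change ((2 : ℕ∞) : WithTop ℕ∞) ≤ ((⊤ : ℕ∞) : WithTop ℕ∞)
    exact_mod_cast (le_top : (2 : ℕ∞) ≤ ⊤)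
  | analytic => exact le_top

theorem closed_pullback (hω : RegularAt c ω 0)
    (hcl : ∀ᶠ x in 𝓝 (0 : Space n), extDeriv ω x = 0) (hΦ : IsDiffeoGerm c Φ) :
    ∀ᶠ x in 𝓝 (0 : Space n), extDeriv (pullback Φ ω) x = 0 := by
  filter_upwards [hΦ.tendsto.eventually hω.eventually_differentiableAt,
    hΦ.tendsto.eventually hcl, hΦ.regularAt] with x h1 h2 h3
  refine (extDeriv_pullback h1 h3 (two_le_order c)).trans ?_
  rw [h2]; rfl

theorem martinetFun_pullback (Φ : Space n → Space n) (ω : TwoForm n) (x : Space n) :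
    martinetFun (pullback Φ ω) x =
      LinearMap.det (fderiv ℝ Φ x : Space n →ₗ[ℝ] Space n) * martinetFun ω (Φ x) :=
  topCoeff_comp _ _

theorem martinetFun_congr (h : ω₀ =ᶠ[𝓝 0] ω₁) : martinetFun ω₀ =ᶠ[𝓝 0] martinetFun ω₁ := by
  filter_upwards [h] with x hx
  exact congrArg topCoeff hx

theorem mem_martinet_pullback (hΦ : IsDiffeoGerm c Φ) :
    ∀ᶠ x in 𝓝 (0 : Space n), x ∈ martinet (pullback Φ ω) ↔ Φ x ∈ martinet ω := by
  filter_upwards [hΦ.eventually_det_ne_zero] with x hx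
  rw [mem_martinet_iff, mem_martinet_iff, martinetFun_pullback]
  simp [hx]

end DiffeoGerms

/-! ### Cancellation of the equation of a hyperplane -/

section Density

variable {E G : Type} [NormedAddCommGroup E] [NormedSpace ℝ E] [NormedAddCommGroup G]
  [NormedSpace ℝ G] {c : Category}

/-- Off the hyperplane one divides by ℓ; a point on it is approached along the transverse line in
direction v, and continuity concludes. -/
theorem eventually_eq_zero_of_smul_eq_zero {ℓ : E →L[ℝ] ℝ} {v y : E} (hv : ℓ v = 1) {R : E → G}
    (hR : RegularAt c R y) (h : ∀ᶠ x in 𝓝 y, ℓ x • R x = 0) : ∀ᶠ x in 𝓝 y, R x = 0 := by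
  filter_upwards [h.eventually_nhds, hR.eventually_differentiableAt] with x hx hd
  by_cases h0 : ℓ x = 0
  · have hline : Tendsto (fun s : ℝ => x + s • v) (𝓝[≠] 0) (𝓝 x) := by
      have : Continuous fun s : ℝ => x + s • v := by fun_prop
      simpa using (this.tendsto 0).mono_left (nhdsWithin_le_nhds (s := {0}ᶜ))
    have l1 := hd.continuousAt.tendsto.comp hline
    refine tendsto_nhds_unique (l1.congr' ?_) (tendsto_const_nhds (f := 𝓝[≠] (0 : ℝ)))
    filter_upwards [hline.eventually hx, self_mem_nhdsWithin] with s hs hs0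
    have hs0' : s ≠ 0 := hs0
    simpa [h0, hv, hs0'] using hs
  · simpa [h0] using hx.self_of_nhds

end Density

/-! ### Solving the Moser equation across the degeneracy locus -/

section VectorField

variable {n : ℕ} {c : Category} {X : Type} [NormedAddCommGroup X] [NormedSpace ℝ X]

/-- A 2-form whose top power vanishes to first order along a hyperplane can be solved for a vector
field with a right-hand side divisible by the equation of the hyperplane. -/
theorem exists_vectorField {Ω : X → Space n [⋀^Fin 2]→L[ℝ] ℝ} {p : X} {ℓ : X →L[ℝ] ℝ} {v : X}
    (hv : ℓ v = 1) (hp : ℓ p = 0) (hΩ : RegularAt c Ω p)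
    (hdeg : ∀ᶠ q in 𝓝 p, ℓ q = 0 → ∃ k ≠ 0, k ∈ formKer (Ω q).toAlternatingMap)
    (hder : fderiv ℝ (fun q => topCoeff (Ω q)) p v ≠ 0) {α : X → Space n →L[ℝ] ℝ}
    (hα : RegularAt c α p) :
    ∃ Y : X → Space n, RegularAt c Y p ∧ (∀ q, α q = 0 → Y q = 0) ∧
      ∀ᶠ q in 𝓝 p, ∀ b, formBilin _ (Ω q) (Y q) b = -(ℓ q * α q b) := by
  have hf : RegularAt c (fun q => topCoeff (Ω q)) p := hΩ.topCoeff
  obtain ⟨g, hg, hfg⟩ := exists_eq_smul_of_eq_zero_on_hyperplane hv hf hp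
    (hdeg.mono fun q hq h0 => topCoeff_eq_zero_of_degenerate (hq h0))
  have hg0 : g p ≠ 0 := by
    have e1 : HasFDerivAt (fun q => topCoeff (Ω q)) (ℓ p • fderiv ℝ g p + ℓ.smulRight (g p)) p :=
      (ℓ.hasFDerivAt.smul hg.differentiableAt.hasFDerivAt).congr_of_eventuallyEq hfg
    rw [e1.fderiv] at hder
    simpa [hp, hv] using hder
  obtain ⟨a₀, ha₀⟩ : ∃ a : Space n [⋀^Fin 2]→L[ℝ] ℝ, topCoeff a ≠ 0 := by
    by_contra! h0
    apply hder
    simp [h0]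
  let b := stdBasis n
  obtain ⟨d, hd0, hdet⟩ := exists_det_gram_eq b b ha₀
  let G : X → Matrix (Fin (2 * n)) (Fin (2 * n)) ℝ := fun q => gram b (Ω q).toAlternatingMap
  have hG : ∀ i j, RegularAt c (fun q => G q i j) p := by
    intro i j
    refine (hΩ.form_apply (m := fun _ => ![b i, b j]) fun _ => regularAt_const _).congr ?_
    exact Eventually.of_forall fun q => gram_apply _ _ _ _
  -- The corank is at least 2 on the hyperplane, so each cofactor vanishes there and is divisible by
  -- ℓ.
  have hP : ∀ i j, ∃ P : X → ℝ, RegularAt c P p ∧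
      ∀ᶠ q in 𝓝 p, (G q).adjugate i j = ℓ q • P q := fun i j =>
    exists_eq_smul_of_eq_zero_on_hyperplane hv (RegularAt.adjugate hG i j) hp
      (hdeg.mono fun q hq h0 => by
        rw [adjugate_gram_eq_zero (finrank_space n) b (hq h0)]; rfl)
  choose P hPr hPe using hP
  -- Since det G = d(ℓg)², the adjugate identity reads ℓPG = dℓ²g²·1, and one factor ℓ cancels.
  have hPG : ∀ j k, ∀ᶠ q in 𝓝 p,
      ∑ i, P j i q * G q i k - d * ℓ q * g q ^ 2 * (1 : Matrix _ _ ℝ) j k = 0 := by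
    intro j k
    refine eventually_eq_zero_of_smul_eq_zero hv (c := c) ?_ ?_
    · refine (RegularAt.sum fun i _ => (hPr j i).mul (hG i k)).sub ?_
      simp only [pow_two]
      exact ((((regularAt_const d).mul (ContinuousLinearMap.regularAt ℓ)).mul (hg.mul hg)).mul (regularAt_const _))
    · filter_upwards [hfg, Filter.eventually_all.2 (hPe j)] with q h1 h2
      have h3 := congrFun (congrFun (Matrix.adjugate_mul (G q)) j) k
      rw [Matrix.mul_apply, Matrix.smul_apply, hdet] at h3
      have h4 : formPow (Ω q).toAlternatingMap n b = ℓ q • g q := h1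
      simp only [h2, h4, smul_eq_mul] at h3
      rw [smul_eq_mul, mul_sub, Finset.mul_sum, sub_eq_zero]
      simp only [← mul_assoc]
      rw [h3]
      ring
  -- The remaining factor ℓ in PG = dℓg²·1 is the one on the right-hand side of the equation, so
  -- only the unit dg² has to be inverted.
  let x : X → Fin (2 * n) → ℝ := fun q i =>
    -((d * g q ^ 2)⁻¹ * ∑ j, α q (b j) * P j i q)
  refine ⟨fun q => ∑ i, x q i • b i, ?_, ?_, ?_⟩
  · refine RegularAt.sum fun i _ => RegularAt.smul ?_ (regularAt_const _)
    refine RegularAt.neg (RegularAt.mul (RegularAt.inv ?_ ?_) (RegularAt.sum fun j _ => ?_))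
    · simp only [pow_two]
      exact (regularAt_const d).mul (hg.mul hg)
    · exact mul_ne_zero hd0 (pow_ne_zero 2 hg0)
    · exact (hα.clm_apply (regularAt_const _)).mul (hPr j i)
  · intro q hq
    simp [x, hq]
  · filter_upwards [Filter.eventually_all.2 fun j => Filter.eventually_all.2 (hPG j),
      hg.continuousAt.eventually_ne hg0] with q h1 h2
    have hb : ∀ k, formBilin _ (Ω q) (∑ i, x q i • b i) (b k) = -(ℓ q * α q (b k)) := by
      intro k
      have e1 : formBilin _ (Ω q) (∑ i, x q i • b i) (b k) = ∑ i, x q i * G q i k := by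
        rw [map_sum, sum_apply]
        refine Finset.sum_congr rfl fun i _ => ?_
        rw [map_smul, smul_apply, smul_eq_mul]
        congr 1
        exact (gram_apply b _ i k).symm
      rw [e1]
      have e2 : ∑ i, x q i * G q i k =
          -((d * g q ^ 2)⁻¹ * ∑ j, α q (b j) * ∑ i, P j i q * G q i k) := by
        simp only [x, neg_mul, Finset.sum_neg_distrib, Finset.mul_sum, Finset.sum_mul]
        rw [Finset.sum_comm]
        refine congrArg _ (Finset.sum_congr rfl fun j _ => Finset.sum_congr rfl fun i _ => ?_)
        ring
      rw [e2]
      have e3 : ∀ j, ∑ i, P j i q * G q i k = d * ℓ q * g q ^ 2 * (1 : Matrix _ _ ℝ) j k :=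
        fun j => sub_eq_zero.1 (h1 j k)
      simp only [e3, Matrix.one_apply, mul_ite, mul_one, mul_zero, Finset.sum_ite_eq',
        Finset.mem_univ, if_true]
      field_simp
    intro u
    have : (formBilin _ (Ω q) (∑ i, x q i • b i)).toLinearMap = (-(ℓ q • α q)).toLinearMap :=
      b.ext fun k => hb k
    exact LinearMap.congr_fun this u

end VectorField

/-! ### Moser's argument along the segment -/

section Moser

variable {n : ℕ} {c : Category}

/-- The segment joining two germs of forms. -/
noncomputable def segment (ω₀ ω₁ : TwoForm n) (p : ℝ × Space n) : Space n [⋀^Fin 2]→L[ℝ] ℝ :=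
  ω₀ p.2 + p.1 • (ω₁ p.2 - ω₀ p.2)

theorem hasFDerivAt_segment {ω₀ ω₁ : TwoForm n} {p : ℝ × Space n}
    (h₀ : DifferentiableAt ℝ ω₀ p.2) (h₁ : DifferentiableAt ℝ ω₁ p.2) :
    ∃ D : ℝ × Space n →L[ℝ] (Space n [⋀^Fin 2]→L[ℝ] ℝ), HasFDerivAt (segment ω₀ ω₁) D p ∧
      ∀ s u, D (s, u) = s • (ω₁ p.2 - ω₀ p.2) +
        (fderiv ℝ ω₀ p.2 u + p.1 • (fderiv ℝ ω₁ p.2 u - fderiv ℝ ω₀ p.2 u)) := by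
  have e0 := h₀.hasFDerivAt.comp p (hasFDerivAt_snd (𝕜 := ℝ) (E := ℝ) (F := Space n))
  have e1 := h₁.hasFDerivAt.comp p (hasFDerivAt_snd (𝕜 := ℝ) (E := ℝ) (F := Space n))
  have e2 := e0.add ((hasFDerivAt_fst (𝕜 := ℝ) (E := ℝ) (F := Space n) (p := p)).smul (e1.sub e0))
  refine ⟨_, e2, fun s u => ?_⟩
  simp
  abel

theorem regularAt_segment {ω₀ ω₁ : TwoForm n} {p : ℝ × Space n}
    (h₀ : RegularAt c ω₀ p.2) (h₁ : RegularAt c ω₁ p.2) : RegularAt c (segment ω₀ ω₁) p := by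
  have hs : RegularAt c (fun q : ℝ × Space n => q.2) p :=
    ContinuousLinearMap.regularAt (ContinuousLinearMap.snd ℝ ℝ (Space n))
  have hf : RegularAt c (fun q : ℝ × Space n => q.1) p :=
    ContinuousLinearMap.regularAt (ContinuousLinearMap.fst ℝ ℝ (Space n))
  exact (h₀.comp hs).add (hf.smul ((h₁.comp hs).sub (h₀.comp hs)))

/-- The infinitesimal form of Moser's argument. -/
theorem segment_infinitesimal {ω₀ ω₁ : TwoForm n} {ℓ : Space n →L[ℝ] ℝ}
    {α : Space n → Space n →L[ℝ] ℝ} {Y : ℝ × Space n → Space n} {q : ℝ × Space n}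
    (h₀ : DifferentiableAt ℝ ω₀ q.2) (h₁ : DifferentiableAt ℝ ω₁ q.2)
    (hcl₀ : extDeriv ω₀ q.2 = 0) (hcl₁ : extDeriv ω₁ q.2 = 0)
    (hα : DifferentiableAt ℝ α q.2) (hY : DifferentiableAt ℝ Y q)
    (hprim : ∀ a b, formBilin _ (ω₁ q.2 - ω₀ q.2) a b = ℓ a * α q.2 b - ℓ b * α q.2 a +
      ℓ q.2 * (fderiv ℝ α q.2 a b - fderiv ℝ α q.2 b a))
    (hsolve : ∀ᶠ p in 𝓝 q, ∀ b, formBilin _ (segment ω₀ ω₁ p) (Y p) b = -(ℓ p.2 * α p.2 b))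
    (a b : Space n) :
    fderiv ℝ (fun p => formBilin _ (segment ω₀ ω₁ p)) q (1, Y q) a b +
      formBilin _ (segment ω₀ ω₁ q) (fderiv ℝ Y q (0, a)) b +
      formBilin _ (segment ω₀ ω₁ q) a (fderiv ℝ Y q (0, b)) = 0 := by
  obtain ⟨D, hD, hDa⟩ := hasFDerivAt_segment h₀ h₁
  have hB : HasFDerivAt (fun q => formBilin _ (segment ω₀ ω₁ q)) ((formBilin _).comp D) q :=
    HasFDerivAt.comp (g := fun a : Space n [⋀^Fin 2]→L[ℝ] ℝ => formBilin _ a) q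
      (ContinuousLinearMap.hasFDerivAt (F := Space n →L[ℝ] Space n →L[ℝ] ℝ) (formBilin _)) hD
  -- The equation Y ⌟ Ω = -ℓα is differentiated in the spatial direction u; its antisymmetrisation,
  -- closedness of Ω, and ω₁ - ω₀ = d(ℓα) together give the claim.
  have solve : ∀ u w : Space n, formBilin _ (D (0, u)) (Y q) w +
      formBilin _ (segment ω₀ ω₁ q) (fderiv ℝ Y q (0, u)) w =
      -(ℓ u * α q.2 w + ℓ q.2 * fderiv ℝ α q.2 u w) := by
    intro u w
    have s1 := (hB.clm_apply hY.hasFDerivAt).clm_apply (hasFDerivAt_const w q)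
    have s2 := hα.hasFDerivAt.comp q (hasFDerivAt_snd (𝕜 := ℝ) (E := ℝ) (F := Space n))
    have s0 := (ℓ.hasFDerivAt (x := q.2)).comp q
      (hasFDerivAt_snd (𝕜 := ℝ) (E := ℝ) (F := Space n))
    have s3 := (s0.mul (s2.clm_apply (hasFDerivAt_const w q))).neg
    have s4 := s3.congr_of_eventuallyEq (f₁ := fun q => formBilin _ (segment ω₀ ω₁ q) (Y q) w)
      (hsolve.mono fun q hq => hq w)
    have s5 := congrArg (fun M => M (0, u)) (s1.unique s4)
    simp at s5
    linear_combination s5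
  have cyc : formBilin _ (D (0, Y q)) a b - formBilin _ (D (0, a)) (Y q) b +
      formBilin _ (D (0, b)) (Y q) a = 0 := by
    have c0 := extDeriv_eq_zero_cyclic h₀ hcl₀ (Y q) a b
    have c1 := extDeriv_eq_zero_cyclic h₁ hcl₁ (Y q) a b
    simp only [hDa, zero_smul, zero_add, map_add, map_smul, map_sub, add_apply, sub_apply,
      smul_apply, smul_eq_mul]
    linear_combination (1 - q.1) * c0 + q.1 * c1
  have hsplit : D (1, Y q) = (ω₁ q.2 - ω₀ q.2) + D (0, Y q) := by
    rw [hDa, hDa, one_smul, zero_smul, zero_add]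
  rw [hB.fderiv, ContinuousLinearMap.comp_apply, hsplit, map_add, add_apply, add_apply, hprim,
    formBilin_swap (segment ω₀ ω₁ q) a]
  linear_combination cyc + solve a b - solve b a

/-- Two singular symplectic germs which agree at the origin, have the same hyperplane as Martinet
hypersurface with the same orientation and the same pullback to it are joined by a segment of
germs which is locally constant up to equivalence. -/
theorem eventually_equivalent_segment {ω₀ ω₁ : TwoForm n} {ℓ : Space n →L[ℝ] ℝ} {v : Space n}
    (hv : ℓ v = 1) (hr₀ : RegularAt c ω₀ 0) (hr₁ : RegularAt c ω₁ 0)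
    (hcl₀ : ∀ᶠ x in 𝓝 (0 : Space n), extDeriv ω₀ x = 0)
    (hcl₁ : ∀ᶠ x in 𝓝 (0 : Space n), extDeriv ω₁ x = 0)
    (hz₀ : ∀ᶠ x in 𝓝 (0 : Space n), ℓ x = 0 → martinetFun ω₀ x = 0)
    (hz₁ : ∀ᶠ x in 𝓝 (0 : Space n), ℓ x = 0 → martinetFun ω₁ x = 0)
    (heq : ω₀ 0 = ω₁ 0)
    (hres : ∀ᶠ x in 𝓝 (0 : Space n), ℓ x = 0 → ∀ u w, ℓ u = 0 → ℓ w = 0 →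
      formBilin _ (ω₀ x) u w = formBilin _ (ω₁ x) u w)
    (hpos : 0 < fderiv ℝ (martinetFun ω₀) 0 v * fderiv ℝ (martinetFun ω₁) 0 v)
    {t₀ : ℝ} (ht₀ : t₀ ∈ Set.Icc (0 : ℝ) 1) :
    ∀ᶠ t in 𝓝 t₀, Equivalent c (fun x => segment ω₀ ω₁ (t₀, x))
      (fun x => segment ω₀ ω₁ (t, x)) := by
  have hsnd : Tendsto (fun q : ℝ × Space n => q.2) (𝓝 (t₀, (0 : Space n))) (𝓝 0) :=
    (continuous_snd.tendsto (t₀, (0 : Space n)))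
  obtain ⟨a₀, ha₀⟩ : ∃ a : Space n [⋀^Fin 2]→L[ℝ] ℝ, topCoeff a ≠ 0 := by
    refine exists_topCoeff_ne_zero (ω := ω₀) (x := 0) fun h => ?_
    rw [h] at hpos
    simp at hpos
  have hβr : RegularAt c (fun x => ω₁ x - ω₀ x) 0 := hr₁.sub hr₀
  have hd₀ := hr₀.eventually_differentiableAt
  have hd₁ := hr₁.eventually_differentiableAt
  obtain ⟨α, hαr, hα0, hα⟩ := exists_primitive_of_closed hv hβr
    (by
      filter_upwards [hcl₀, hcl₁, hd₀, hd₁] with x h0 h1 h2 h3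
      have := extDeriv_fun_add (h3.fun_sub h2) h2
      simp only [sub_add_cancel] at this
      rwa [h0, h1, add_zero, eq_comm] at this)
    (by
      filter_upwards [hres] with x hx h0 u w hu hw
      rw [map_sub, sub_apply, sub_apply, hx h0 u w hu hw, sub_self])
  have hα0 : α 0 = 0 := hα0 (by rw [heq, sub_self])
  set Ω := segment ω₀ ω₁ with hΩ
  have hΩr : RegularAt c Ω (t₀, 0) := regularAt_segment hr₀ hr₁
  let L : ℝ × Space n →L[ℝ] ℝ := ℓ.comp (ContinuousLinearMap.snd ℝ ℝ (Space n))
  have hLapp : ∀ q, L q = ℓ q.2 := fun _ => rfl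
  obtain ⟨Y, hYr, hY0, hY⟩ := exists_vectorField (c := c) (Ω := Ω) (p := (t₀, (0 : Space n)))
    (ℓ := L) (v := (0, v)) hv (map_zero ℓ) hΩr
    (by
      filter_upwards [hsnd.eventually hz₀, hsnd.eventually hz₁, hsnd.eventually hres]
        with q h0 h1 h2 hq
      exact degenerate_segment (finrank_space n) (degenerate_of_topCoeff_eq_zero ha₀ (h0 hq))
        (degenerate_of_topCoeff_eq_zero ha₀ (h1 hq)) (ℓ := ℓ.toLinearMap) hv
        (fun x y hx hy => h2 hq x y hx hy) q.1)
    (by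
      -- As Ω(t, 0) does not depend on t, the transverse derivative of the top power at time t₀ is
      -- (1 - t₀)c₀ + t₀c₁, where c₀ and c₁ have the same sign.
      obtain ⟨D, hD, hDa⟩ := hasFDerivAt_segment (p := (t₀, (0 : Space n)))
        hr₀.differentiableAt hr₁.differentiableAt
      have hΩ0 : Ω (t₀, 0) = ω₀ 0 := by simp [hΩ, segment, heq]
      have e1 := ((differentiable_topCoeff (Ω (t₀, 0))).hasFDerivAt.comp _ hD).fderiv
      rw [fderiv_martinetFun hr₀.differentiableAt, fderiv_martinetFun hr₁.differentiableAt,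
        ← heq] at hpos
      change fderiv ℝ (topCoeff ∘ Ω) (t₀, 0) (0, v) ≠ 0
      rw [e1, hΩ0, ContinuousLinearMap.comp_apply, hDa]
      simp only [ContinuousLinearMap.comp_apply] at hpos
      simp only [zero_smul, zero_add, map_add, map_smul, map_sub, smul_eq_mul]
      set c₀ := fderiv ℝ topCoeff (ω₀ 0) (fderiv ℝ ω₀ 0 v)
      set c₁ := fderiv ℝ topCoeff (ω₀ 0) (fderiv ℝ ω₁ 0 v)
      intro h
      have hc₀ : c₀ ≠ 0 := by rintro h0; rw [h0, zero_mul] at hpos; exact lt_irrefl _ hpos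
      have h3 : (1 - t₀) * (c₀ * c₀) + t₀ * (c₀ * c₁) = 0 := by linear_combination c₀ * h
      have h4 : 0 < c₀ * c₀ := mul_self_pos.2 hc₀
      rcases ht₀.1.eq_or_lt with h5 | h5
      · rw [← h5] at h3; linarith
      · have := mul_pos h5 hpos
        have := mul_nonneg (sub_nonneg.2 ht₀.2) h4.le
        linarith)
    (α := fun q => α q.2)
    (hαr.comp (f := fun q : ℝ × Space n => q.2)
      (ContinuousLinearMap.regularAt (ContinuousLinearMap.snd ℝ ℝ (Space n))))
  have hΩb : RegularAt c (fun q => formBilin _ (Ω q)) (t₀, (0 : Space n)) := hΩr.formBilin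
  have key := exists_diffeo_of_infinitesimal (Ω := fun q => formBilin _ (Ω q)) (X := Y) hΩb hYr
    (Eventually.of_forall fun t => hY0 _ hα0)
    (by
      filter_upwards [hY.eventually_nhds, hYr.eventually_differentiableAt, hsnd.eventually hcl₀,
        hsnd.eventually hcl₁, hsnd.eventually hd₀, hsnd.eventually hd₁, hsnd.eventually hα,
        hsnd.eventually hαr.eventually_differentiableAt] with q e1 e2 e3 e4 e5 e6 e7 e8 a b
      exact segment_infinitesimal e5 e6 e3 e4 e8 e2 e7 e1 a b)
  have hshift : Tendsto (fun t => t - t₀) (𝓝 t₀) (𝓝 0) := by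
    have : Continuous fun t : ℝ => t - t₀ := by fun_prop
    simpa using this.tendsto t₀
  filter_upwards [hshift.eventually key] with t ht
  obtain ⟨Ψ, hΨr, hΨ0, ⟨e, he⟩, hΨ⟩ := ht
  refine ⟨Ψ, isDiffeoGerm_of_hasFDerivAt hΨr hΨ0 he, ?_⟩
  filter_upwards [hΨ] with x hx
  refine form_ext fun u w => ?_
  rw [formBilin_pullback]
  have := hx u w
  rwa [add_sub_cancel] at this

/-- The flow is only available for short times. Equivalence is symmetric, transitive and locally
constant along the segment, so connectedness of [0, 1] replaces a flow up to time one. -/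
theorem equivalent_of_eq_at_zero {ω₀ ω₁ : TwoForm n} {ℓ : Space n →L[ℝ] ℝ} {v : Space n}
    (hv : ℓ v = 1) (hr₀ : RegularAt c ω₀ 0) (hr₁ : RegularAt c ω₁ 0)
    (hcl₀ : ∀ᶠ x in 𝓝 (0 : Space n), extDeriv ω₀ x = 0)
    (hcl₁ : ∀ᶠ x in 𝓝 (0 : Space n), extDeriv ω₁ x = 0)
    (hz₀ : ∀ᶠ x in 𝓝 (0 : Space n), ℓ x = 0 → martinetFun ω₀ x = 0)
    (hz₁ : ∀ᶠ x in 𝓝 (0 : Space n), ℓ x = 0 → martinetFun ω₁ x = 0)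
    (heq : ω₀ 0 = ω₁ 0)
    (hres : ∀ᶠ x in 𝓝 (0 : Space n), ℓ x = 0 → ∀ u w, ℓ u = 0 → ℓ w = 0 →
      formBilin _ (ω₀ x) u w = formBilin _ (ω₁ x) u w)
    (hpos : 0 < fderiv ℝ (martinetFun ω₀) 0 v * fderiv ℝ (martinetFun ω₁) 0 v) :
    Equivalent c ω₀ ω₁ := by
  have key := isPreconnected_Icc.induction₂ (s := Set.Icc (0 : ℝ) 1)
    (fun t t' => Equivalent c (fun x => segment ω₀ ω₁ (t, x)) (fun x => segment ω₀ ω₁ (t', x)))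
    (fun t ht => nhdsWithin_le_nhds
      (eventually_equivalent_segment hv hr₀ hr₁ hcl₀ hcl₁ hz₀ hz₁ heq hres hpos ht))
    (fun _ _ _ _ _ _ h h' => h.trans h') (fun _ _ _ _ h => h.symm)
    (x := 0) (y := 1) (by simp) (by simp)
  simpa [segment] using key

end Moser

/-! ### Reduction to forms that agree at the origin -/

section Flat

variable {n : ℕ} {c : Category}

theorem isDiffeoGerm_linear {A : Space n →L[ℝ] Space n}
    (hA : LinearMap.det (A : Space n →ₗ[ℝ] Space n) ≠ 0) : IsDiffeoGerm c (fun x => A x) :=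
  isDiffeoGerm_of_hasFDerivAt (e := A.toContinuousLinearEquivOfDetNeZero hA)
    (ContinuousLinearMap.regularAt A) (map_zero A)
    (by rw [A.coe_toContinuousLinearEquivOfDetNeZero hA]; exact A.hasFDerivAt)

/-- The top coefficient of the pullback is det(dΦ) times the old one composed with Φ; since the
latter vanishes at 0, the derivative of the determinant drops out. -/
theorem fderiv_martinetFun_pullback {Φ : Space n → Space n} {ω : TwoForm n}
    (hΦ : IsDiffeoGerm c Φ) (hω : RegularAt c ω 0) (h : StructurallySmooth ω) :
    fderiv ℝ (martinetFun (pullback Φ ω)) 0 =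
      LinearMap.det (fderiv ℝ Φ 0 : Space n →ₗ[ℝ] Space n) •
        (fderiv ℝ (martinetFun ω) 0).comp (fderiv ℝ Φ 0) := by
  obtain ⟨a, ha⟩ := exists_topCoeff_ne_zero h.fderiv_ne_zero
  -- Writing the determinant through the pullback of a constant form yields its differentiability.
  have hdet : (fun x => LinearMap.det (fderiv ℝ Φ x : Space n →ₗ[ℝ] Space n)) =
      fun x => martinetFun (pullback Φ fun _ => a) x * (topCoeff a)⁻¹ := by
    funext x
    rw [martinetFun_pullback, martinetFun_eq_topCoeff]
    field_simp
  have hd : DifferentiableAt ℝ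
      (fun x => LinearMap.det (fderiv ℝ Φ x : Space n →ₗ[ℝ] Space n)) 0 := by
    rw [hdet]
    exact ((regularAt_pullback (regularAt_const a) hΦ).topCoeff.mul
      (regularAt_const _)).differentiableAt
  have hF : DifferentiableAt ℝ (martinetFun ω) (Φ 0) := by
    rw [hΦ.map_zero]; exact hω.topCoeff.differentiableAt
  have e1 := hd.hasFDerivAt.mul (hF.hasFDerivAt.comp 0 hΦ.regularAt.differentiableAt.hasFDerivAt)
  have e2 : HasFDerivAt (martinetFun (pullback Φ ω)) _ 0 :=
    e1.congr_of_eventuallyEq (Eventually.of_forall fun x => martinetFun_pullback Φ ω x)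
  rw [e2.fderiv]
  simp only [Function.comp_apply, hΦ.map_zero, h.apply_zero, zero_smul, add_zero]

theorem apply_eq_mul_of_ker {ℓ m : Space n →L[ℝ] ℝ} {v : Space n} (hv : ℓ v = 1)
    (h : ∀ u, ℓ u = 0 → m u = 0) (u : Space n) : m u = ℓ u * m v := by
  have := h (u - ℓ u • v) (by simp [hv])
  rw [map_sub, map_smul, smul_eq_mul, sub_eq_zero] at this
  exact this

theorem fderiv_apply_eq_zero_of_vanish {f : Space n → ℝ} {ℓ : Space n →L[ℝ] ℝ}
    (hf : DifferentiableAt ℝ f 0) (h : ∀ᶠ x in 𝓝 (0 : Space n), ℓ x = 0 → f x = 0)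
    (u : Space n) (hu : ℓ u = 0) : fderiv ℝ f 0 u = 0 := by
  have hc : HasDerivAt (fun s : ℝ => s • u) u 0 := by
    simpa using (hasDerivAt_id (0 : ℝ)).smul_const u
  have hf' : HasFDerivAt f (fderiv ℝ f 0) ((0 : ℝ) • u) := by
    rw [zero_smul]; exact hf.hasFDerivAt
  have e1 := hf'.comp_hasDerivAt 0 hc
  have ht : Tendsto (fun s : ℝ => s • u) (𝓝 0) (𝓝 0) := by
    have := hc.continuousAt.tendsto
    rwa [zero_smul] at this
  have e2 : HasDerivAt (f ∘ fun s : ℝ => s • u) 0 0 :=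
    (hasDerivAt_const (0 : ℝ) (0 : ℝ)).congr_of_eventuallyEq
      ((ht.eventually h).mono fun s hs => hs (by rw [map_smul, hu, smul_zero]))
  exact e1.unique e2

/-- Equivalence of germs whose Martinet hypersurface is a hyperplane. -/
theorem equivalent_of_flat {ω₀ ω₁ : TwoForm n} {ℓ : Space n →L[ℝ] ℝ} {v : Space n}
    (hv : ℓ v = 1) (hr₀ : RegularAt c ω₀ 0) (hr₁ : RegularAt c ω₁ 0)
    (hs₁ : StructurallySmooth ω₁)
    (hcl₀ : ∀ᶠ x in 𝓝 (0 : Space n), extDeriv ω₀ x = 0)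
    (hcl₁ : ∀ᶠ x in 𝓝 (0 : Space n), extDeriv ω₁ x = 0)
    (hz₀ : ∀ᶠ x in 𝓝 (0 : Space n), ℓ x = 0 → martinetFun ω₀ x = 0)
    (hz₁ : ∀ᶠ x in 𝓝 (0 : Space n), ℓ x = 0 → martinetFun ω₁ x = 0)
    (hker : formKer (ω₀ 0).toAlternatingMap = formKer (ω₁ 0).toAlternatingMap)
    (hres : ∀ᶠ x in 𝓝 (0 : Space n), ℓ x = 0 → ∀ u w, ℓ u = 0 → ℓ w = 0 →
      formBilin _ (ω₀ x) u w = formBilin _ (ω₁ x) u w)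
    (hpos : 0 < fderiv ℝ (martinetFun ω₀) 0 v * fderiv ℝ (martinetFun ω₁) 0 v) :
    Equivalent c ω₀ ω₁ := by
  have hres0 := hres.self_of_nhds (map_zero ℓ)
  obtain ⟨w, hw, hwv⟩ := exists_vector_of_same_kernel hker (ℓ := ℓ.toLinearMap) hv
    (fun x y hx hy => hres0 x y hx hy)
  have hw : ℓ w ≠ 0 := hw
  have hwv : ∀ u, ℓ u = 0 → formBilin _ (ω₁ 0) w u = formBilin _ (ω₀ 0) v u := hwv
  -- A fixes the hyperplane pointwise and sends v to w, so it changes neither the hypersurface nor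
  -- the restriction to it.
  let A : Space n →L[ℝ] Space n := ContinuousLinearMap.id ℝ _ + ℓ.smulRight (w - v)
  have hAapp : ∀ u, A u = u + ℓ u • (w - v) := fun _ => rfl
  have hA0 : ∀ u, ℓ u = 0 → A u = u := fun u hu => by rw [hAapp, hu, zero_smul, add_zero]
  have hℓA : ∀ u, ℓ (A u) = ℓ u * ℓ w := fun u => by
    rw [hAapp, map_add, map_smul, map_sub, hv, smul_eq_mul]; ring
  have hAv : A v = w := by rw [hAapp, hv, one_smul, add_sub_cancel]
  have hdet : LinearMap.det (A : Space n →ₗ[ℝ] Space n) = ℓ w := by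
    have : (A : Space n →ₗ[ℝ] Space n) = LinearMap.transvection ℓ.toLinearMap (w - v) := by
      ext1 u; rfl
    rw [this, LinearMap.transvection.det]
    change 1 + ℓ (w - v) = ℓ w
    rw [map_sub, hv]; ring
  have hA : IsDiffeoGerm c (fun x => A x) := isDiffeoGerm_linear (by rw [hdet]; exact hw)
  have hfA : ∀ x, fderiv ℝ (fun x => A x) x = A := fun x => A.fderiv
  have hAt : Tendsto (fun x => A x) (𝓝 0) (𝓝 0) := hA.tendsto
  refine Equivalent.trans (ω₁ := pullback (fun x => A x) ω₁) ?_ (equivalent_pullback hA)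
  refine equivalent_of_eq_at_zero hv hr₀ (regularAt_pullback hr₁ hA) hcl₀
    (closed_pullback hr₁ hcl₁ hA) hz₀ ?_ ?_ ?_ ?_
  · filter_upwards [hAt.eventually hz₁] with x hx h0
    rw [martinetFun_pullback, hx (by rw [hℓA, h0, zero_mul]), mul_zero]
  · refine form_ext fun u u' => ?_
    rw [formBilin_pullback, hfA, map_zero]
    have split : ∀ u, ℓ (u - ℓ u • v) = 0 := fun u => by simp [hv]
    have hAu : ∀ u, A u = (u - ℓ u • v) + ℓ u • w := fun u => by
      rw [hAapp, smul_sub]; abel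
    have e : ∀ u, u = (u - ℓ u • v) + ℓ u • v := fun u => by abel
    rw [hAu u, hAu u']
    conv_lhs => rw [e u, e u']
    simp only [map_add, add_apply, map_smul, smul_apply, smul_eq_mul, formBilin_self]
    rw [hres0 _ _ (split u) (split u'), hwv _ (split u'), formBilin_swap (ω₁ 0) _ w,
      hwv _ (split u), formBilin_swap (ω₀ 0) _ v]
  · filter_upwards [hres] with x hx h0 u u' hu hu'
    rw [formBilin_pullback, hfA, hA0 x h0, hA0 u hu, hA0 u' hu', hx h0 u u' hu hu']
  -- Both det A and the stretching of the transverse direction equal ℓ(w), so the differential is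
  -- multiplied by ℓ(w)² and its sign survives even when ℓ(w) < 0.
  · rw [fderiv_martinetFun_pullback hA hr₁ hs₁, hfA, hdet, smul_apply,
      ContinuousLinearMap.comp_apply, hAv, apply_eq_mul_of_ker hv
        (fderiv_apply_eq_zero_of_vanish (f := martinetFun ω₁) hr₁.topCoeff.differentiableAt hz₁) w, smul_eq_mul]
    have : 0 < ℓ w * ℓ w := mul_self_pos.2 hw
    have := mul_pos this hpos
    linarith

end Flat

/-! ### Straightening the Martinet hypersurface -/

section Straighten

variable {n : ℕ} {c : Category}

/-- A regular function germ with nonzero differential is linear in suitable coordinates, tangent to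
the given ones. -/
theorem exists_straightening {f : Space n → ℝ} (hf : RegularAt c f 0) (h0 : f 0 = 0)
    (hd : fderiv ℝ f 0 ≠ 0) : ∃ Φ, IsDiffeoGerm c Φ ∧
      fderiv ℝ Φ 0 = ContinuousLinearMap.id ℝ (Space n) ∧
      ∀ᶠ x in 𝓝 (0 : Space n), f (Φ x) = fderiv ℝ f 0 x := by
  set ℓ := fderiv ℝ f 0 with hℓ
  obtain ⟨u, hu⟩ : ∃ u, ℓ u ≠ 0 := by
    by_contra! h; exact hd (ContinuousLinearMap.ext h)
  let v := (ℓ u)⁻¹ • u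
  have hv : ℓ v = 1 := by simp [v, hu]
  -- Because ℓ(v) = 1, ℓ ∘ S = f, while S is tangent to the identity; the straightening is its
  -- inverse.
  let S : Space n → Space n := fun x => x + (f x - ℓ x) • v
  have hS : RegularAt c S 0 :=
    regularAt_id.add ((hf.sub (ContinuousLinearMap.regularAt ℓ)).smul (regularAt_const v))
  have hS0 : S 0 = 0 := by simp [S, h0]
  have hS' : HasFDerivAt S (ContinuousLinearMap.id ℝ (Space n)) 0 := by
    have e := (hasFDerivAt_id (𝕜 := ℝ) (0 : Space n)).add
      ((hf.differentiableAt.hasFDerivAt.sub ℓ.hasFDerivAt).smul_const v)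
    refine e.congr_fderiv ?_
    rw [← hℓ, sub_self]
    ext1 u
    simp
  have hSd : IsDiffeoGerm c S :=
    isDiffeoGerm_of_hasFDerivAt hS hS0 (e := ContinuousLinearEquiv.refl ℝ (Space n)) hS'
  obtain ⟨Φ, hΦ, h1, h2⟩ := hSd.exists_inverse
  refine ⟨Φ, hΦ, ?_, ?_⟩
  · have hS'' : HasFDerivAt S (ContinuousLinearMap.id ℝ (Space n)) (Φ 0) := by
      rw [hΦ.map_zero]; exact hS'
    have e1 := hS''.comp 0 hΦ.regularAt.differentiableAt.hasFDerivAt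
    have e2 : HasFDerivAt (S ∘ Φ) (ContinuousLinearMap.id ℝ (Space n)) 0 :=
      (hasFDerivAt_id _).congr_of_eventuallyEq h2
    exact e1.unique e2
  · filter_upwards [h2] with x hx
    have : ℓ (S (Φ x)) = f (Φ x) := by simp [S, hv]
    rw [← this, hx]

/-- Two germs with the same Martinet hypersurface, the same pullback to it, the same kernel at the
origin and positively proportional differentials are equivalent. -/
theorem equivalent_of_same_data {ω₀ ω₁ : TwoForm n}
    (hr₀ : RegularAt c ω₀ 0) (hr₁ : RegularAt c ω₁ 0)
    (hcl₀ : ∀ᶠ x in 𝓝 (0 : Space n), extDeriv ω₀ x = 0)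
    (hcl₁ : ∀ᶠ x in 𝓝 (0 : Space n), extDeriv ω₁ x = 0)
    (hs₀ : StructurallySmooth ω₀) (hs₁ : StructurallySmooth ω₁)
    (hz : ∀ᶠ x in 𝓝 (0 : Space n), x ∈ martinet ω₀ → x ∈ martinet ω₁)
    (hker : formKer (ω₀ 0).toAlternatingMap = formKer (ω₁ 0).toAlternatingMap)
    (hres : SamePullback ω₀ ω₁)
    (hpos : ∃ v, 0 < fderiv ℝ (martinetFun ω₀) 0 v * fderiv ℝ (martinetFun ω₁) 0 v) :
    Equivalent c ω₀ ω₁ := by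
  have hF₀ : RegularAt c (martinetFun ω₀) 0 := hr₀.topCoeff
  obtain ⟨Φ, hΦ, hΦ', hstr⟩ := exists_straightening hF₀ hs₀.apply_zero hs₀.fderiv_ne_zero
  set ℓ := fderiv ℝ (martinetFun ω₀) 0 with hℓ
  -- As Φ is tangent to the identity, straightening leaves kernels and differentials at the origin
  -- untouched.
  have hp0 : ∀ ω : TwoForm n, pullback Φ ω 0 = ω 0 := fun ω => by
    rw [pullback, hΦ', hΦ.map_zero]; rfl
  have hpd : ∀ ω : TwoForm n, RegularAt c ω 0 → StructurallySmooth ω →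
      fderiv ℝ (martinetFun (pullback Φ ω)) 0 = fderiv ℝ (martinetFun ω) 0 := fun ω h h' => by
    rw [fderiv_martinetFun_pullback hΦ h h', hΦ', ContinuousLinearMap.comp_id]
    have : LinearMap.det ((ContinuousLinearMap.id ℝ (Space n) : Space n →L[ℝ] Space n) :
      Space n →ₗ[ℝ] Space n) = 1 := LinearMap.det_id
    rw [this, one_smul]
  obtain ⟨u, hu⟩ := hpos
  have hu0 : ℓ u ≠ 0 := by
    rintro h; rw [h, zero_mul] at hu; exact lt_irrefl _ hu
  have key : Equivalent c (pullback Φ ω₀) (pullback Φ ω₁) := by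
    refine equivalent_of_flat (ℓ := ℓ) (v := (ℓ u)⁻¹ • u) (by simp [hu0])
      (regularAt_pullback hr₀ hΦ) (regularAt_pullback hr₁ hΦ) ⟨?_, ?_⟩
      (closed_pullback hr₀ hcl₀ hΦ) (closed_pullback hr₁ hcl₁ hΦ) ?_ ?_ ?_ ?_ ?_
    · rw [martinetFun_eq_topCoeff]
      change topCoeff (pullback Φ ω₁ 0) = 0
      rw [hp0]; exact hs₁.apply_zero
    · rw [hpd ω₁ hr₁ hs₁]; exact hs₁.fderiv_ne_zero
    · filter_upwards [hstr] with x hx h0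
      rw [martinetFun_pullback, hx, h0, mul_zero]
    · filter_upwards [hstr, hΦ.tendsto.eventually hz] with x hx h1 h0
      rw [martinetFun_pullback, mem_martinet_iff.1 (h1 (mem_martinet_iff.2 (hx.trans h0))),
        mul_zero]
    · rw [hp0, hp0, hker]
    · filter_upwards [hstr.eventually_nhds, hΦ.tendsto.eventually hres,
        hΦ.eventually_differentiableAt, hΦ.tendsto.eventually hF₀.eventually_differentiableAt]
        with x hx h1 h2 h3 h0 a b ha hb
      have ht : ∀ a, ℓ a = 0 → fderiv ℝ Φ x a ∈ tangent ω₀ (Φ x) := by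
        intro a ha
        have e1 := h3.hasFDerivAt.comp x h2.hasFDerivAt
        have e2 : HasFDerivAt (martinetFun ω₀ ∘ Φ) ℓ x := ℓ.hasFDerivAt.congr_of_eventuallyEq hx
        have e3 := congrArg (fun M => M a) (e1.unique e2)
        exact LinearMap.mem_ker.2 (e3.trans ha)
      rw [formBilin_pullback, formBilin_pullback]
      exact h1 (mem_martinet_iff.2 (hx.self_of_nhds.trans h0)) _ (ht a ha) _ (ht b hb)
    · rw [hpd ω₀ hr₀ hs₀, hpd ω₁ hr₁ hs₁, ← hℓ]
      simp only [map_smul, smul_eq_mul]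
      have h1 : 0 < (ℓ u)⁻¹ * (ℓ u)⁻¹ := mul_self_pos.2 (inv_ne_zero hu0)
      have := mul_pos h1 hu
      linarith
  exact (equivalent_pullback hΦ).symm.trans (key.trans (equivalent_pullback hΦ))

end Straighten

/-! ### Frames adapted to a hyperplane -/

section Frames

variable {n : ℕ}

/-- The frame consisting of `v` and `e`. -/
def frame (hn : 1 ≤ n) (v : Space n) (e : Fin (2 * n - 1) → Space n) (i : Fin (2 * n)) : Space n :=
  Sum.elim (fun _ : Fin 1 => v) e
    (finSumFinEquiv.symm ((finCongr (one_add_two_mul_sub_one hn)).symm i))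

theorem wedge_frame (hn : 1 ≤ n) (φ : Space n →ₗ[ℝ] ℝ) (Θ : Space n [⋀^Fin (2 * n - 1)]→ₗ[ℝ] ℝ)
    (v : Space n) (e : Fin (2 * n - 1) → Space n) (he : ∀ i, φ (e i) = 0) :
    (wedge (oneForm φ) Θ).domDomCongr (finCongr (one_add_two_mul_sub_one hn)) (frame hn v e) =
      φ v * Θ e := by
  rw [← wedge_oneForm_cons φ Θ v e he, AlternatingMap.domDomCongr_apply]
  exact congrArg _ (funext fun i => by simp [frame])

theorem exists_frame_det_ne_zero (hn : 1 ≤ n) {ℓ : Space n →L[ℝ] ℝ} {v : Space n} (hv : ℓ v ≠ 0) :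
    ∃ e : Fin (2 * n - 1) → Space n, (∀ i, ℓ (e i) = 0) ∧
      (stdBasis n).det (frame hn v e) ≠ 0 := by
  have hK : Module.finrank ℝ (LinearMap.ker ℓ.toLinearMap) = 2 * n - 1 := by
    have h1 := LinearMap.finrank_range_add_finrank_ker ℓ.toLinearMap
    have h2 : LinearMap.range ℓ.toLinearMap = ⊤ :=
      LinearMap.range_eq_top.2 (LinearMap.surjective (f := ℓ.toLinearMap)
        (fun h => hv (LinearMap.congr_fun h v)))
    rw [h2, finrank_top, Module.finrank_self, finrank_space] at h1
    omega
  let b := Module.finBasisOfFinrankEq ℝ (LinearMap.ker ℓ.toLinearMap) hK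
  let e : Fin (2 * n - 1) → Space n := fun i => b i
  have he : ∀ i, ℓ (e i) = 0 := fun i => (b i).2
  refine ⟨e, he, ?_⟩
  have hli : LinearIndependent ℝ e :=
    b.linearIndependent.map' (LinearMap.ker ℓ.toLinearMap).subtype (Submodule.ker_subtype _)
  have hv0 : v ≠ 0 := by rintro rfl; exact hv (map_zero ℓ)
  have hsum : LinearIndependent ℝ (Sum.elim (fun _ : Fin 1 => v) e) := by
    refine LinearIndependent.sum_type (linearIndependent_unique_iff.2 hv0) hli ?_
    rw [Submodule.disjoint_def]
    intro x hx hx'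
    have hx0 : ℓ x = 0 := by
      have : Submodule.span ℝ (Set.range e) ≤ LinearMap.ker ℓ.toLinearMap := by
        rw [Submodule.span_le]
        rintro _ ⟨i, rfl⟩
        exact he i
      exact this hx'
    have hr : Set.range (fun _ : Fin 1 => v) = {v} := Set.range_const
    rw [hr, Submodule.mem_span_singleton] at hx
    obtain ⟨a, rfl⟩ := hx
    rw [map_smul, smul_eq_mul] at hx0
    rw [(mul_eq_zero.1 hx0).resolve_right hv, zero_smul]
  have hfr : LinearIndependent ℝ (frame hn v e) :=
    hsum.comp (fun i => finSumFinEquiv.symm ((finCongr (one_add_two_mul_sub_one hn)).symm i))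
      (finSumFinEquiv.symm.injective.comp (finCongr _).symm.injective)
  have hunit := (Module.Basis.is_basis_iff_det (stdBasis n)).1
    ⟨hfr, hfr.span_eq_top_of_card_eq_finrank' (by simp)⟩
  exact hunit.ne_zero

theorem two_mul_eq_sub_one_add_one {n : ℕ} (hn : 1 ≤ n) : 2 * n = (2 * n - 1) + 1 := by omega

/-- The standard volume form. -/
noncomputable def volForm (hn : 1 ≤ n) : Space n [⋀^Fin (2 * n - 1 + 1)]→L[ℝ] ℝ :=
  { (stdBasis n).det.domDomCongr (finCongr (two_mul_eq_sub_one_add_one hn)) with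
    cont := by
      change Continuous fun e : Fin (2 * n - 1 + 1) → Space n =>
        (stdBasis n).det fun i => e (finCongr (two_mul_eq_sub_one_add_one hn) i)
      simp only [Module.Basis.det_apply]
      refine Continuous.matrix_det (continuous_matrix fun i j => ?_)
      change Continuous fun e : Fin (2 * n - 1 + 1) → Space n =>
        (e (finCongr (two_mul_eq_sub_one_add_one hn) j)) i
      fun_prop }

/-- The contraction of the standard volume form with a vector. -/
noncomputable def volInterior (hn : 1 ≤ n) (v : Space n) : Space n [⋀^Fin (2 * n - 1)]→L[ℝ] ℝ :=
  (volForm hn).curryLeft v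

theorem volInterior_apply (hn : 1 ≤ n) (v : Space n) (e : Fin (2 * n - 1) → Space n) :
    volInterior hn v e = (stdBasis n).det (frame hn v e) := by
  change (stdBasis n).det _ = _
  refine congrArg _ (funext fun i => ?_)
  change Fin.cons (α := fun _ => Space n) v e (finCongr (two_mul_eq_sub_one_add_one hn) i) = _
  obtain ⟨j, rfl⟩ := (finCongr (one_add_two_mul_sub_one hn)).surjective i
  simp only [frame, Equiv.symm_apply_apply]
  induction j using Fin.addCases with
  | left j =>
    rw [finSumFinEquiv_symm_apply_castAdd, Subsingleton.elim j 0]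
    rfl
  | right j =>
    rw [finSumFinEquiv_symm_apply_natAdd]
    have : finCongr (two_mul_eq_sub_one_add_one hn)
      (finCongr (one_add_two_mul_sub_one hn) (Fin.natAdd 1 j)) = Fin.succ j := by
      ext; simp
    rw [this]
    rfl

end Frames

/-! ### Canonical volume forms on the Martinet hypersurface -/

section CanonicalVolume

variable {n : ℕ} {c : Category} {hn : 1 ≤ n}

theorem IsDiffeoGerm.bijective_fderiv {Φ : Space n → Space n} (hΦ : IsDiffeoGerm c Φ) :
    Function.Bijective (fderiv ℝ Φ 0) := by
  obtain ⟨L, hL⟩ := hΦ.eventually_exists_leftInverse.self_of_nhds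
  have hinj : Function.Injective (fderiv ℝ Φ 0) := fun u w h => by
    have e : ∀ u, L (fderiv ℝ Φ 0 u) = u := fun u => congrArg (fun M => M u) hL
    rw [← e u, h, e]
  exact ⟨hinj, (LinearMap.injective_iff_surjective (f := (fderiv ℝ Φ 0).toLinearMap)).1 hinj⟩

theorem topform_eq_of_frame {τ : Space n [⋀^Fin (2 * n)]→ₗ[ℝ] ℝ} {w : Fin (2 * n) → Space n}
    : τ w = τ (stdBasis n) * (stdBasis n).det w := by
  conv_lhs => rw [AlternatingMap.eq_smul_basis_det (stdBasis n) τ]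
  rfl

/-- Contracting the standard volume with a transverse v and dividing by df(v) gives Θ with df ∧ Θ
equal to the volume. Top forms span a line, so this is checked on one adapted frame. -/
theorem exists_canonicalVolume (hn : 1 ≤ n) {ω : TwoForm n} (hω : RegularAt c ω 0)
    (hs : StructurallySmooth ω) : ∃ f Θ, IsCanonicalVolume c hn ω f Θ := by
  obtain ⟨v, hv⟩ : ∃ v, fderiv ℝ (martinetFun ω) 0 v ≠ 0 := by
    by_contra! h0
    exact hs.fderiv_ne_zero (ContinuousLinearMap.ext h0)
  have hF : RegularAt c (martinetFun ω) 0 := hω.topCoeff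
  have hFv : RegularAt c (fun x => fderiv ℝ (martinetFun ω) x v) 0 :=
    hF.fderiv.clm_apply (regularAt_const v)
  refine ⟨martinetFun ω, fun x => (fderiv ℝ (martinetFun ω) x v)⁻¹ • volInterior hn v, hF,
    Eventually.of_forall fun x => mem_martinet_iff.symm, hs.fderiv_ne_zero,
    (hFv.inv hv).smul (regularAt_const _), ?_⟩
  filter_upwards [hFv.continuousAt.eventually_ne hv] with x hx
  rw [powAt_eq_martinetFun_smul]
  congr 1
  obtain ⟨e, he, hdet⟩ := exists_frame_det_ne_zero hn hx
  set τ := (wedge (oneForm (fderiv ℝ (martinetFun ω) x).toLinearMap)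
    ((fderiv ℝ (martinetFun ω) x v)⁻¹ • volInterior hn v).toAlternatingMap).domDomCongr
      (finCongr (one_add_two_mul_sub_one hn)) with hτ
  have h1 : τ (frame hn v e) = (stdBasis n).det (frame hn v e) := by
    rw [hτ, wedge_frame hn _ _ v e he]
    change fderiv ℝ (martinetFun ω) x v * ((fderiv ℝ (martinetFun ω) x v)⁻¹ *
      volInterior hn v e) = _
    rw [mul_inv_cancel_left₀ hx, volInterior_apply]
  rw [topform_eq_of_frame] at h1
  have h2 : τ (stdBasis n) = 1 := mul_right_cancel₀ hdet (h1.trans (one_mul _).symm)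
  rw [AlternatingMap.eq_smul_basis_det (stdBasis n) τ, h2, one_smul]

theorem IsCanonicalVolume.congr {ω₀ ω₁ : TwoForm n} {f : Space n → ℝ}
    {Θ : Space n → Space n [⋀^Fin (2 * n - 1)]→L[ℝ] ℝ} (h : IsCanonicalVolume c hn ω₁ f Θ)
    (hω : ω₁ =ᶠ[𝓝 0] ω₀) : IsCanonicalVolume c hn ω₀ f Θ := by
  refine ⟨h.regular_fun, ?_, h.fderiv_ne_zero, h.regular_form, ?_⟩
  · filter_upwards [h.zero_iff, hω] with x hx hx'
    rw [hx, mem_martinet_iff, mem_martinet_iff, martinetFun_eq_topCoeff, martinetFun_eq_topCoeff]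
    simp only [hx']
  · filter_upwards [h.eq_pow, hω] with x hx hx'
    rw [hx, powAt, powAt, hx']

theorem IsCanonicalVolume.pullback {ω : TwoForm n} {f : Space n → ℝ}
    {Θ : Space n → Space n [⋀^Fin (2 * n - 1)]→L[ℝ] ℝ} (h : IsCanonicalVolume c hn ω f Θ)
    {Φ : Space n → Space n} (hΦ : IsDiffeoGerm c Φ) :
    IsCanonicalVolume c hn (SingularSymplectic.pullback Φ ω) (fun x => f (Φ x))
      (fun x => (Θ (Φ x)).compContinuousLinearMap (fderiv ℝ Φ x)) := by
  have hf : RegularAt c f (Φ 0) := by rw [hΦ.map_zero]; exact h.regular_fun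
  have hΘ : RegularAt c Θ (Φ 0) := by rw [hΦ.map_zero]; exact h.regular_form
  refine ⟨hf.comp hΦ.regularAt, ?_, ?_, RegularAt.form_pullback hΘ hΦ.regularAt, ?_⟩
  · filter_upwards [hΦ.tendsto.eventually h.zero_iff, mem_martinet_pullback (ω := ω) hΦ]
      with x h1 h2
    rw [h1, h2]
  · intro h0
    apply h.fderiv_ne_zero
    have e1 : fderiv ℝ (fun x => f (Φ x)) 0 = (fderiv ℝ f 0).comp (fderiv ℝ Φ 0) := by
      have := (hf.differentiableAt.hasFDerivAt.comp 0
        hΦ.regularAt.differentiableAt.hasFDerivAt).fderiv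
      rwa [hΦ.map_zero] at this
    rw [e1] at h0
    ext u
    obtain ⟨w, rfl⟩ := hΦ.bijective_fderiv.2 u
    exact congrArg (fun M => M w) h0
  · filter_upwards [hΦ.tendsto.eventually h.eq_pow, hΦ.eventually_differentiableAt,
      hΦ.tendsto.eventually (RegularAt.eventually_differentiableAt (x := (0 : Space n))
        h.regular_fun)] with x h1 h2 h3
    have e1 : fderiv ℝ (fun x => f (Φ x)) x = (fderiv ℝ f (Φ x)).comp (fderiv ℝ Φ x) :=
      (h3.hasFDerivAt.comp x h2.hasFDerivAt).fderiv
    have e2 : powAt (SingularSymplectic.pullback Φ ω) n x =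
        (powAt ω n (Φ x)).compLinearMap (fderiv ℝ Φ x).toLinearMap :=
      formPow_compLinearMap (ω (Φ x)).toAlternatingMap _ n
    rw [e2, ← h1, e1]
    have e3 := wedge_compLinearMap (oneForm (fderiv ℝ f (Φ x)).toLinearMap)
      (Θ (Φ x)).toAlternatingMap (fderiv ℝ Φ x).toLinearMap
    ext w
    have e4 := congrArg (fun τ => τ (fun i => w (finCongr (one_add_two_mul_sub_one hn) i))) e3
    exact congrArg (fun r => f (Φ x) * r) e4

/-- The canonical volume of a frame is a positive multiple of the oriented volume. -/
theorem IsCanonicalVolume.exists_mul_eq {ω : TwoForm n} {f : Space n → ℝ}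
    {Θ : Space n → Space n [⋀^Fin (2 * n - 1)]→L[ℝ] ℝ} (h : IsCanonicalVolume c hn ω f Θ)
    (hs : StructurallySmooth ω) : ∃ m ≠ 0, ∀ v e, (∀ i, e i ∈ tangent ω 0) →
      fderiv ℝ (martinetFun ω) 0 v * Θ 0 e = m ^ 2 * (stdBasis n).det (frame hn v e) := by
  -- Here df ∧ Θ is μ times the standard volume, so the standard coefficient F of the top power is
  -- fμ. One factor μ(0) comes from dF = μ df at 0, the other from df ∧ Θ, whence a square.
  set μ : Space n → ℝ := fun x => (wedge (oneForm (fderiv ℝ f x).toLinearMap)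
    (Θ x).toAlternatingMap).domDomCongr (finCongr (one_add_two_mul_sub_one hn)) (stdBasis n) with hμ
  have hf : RegularAt c f 0 := h.regular_fun
  have hμd : DifferentiableAt ℝ μ 0 := by
    refine ContDiffAt.differentiableAt (n := c.order) ?_ (order_ne_zero c)
    refine contDiff_wedge (α := fun x => oneForm (fderiv ℝ f x).toLinearMap)
      (β := fun x => (Θ x).toAlternatingMap) (fun w => ?_) (fun w => ?_) _
    · exact (hf.fderiv.clm_apply (regularAt_const (w 0))).contDiffAt
    · exact (ContinuousLinearMap.contDiff (ContinuousAlternatingMap.apply ℝ (Space n) ℝ w)).contDiffAt.comp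
        (0 : Space n) (RegularAt.contDiffAt (x := (0 : Space n)) h.regular_form)
  have hF : martinetFun ω =ᶠ[𝓝 0] fun x => f x * μ x := by
    filter_upwards [h.eq_pow] with x hx
    rw [martinetFun, ← hx]
    rfl
  have hf0 : f 0 = 0 := h.zero_iff.self_of_nhds.2 (mem_martinet_iff.2 hs.apply_zero)
  have hd : fderiv ℝ (martinetFun ω) 0 = μ 0 • fderiv ℝ f 0 := by
    have := (hf.differentiableAt.hasFDerivAt.mul hμd.hasFDerivAt).congr_of_eventuallyEq hF
    rw [this.fderiv, hf0, zero_smul, zero_add]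
  have hμ0 : μ 0 ≠ 0 := by
    intro h0
    apply hs.fderiv_ne_zero
    rw [hd, h0, zero_smul]
  refine ⟨μ 0, hμ0, fun v e he => ?_⟩
  have he' : ∀ i, fderiv ℝ f 0 (e i) = 0 := by
    intro i
    have : fderiv ℝ (martinetFun ω) 0 (e i) = 0 := he i
    rw [hd, smul_apply, smul_eq_mul] at this
    exact (mul_eq_zero.1 this).resolve_left hμ0
  have h1 := wedge_frame hn (fderiv ℝ f 0).toLinearMap (Θ 0).toAlternatingMap v e he'
  rw [topform_eq_of_frame] at h1
  have h2 : μ 0 * (stdBasis n).det (frame hn v e) = fderiv ℝ f 0 v * Θ 0 e := h1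
  rw [hd, smul_apply, smul_eq_mul, mul_assoc, ← h2]
  ring

end CanonicalVolume

/-! ### Invariance and completeness of the data -/

section Invariants

variable {n : ℕ} {c : Category} {hn : 1 ≤ n}

/-- In straightened coordinates the second function vanishes along a hyperplane, hence so does its
differential at 0. -/
theorem ker_fderiv_le_of_martinet_subset {ω₀ ω₁ : TwoForm n} (hr₀ : RegularAt c ω₀ 0)
    (hr₁ : RegularAt c ω₁ 0) (hs₀ : StructurallySmooth ω₀)
    (hz : ∀ᶠ x in 𝓝 (0 : Space n), x ∈ martinet ω₀ → x ∈ martinet ω₁) (u : Space n)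
    (hu : fderiv ℝ (martinetFun ω₀) 0 u = 0) : fderiv ℝ (martinetFun ω₁) 0 u = 0 := by
  have hF₀ : RegularAt c (martinetFun ω₀) 0 := hr₀.topCoeff
  obtain ⟨Φ, hΦ, hΦ', hstr⟩ := exists_straightening hF₀ hs₀.apply_zero hs₀.fderiv_ne_zero
  have hF₁ : DifferentiableAt ℝ (martinetFun ω₁) (Φ 0) := by
    rw [hΦ.map_zero]; exact hr₁.topCoeff.differentiableAt
  have e1 := hF₁.hasFDerivAt.comp 0 hΦ.regularAt.differentiableAt.hasFDerivAt
  have e2 := fderiv_apply_eq_zero_of_vanish e1.differentiableAt (by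
    filter_upwards [hstr, hΦ.tendsto.eventually hz] with x h1 h2 h0
    exact mem_martinet_iff.1 (h2 (mem_martinet_iff.2 (h1.trans h0)))) u hu
  rw [e1.fderiv, hΦ', hΦ.map_zero] at e2
  exact e2

/-- If the canonical orientations agree, then the differentials of the functions defining the
Martinet hypersurface are positively proportional. -/
theorem exists_pos_of_orientation {ω₀ ω₁ : TwoForm n} {f₀ f₁ : Space n → ℝ}
    {Θ₀ Θ₁ : Space n → Space n [⋀^Fin (2 * n - 1)]→L[ℝ] ℝ} (hr₀ : RegularAt c ω₀ 0)
    (hr₁ : RegularAt c ω₁ 0) (hs₀ : StructurallySmooth ω₀) (hs₁ : StructurallySmooth ω₁)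
    (hz : ∀ᶠ x in 𝓝 (0 : Space n), x ∈ martinet ω₀ → x ∈ martinet ω₁)
    (h₀ : IsCanonicalVolume c hn ω₀ f₀ Θ₀) (h₁ : IsCanonicalVolume c hn ω₁ f₁ Θ₁)
    (h : ∀ e : Fin (2 * n - 1) → Space n, (∀ i, e i ∈ tangent ω₀ 0) →
      (0 < Θ₀ 0 e ↔ 0 < Θ₁ 0 e)) :
    ∃ v, 0 < fderiv ℝ (martinetFun ω₀) 0 v * fderiv ℝ (martinetFun ω₁) 0 v := by
  obtain ⟨v, hv⟩ : ∃ v, fderiv ℝ (martinetFun ω₀) 0 v ≠ 0 := by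
    by_contra! h0
    exact hs₀.fderiv_ne_zero (ContinuousLinearMap.ext h0)
  obtain ⟨e, he, hdet⟩ := exists_frame_det_ne_zero hn hv
  obtain ⟨m₀, hm₀, e₀⟩ := h₀.exists_mul_eq hs₀
  obtain ⟨m₁, hm₁, e₁⟩ := h₁.exists_mul_eq hs₁
  have e₀ := e₀ v e he
  have e₁ := e₁ v e fun i => ker_fderiv_le_of_martinet_subset hr₀ hr₁ hs₀ hz _ (he i)
  refine ⟨v, ?_⟩
  -- Multiplying the two identities gives a nonzero square, so the product of the differentials has
  -- the sign of Θ₀(e)Θ₁(e).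
  have hprod : 0 < (fderiv ℝ (martinetFun ω₀) 0 v * fderiv ℝ (martinetFun ω₁) 0 v) *
      (Θ₀ 0 e * Θ₁ 0 e) := by
    have : (fderiv ℝ (martinetFun ω₀) 0 v * fderiv ℝ (martinetFun ω₁) 0 v) *
        (Θ₀ 0 e * Θ₁ 0 e) = (m₀ * m₁ * (stdBasis n).det (frame hn v e)) ^ 2 := by
      linear_combination (fderiv ℝ (martinetFun ω₁) 0 v * Θ₁ 0 e) * e₀ +
        (m₀ ^ 2 * (stdBasis n).det (frame hn v e)) * e₁
    rw [this]
    positivity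
  have hΘ : 0 ≤ Θ₀ 0 e * Θ₁ 0 e := by
    by_cases h0 : 0 < Θ₀ 0 e
    · exact (mul_pos h0 ((h e he).1 h0)).le
    · exact mul_nonneg_of_nonpos_of_nonpos (not_lt.1 h0) (not_lt.1 (mt (h e he).2 h0))
  by_contra hneg
  exact absurd hprod (not_lt.2 (mul_nonpos_of_nonpos_of_nonneg (not_lt.1 hneg) hΘ))

theorem formKer_compLinearMap {V U : Type*} [AddCommGroup V] [Module ℝ V] [AddCommGroup U]
    [Module ℝ U] {k : ℕ} (a : V [⋀^Fin k]→ₗ[ℝ] ℝ) {L : U →ₗ[ℝ] V}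
    (hL : Function.Surjective L) : formKer (a.compLinearMap L) = (formKer a).comap L := by
  have key : ∀ (i : Fin k) (w : Fin k → U) (v : U),
      a.compLinearMap L (Function.update w i v) = a (Function.update (L ∘ w) i (L v)) := by
    intro i w v
    rw [← Function.comp_update]
    rfl
  ext v
  constructor
  · intro hv i w
    obtain ⟨w', rfl⟩ : ∃ w' : Fin k → U, L ∘ w' = w :=
      ⟨fun j => (hL (w j)).choose, funext fun j => (hL (w j)).choose_spec⟩
    rw [← key]
    exact hv i w'
  · intro hv i w
    rw [key]
    exact hv i _

theorem kerAtZero_pullback {Φ : Space n → Space n} (hΦ : IsDiffeoGerm c Φ) (ω : TwoForm n) :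
    kerAtZero (pullback Φ ω) = (kerAtZero ω).comap (fderiv ℝ Φ 0).toLinearMap := by
  have : powAt (pullback Φ ω) (n - 1) 0 =
      (powAt ω (n - 1) 0).compLinearMap (fderiv ℝ Φ 0).toLinearMap := by
    have := formPow_compLinearMap (ω (Φ 0)).toAlternatingMap (fderiv ℝ Φ 0).toLinearMap (n - 1)
    rw [hΦ.map_zero] at this
    rw [powAt, pullback, hΦ.map_zero]
    exact this
  rw [kerAtZero, this, formKer_compLinearMap _ hΦ.bijective_fderiv.2]
  rfl

theorem structurallySmooth_pullback {Φ : Space n → Space n} (hΦ : IsDiffeoGerm c Φ)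
    {ω : TwoForm n} (hr : RegularAt c ω 0) (hs : StructurallySmooth ω) :
    StructurallySmooth (pullback Φ ω) := by
  refine ⟨?_, fun h => hs.fderiv_ne_zero ?_⟩
  · rw [martinetFun_pullback, hΦ.map_zero, hs.apply_zero, mul_zero]
  · rw [fderiv_martinetFun_pullback hΦ hr hs] at h
    ext u
    obtain ⟨w, rfl⟩ := hΦ.bijective_fderiv.2 u
    have := congrArg (fun M => M w) h
    exact (mul_eq_zero.1 this).resolve_left hΦ.eventually_det_ne_zero.self_of_nhds

/-- The data are invariant under diffeomorphism germs. -/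
theorem carriesData_of_pullback {ω₀ ω₁ : TwoForm n} (hr₁ : RegularAt c ω₁ 0)
    (hs₁ : StructurallySmooth ω₁) {Ψ : Space n → Space n} (hΨ : IsDiffeoGerm c Ψ)
    (h : pullback Ψ ω₁ =ᶠ[𝓝 0] ω₀) : CarriesData c hn Ψ ω₀ ω₁ := by
  -- The canonical pair for ω₀ is taken to be the pullback of this one, which makes the comparison
  -- of orientations tautological.
  obtain ⟨f, Θ, hfΘ⟩ := exists_canonicalVolume (c := c) hn hr₁ hs₁
  refine ⟨?_, ?_, ⟨_, _, f, Θ, (hfΘ.pullback hΨ).congr h, hfΘ, ?_⟩, ?_⟩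
  · filter_upwards [martinetFun_congr h, mem_martinet_pullback (ω := ω₁) hΨ] with x hx hx'
    rw [← hx', mem_martinet_iff, mem_martinet_iff, hx]
  · filter_upwards [h] with p hp _ u _ v _
    rw [← hp]
    exact formBilin_pullback Ψ ω₁ p u v
  · exact Eventually.of_forall fun p _ e _ => Iff.rfl
  · have : kerAtZero ω₀ = kerAtZero (pullback Ψ ω₁) := by
      rw [kerAtZero, kerAtZero, powAt, powAt, h.self_of_nhds]
    rw [this, kerAtZero_pullback hΨ, Submodule.map_comap_eq_of_surjective hΨ.bijective_fderiv.2]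

/-- Germs with the same Martinet hypersurface, pullback, orientation and kernel are equivalent. -/
theorem equivalent_of_sameOrientation {ω₀ ω₁ : TwoForm n} {f₀ f₁ : Space n → ℝ}
    {Θ₀ Θ₁ : Space n → Space n [⋀^Fin (2 * n - 1)]→L[ℝ] ℝ}
    (hr₀ : RegularAt c ω₀ 0) (hr₁ : RegularAt c ω₁ 0)
    (hcl₀ : ∀ᶠ x in 𝓝 (0 : Space n), extDeriv ω₀ x = 0)
    (hcl₁ : ∀ᶠ x in 𝓝 (0 : Space n), extDeriv ω₁ x = 0)
    (hs₀ : StructurallySmooth ω₀) (hs₁ : StructurallySmooth ω₁)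
    (hz : ∀ᶠ x in 𝓝 (0 : Space n), x ∈ martinet ω₀ → x ∈ martinet ω₁)
    (h₀ : IsCanonicalVolume c hn ω₀ f₀ Θ₀) (h₁ : IsCanonicalVolume c hn ω₁ f₁ Θ₁)
    (h : ∀ e : Fin (2 * n - 1) → Space n, (∀ i, e i ∈ tangent ω₀ 0) →
      (0 < Θ₀ 0 e ↔ 0 < Θ₁ 0 e))
    (hres : SamePullback ω₀ ω₁) (hker : kerAtZero ω₀ = kerAtZero ω₁) : Equivalent c ω₀ ω₁ := by
  rw [kerAtZero_eq_formKer hn hr₀.differentiableAt hs₀,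
    kerAtZero_eq_formKer hn hr₁.differentiableAt hs₁] at hker
  exact equivalent_of_same_data hr₀ hr₁ hcl₀ hcl₁ hs₀ hs₁ hz hker hres
    (exists_pos_of_orientation hr₀ hr₁ hs₀ hs₁ hz h₀ h₁ h)

/-- Replacing ω₁ by its pullback under Φ turns transported data into equal data on a common
hypersurface. -/
theorem equivalent_of_carriesData {ω₀ ω₁ : TwoForm n} (h₀ : IsSingularSymplectic c ω₀)
    (h₁ : IsSingularSymplectic c ω₁) (hs₀ : StructurallySmooth ω₀) (hs₁ : StructurallySmooth ω₁)
    {Φ : Space n → Space n} (hΦ : IsDiffeoGerm c Φ) (h : CarriesData c hn Φ ω₀ ω₁) :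
    Equivalent c ω₀ ω₁ := by
  have hr₁ : RegularAt c ω₁ 0 := h₁.regular
  obtain ⟨f₀, Θ₀, f₁, Θ₁, hv₀, hv₁, hor⟩ := h.orientation
  refine Equivalent.trans (ω₁ := pullback Φ ω₁) ?_ (equivalent_pullback hΦ)
  refine equivalent_of_sameOrientation h₀.regular (regularAt_pullback hr₁ hΦ) h₀.closed
    (closed_pullback hr₁ h₁.closed hΦ) hs₀ (structurallySmooth_pullback hΦ hr₁ hs₁) ?_ hv₀
    (hv₁.pullback hΦ)
    (hor.self_of_nhds (mem_martinet_iff.2 hs₀.apply_zero)) ?_ ?_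
  · filter_upwards [h.hypersurface, mem_martinet_pullback (ω := ω₁) hΦ] with x h1 h2 hx
    exact h2.2 (h1.1 hx)
  · filter_upwards [h.form] with p hp hpm u hu v hv
    exact (hp hpm u hu v hv).trans (formBilin_pullback Φ ω₁ p u v).symm
  · rw [kerAtZero_pullback hΦ, ← h.kernel,
      Submodule.comap_map_eq_of_injective hΦ.bijective_fderiv.1]

end Invariants

end SingularSymplectic

theorem mainTheorem2 (n : ℕ) (hn : 1 ≤ n) (c : SingularSymplectic.Category) :
    -- forms with a common hypersurface and the same data are equivalent
    (∀ ω₀ ω₁ : SingularSymplectic.TwoForm n,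
      SingularSymplectic.IsSingularSymplectic c ω₀ →
      SingularSymplectic.IsSingularSymplectic c ω₁ →
      SingularSymplectic.StructurallySmooth ω₀ →
      SingularSymplectic.StructurallySmooth ω₁ →
      SingularSymplectic.martinet ω₀ =ᶠ[𝓝 0] SingularSymplectic.martinet ω₁ →
      SingularSymplectic.formRank (SingularSymplectic.restrictAt ω₀ 0) =
        SingularSymplectic.formRank (SingularSymplectic.restrictAt ω₁ 0) →
      SingularSymplectic.formRank (SingularSymplectic.restrictAt ω₁ 0) ≤ 2 * n - 2 →
      SingularSymplectic.SameOrientation c hn ω₀ ω₁ →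
      SingularSymplectic.SamePullback ω₀ ω₁ →
      SingularSymplectic.kerAtZero ω₀ = SingularSymplectic.kerAtZero ω₁ →
      ∃ Ψ : SingularSymplectic.Space n → SingularSymplectic.Space n,
        SingularSymplectic.IsDiffeoGerm c Ψ ∧ SingularSymplectic.pullback Ψ ω₁ =ᶠ[𝓝 0] ω₀) ∧
    -- the data are invariants, and they form a complete set of invariants
    (∀ ω₀ ω₁ : SingularSymplectic.TwoForm n,
      SingularSymplectic.IsSingularSymplectic c ω₀ →
      SingularSymplectic.IsSingularSymplectic c ω₁ →
      SingularSymplectic.StructurallySmooth ω₀ →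
      SingularSymplectic.StructurallySmooth ω₁ →
      (∀ Ψ : SingularSymplectic.Space n → SingularSymplectic.Space n,
        SingularSymplectic.IsDiffeoGerm c Ψ → SingularSymplectic.pullback Ψ ω₁ =ᶠ[𝓝 0] ω₀ →
          SingularSymplectic.CarriesData c hn Ψ ω₀ ω₁) ∧
      ((∃ Φ : SingularSymplectic.Space n → SingularSymplectic.Space n,
        SingularSymplectic.IsDiffeoGerm c Φ ∧ SingularSymplectic.CarriesData c hn Φ ω₀ ω₁) →
          SingularSymplectic.Equivalent c ω₀ ω₁)) := by
  refine ⟨fun ω₀ ω₁ h₀ h₁ hs₀ hs₁ hz _ _ ho hres hker => ?_, fun ω₀ ω₁ h₀ h₁ hs₀ hs₁ =>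
    ⟨fun Ψ hΨ h => SingularSymplectic.carriesData_of_pullback h₁.regular hs₁ hΨ h,
      fun ⟨Φ, hΦ, h⟩ => SingularSymplectic.equivalent_of_carriesData h₀ h₁ hs₀ hs₁ hΦ h⟩⟩
  obtain ⟨f₀, Θ₀, f₁, Θ₁, hv₀, hv₁, hor⟩ := ho
  exact SingularSymplectic.equivalent_of_sameOrientation h₀.regular h₁.regular h₀.closed h₁.closed
    hs₀ hs₁ (hz.mem_iff.mono fun x hx => hx.1) hv₀ hv₁
    (hor.self_of_nhds (SingularSymplectic.mem_martinet_iff.2 hs₀.apply_zero)) hres hker
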